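/- Let $H>\tfrac12$, $T>0$, let $B$ be a one-dimensional Brownian motion, and consider the model $X_t=x_0+\int_0^t K(t,r)V(X_r)\circ dB_r$ with $K(t,r)=(t-r)^{H-1/2}$, together with a function $G$, where $G\in C^4(\mathbb R)$ and $V\in C^3(\mathbb R)$. For $n\ge 1$ let $\mathcal S_n$ be the set of $\vec\kappa=(\kappa_1,\dots,\kappa_n)$ with $\kappa_l\in\{0,\dots,l-1\}$. For $\vec\kappa\in\mathcal S_n$ let $c_\alpha=\#\{l:\kappa_l=\alpha\}$ and put, with $t_0:=T$, $$\mathcal V_0(\vec\kappa;x)=G^{(c_0)}(x)\prod_{\alpha=1}^n V^{(c_\alpha)}(x),\qquad \mathcal K(\vec\kappa;\vec t\,)=\prod_{l=1}^n K(t_{\kappa_l},t_l).$$ Let $\bar{\mathbb V}_N$ be the set of all functions $\mathcal V_0(\vec\kappa;\cdot)$ with $\vec\kappa\in\mathcal S_n$, $1\le n\le N$, $n$ even, and for $\phi\in\bar{\mathbb V}_N$ let $$\bar\Gamma^\phi_N=\sum_{\substack{1\le n\le N\\ n\ \mathrm{even}}}\ \sum_{\vec\kappa\in\mathcal S_n}\mathbf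 1_{\{\mathcal V_0(\vec\kappa;\cdot)=\phi\}}\int_{0\le t_n\le\cdots\le t_1\le T}\mathcal K(\vec\kappa;\vec t\,)\circ dB_{t_n}\circ\cdots\circ dB_{t_1},$$ where the integrals are iterated Stratonovich integrals (limits in $L^2$ of trapezoidal sums as the mesh of the partition tends to $0$). Let $$\phi_1=G^{(4)}V^4,\quad \phi_2=G^{(3)}V'V^3,\quad \phi_3=G''V''V^3,\quad \phi_4=G''(V')^2V^2,$$ $$\phi_5=G'V^{(3)}V^3,\quad \phi_6=G'V''V'V^2,\quad \phi_7=G'(V')^3V .$$ (i) If none of $\phi_1,\dots,\phi_7$ equals one of the functions $G''V^2$, $G'V'V$, then $\bar{\mathbb V}_5\setminus\bar{\mathbb V}_3=\{\phi_1,\dots,\phi_7\}$. (ii) Let $\alpha\in\{1,\dots,7\}$ be such that $\phi_\alpha$ differs, as a function, from the six other $\phi_\beta$ and from $G''V^2$ and $G'V'V$. Then, for $N\in\{4,5\}$, the random variable $\bar\Gamma^{\phi_\alpha}_N$ exists, is integrable, and $\gamma^{\phi_\alpha}:=\mathbb E[\bar\Gamma^{\phi_\alpha}_N]$ is given by $$\gamma^{\phi_1}=\frac{T^{4H}}{32H^2},\qquad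 \gamma^{\phi_2}=\frac{T^{4H}}{4H}\,\mathrm B\!\left(2H,H+\tfrac12\right),\qquad \gamma^{\phi_3}=\gamma^{\phi_4}=\frac{T^{4H}}{4H}\,\mathrm B(2H,2H+1),$$ $$\gamma^{\phi_5}=\gamma^{\phi_6}=\gamma^{\phi_7}=0,$$ where $\mathrm B(a,b)=\int_0^1(1-t)^{a-1}t^{b-1}\,dt$. -/

import Mathlib

open MeasureTheory ProbabilityTheory
open scoped NNReal

noncomputable section

namespace VolterraSignature

/-! ### Iterated Stratonovich integrals against a Brownian motion -/

section Stratonovich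

variable {Ω : Type*} [MeasurableSpace Ω]

/-- The trapezoidal sum of `Y` against `B` along the points `τ 0, …, τ k`. -/
def trapezoidSum (B Y : ℝ≥0 → Ω → ℝ) (k : ℕ) (τ : ℕ → ℝ≥0) (ω : Ω) : ℝ :=
  ∑ i ∈ Finset.range k,
    (Y (τ i) ω + Y (τ (i + 1)) ω) / 2 * (B (τ (i + 1)) ω - B (τ i) ω)

/-- `I` is (a version of) the Stratonovich integral `∫_0^s Y_t ∘ dB_t`: the trapezoidal sums along
the partitions `0 = τ 0 ≤ ⋯ ≤ τ k = s` converge to `I` in `L²(P)` as the mesh tends to `0`. -/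
def IsStratonovichIntegral (B : ℝ≥0 → Ω → ℝ) (P : Measure Ω) (s : ℝ≥0) (Y : ℝ≥0 → Ω → ℝ)
    (I : Ω → ℝ) : Prop :=
  MemLp I 2 P ∧
    ∀ ε : ℝ, 0 < ε → ∃ δ : ℝ, 0 < δ ∧
      ∀ (k : ℕ) (τ : ℕ → ℝ≥0), Monotone τ → τ 0 = 0 → τ k = s →
        (∀ i < k, (τ (i + 1) : ℝ) - (τ i : ℝ) ≤ δ) →
          eLpNorm (fun ω => trapezoidSum B Y k τ ω - I ω) 2 P ≤ ENNReal.ofReal ε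

/-- `I` is (a version of) the iterated Stratonovich integral
`∫_{0 ≤ t_n ≤ ⋯ ≤ t_1 ≤ s} f(t_1, …, t_n) ∘ dB_{t_n} ∘ ⋯ ∘ dB_{t_1}`
of a deterministic integrand: one integrates over `t_n` first and over `t_1` last, and
`Y t` below is the inner integral over `0 ≤ t_n ≤ ⋯ ≤ t_2 ≤ t` for `t_1 = t`. -/
def IsIteratedStratonovich (B : ℝ≥0 → Ω → ℝ) (P : Measure Ω) :
    (n : ℕ) → ((Fin n → ℝ≥0) → ℝ) → ℝ≥0 → (Ω → ℝ) → Prop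
  | 0, f, _, I => I =ᵐ[P] fun _ => f Fin.elim0
  | n + 1, f, s, I =>
      ∃ Y : ℝ≥0 → Ω → ℝ,
        (∀ t ≤ s, IsIteratedStratonovich B P n
          (fun r : Fin n → ℝ≥0 => f (Fin.cons t r)) t (Y t)) ∧
        IsStratonovichIntegral B P s Y I

end Stratonovich

/-! ### The index maps, kernels and coefficient functions of the one dimensional model -/

/-- The index maps `κ = (κ_1, …, κ_n)` with `κ_l ∈ {0, …, l - 1}`. The entry `κ l` with
`l : Fin n` is the mathematical `κ_{l+1} ∈ {0, …, l}`. -/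
abbrev IndexMap (n : ℕ) : Type := (l : Fin n) → Fin (l.val + 1)

/-- The number of elements of `{l ∈ {1, …, n} : κ_l = a}`, for `a ∈ {0, …, n}`. -/
def IndexMap.count {n : ℕ} (κ : IndexMap n) (a : ℕ) : ℕ :=
  (Finset.univ.filter fun l : Fin n => (κ l : ℕ) = a).card

/-- The kernel `K(t, r) = (t - r)^{H - 1/2}`, used for `r ≤ t`. -/
def volterraKernel (H : ℝ) (t r : ℝ≥0) : ℝ := ((t : ℝ) - (r : ℝ)) ^ (H - 1 / 2)

/-- `∏_{l=1}^n K(t_{κ_l}, t_l)`, where `t_0 = T`. -/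
def kernelProd (H : ℝ) (T : ℝ≥0) {n : ℕ} (κ : IndexMap n) (t : Fin n → ℝ≥0) : ℝ :=
  ∏ l : Fin n,
    volterraKernel H
      ((Fin.cons T t : Fin (n + 1) → ℝ≥0) (Fin.castLE (by omega) (κ l))) (t l)

/-- The function `x ↦ (∏_{a=1}^n V^{(c_a)}(x)) · G^{(c_0)}(x)`, where `c_a` is the number of
`l` with `κ_l = a`. -/
def coeffFun (G V : ℝ → ℝ) {n : ℕ} (κ : IndexMap n) : ℝ → ℝ := fun x =>
  (∏ a : Fin n, iteratedDeriv (κ.count (a.val + 1)) V x) * iteratedDeriv (κ.count 0) G x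

/-- The orders `1 ≤ n ≤ N` which carry an index `j = (1, …, 1) ∈ {1}^n` in which `1` occurs an
even number of times (the model has no `dt` term, so the index `0` does not occur). -/
def evenOrders (N : ℕ) : Finset ℕ := (Finset.Icc 1 N).filter fun n => Even n

/-- The set of coefficient functions of even order at most `N`. -/
def coeffSet (G V : ℝ → ℝ) (N : ℕ) : Set (ℝ → ℝ) :=
  {φ | ∃ n ∈ evenOrders N, ∃ κ : IndexMap n, coeffFun G V κ = φ}

open Classical in
/-- `Γ` is (a version of) the signature component of `φ` at order `N`: the sum, over all even
orders `n ≤ N` and all index maps `κ` whose coefficient function is `φ`, of the iterated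
Stratonovich integrals of `kernelProd H T κ` over `0 ≤ t_n ≤ ⋯ ≤ t_1 ≤ T`. -/
def IsSignatureComponent {Ω : Type*} [MeasurableSpace Ω] (B : ℝ≥0 → Ω → ℝ) (P : Measure Ω)
    (H : ℝ) (T : ℝ≥0) (G V : ℝ → ℝ) (N : ℕ) (φ : ℝ → ℝ) (Γ : Ω → ℝ) : Prop :=
  ∃ J : (n : ℕ) → IndexMap n → Ω → ℝ,
    (∀ n ∈ evenOrders N, ∀ κ : IndexMap n,
      IsIteratedStratonovich B P n (kernelProd H T κ) T (J n κ)) ∧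
    Γ =ᵐ[P] fun ω =>
      ∑ n ∈ evenOrders N, ∑ κ : IndexMap n, if coeffFun G V κ = φ then J n κ ω else 0

/-! ### The explicit functions and values -/

/-- The two functions of order two: `G'' V²` and `G' V' V`. -/
def orderTwoFun (G V : ℝ → ℝ) : Fin 2 → ℝ → ℝ :=
  ![fun x => iteratedDeriv 2 G x * V x ^ 2,
    fun x => deriv G x * deriv V x * V x]

/-- The seven functions of order four. -/
def orderFourFun (G V : ℝ → ℝ) : Fin 7 → ℝ → ℝ :=
  ![fun x => iteratedDeriv 4 G x * V x ^ 4,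
    fun x => iteratedDeriv 3 G x * deriv V x * V x ^ 3,
    fun x => iteratedDeriv 2 G x * iteratedDeriv 2 V x * V x ^ 3,
    fun x => iteratedDeriv 2 G x * deriv V x ^ 2 * V x ^ 2,
    fun x => deriv G x * iteratedDeriv 3 V x * V x ^ 3,
    fun x => deriv G x * iteratedDeriv 2 V x * deriv V x * V x ^ 2,
    fun x => deriv G x * deriv V x ^ 3 * V x]

/-- The Beta function `∫_0^1 (1 - t)^{a-1} t^{b-1} dt`, for `a, b > 0`. -/
def betaFun (a b : ℝ) : ℝ := ∫ t in (0 : ℝ)..1, (1 - t) ^ (a - 1) * t ^ (b - 1)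

/-- The seven expected signature components of order four. -/
def orderFourValue (H : ℝ) (T : ℝ≥0) : Fin 7 → ℝ :=
  ![(T : ℝ) ^ (4 * H) / (32 * H ^ 2),
    (T : ℝ) ^ (4 * H) / (4 * H) * betaFun (2 * H) (H + 1 / 2),
    (T : ℝ) ^ (4 * H) / (4 * H) * betaFun (2 * H) (2 * (H + 1 / 2)),
    (T : ℝ) ^ (4 * H) / (4 * H) * betaFun (2 * H) (2 * (H + 1 / 2)),
    0, 0, 0]

end VolterraSignature

end

noncomputable section

namespace VolterraSignature

/-! ### Moments of the increments of a Brownian motion -/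

/-! The analytic core turns iterated Stratonovich integrals into Itô and time integrals. For a
continuous integrand $f$, let $S_n f(s)$ be defined by `strat`, that is, $$S_{n+2}f(s)=\int_0^s
S_{n+1}f(t,\cdot)\,dB_t+\tfrac12\int_0^s S_nf(t,t,\cdot)\,dt .$$ `isIteratedStratonovich_strat`
shows that this is the iterated Stratonovich integral, and `IsIteratedStratonovich.unique` shows
that there is no other up to null sets. Itô integrals have mean zero, so two applications of the
recursion give (`expect_strat_four`) $$\mathbb E[S_4f(T)]=\tfrac14\int_0^T\!\int_0^t
f(t,t,r,r)\,dr\,dt .$$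

The passage from trapezoidal sums to this formula is `isStratonovichIntegral_of_expansion`: if
$Y_b-Y_a=A+Z_a(B_b-B_a)+R$ with $A$ small and known at time $a$, and $R=o(\sqrt{b-a})$, then $\int
Y\circ dB=\int Y\,dB+\tfrac12\int Z\,dt$. Everything is done in $L^4$, because the remainder $R$ is
not independent of the increment of $B$ that it multiplies, and a product of two $L^4$ variables is
in $L^2$. The Itô integral is built from left-point sums; a bound on fourth moments that adds up
over consecutive intervals (`IsMartIncr`) plays the role of the Itô isometry.

The rest is combinatorics and calculus. There are 24 index maps of order four. Their coefficient
functions are the seven $\phi_\alpha$ (`coeffFun_four`). Since $H>\tfrac12$, the kernel vanishes at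
$t=r$, so the integrand at $(t,t,r,r)$ is zero when $\kappa_2=1$ or $\kappa_4=3$. Nine maps survive,
with only three distinct integrands (`posKernelProd_diag`, `card_shape_kind`), whose integrals over
the triangle are Beta integrals (`timeInt_diagKernel`). For $\phi_5,\phi_6,\phi_7$ only the first
derivative of $G$ occurs, which forces $\kappa_2=1$; hence the value $0$. -/

lemma gaussianReal_moment_two (v : ℝ≥0) : ∫ x, x ^ 2 ∂(gaussianReal 0 v) = v := by
  have h := variance_fun_id_gaussianReal (μ := 0) (v := v)
  rw [variance_eq_integral measurable_id'.aemeasurable] at h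
  simpa using h

lemma gaussianReal_moment_three (v : ℝ≥0) : ∫ x, x ^ 3 ∂(gaussianReal 0 v) = 0 := by
  have h := gaussianReal_map_neg (μ := 0) (v := v)
  have h2 : ∫ x, x ^ 3 ∂((gaussianReal 0 v).map (fun x ↦ -x)) = ∫ x, (-x) ^ 3 ∂(gaussianReal 0 v) :=
    integral_map (by fun_prop) (by fun_prop)
  rw [h] at h2
  have h3 : ∀ x : ℝ, (-x) ^ 3 = - x ^ 3 := fun x => by ring
  simp only [h3, integral_neg, neg_zero] at h2
  linarith

/-- The moment is the fourth derivative at $0$ of the moment generating function $e^{vt^2/2}$. Each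
derivative keeps the form polynomial times exponential, with $p\mapsto p'+vtp$ on the polynomial;
`key` is this rule. -/
lemma gaussianReal_moment_four (v : ℝ≥0) : ∫ x, x ^ 4 ∂(gaussianReal 0 v) = 3 * (v : ℝ) ^ 2 := by
  have h : ∫ x, x ^ 4 ∂(gaussianReal 0 v)
      = iteratedDeriv 4 (mgf (fun x ↦ x) (gaussianReal 0 v)) 0 := by
    rw [iteratedDeriv_mgf_zero] <;> simp
  rw [h, mgf_fun_id_gaussianReal]
  have key : ∀ (p p' q : ℝ → ℝ), (∀ t, HasDerivAt p (p' t) t) →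
      (∀ t, p' t + v * t * p t = q t) →
      deriv (fun t : ℝ => p t * Real.exp (0 * t + v * t ^ 2 / 2))
        = fun t => q t * Real.exp (0 * t + v * t ^ 2 / 2) := by
    intro p p' q hp hq
    ext t
    have h1 : HasDerivAt (fun t : ℝ => 0 * t + v * t ^ 2 / 2) (v * t) t := by
      have h2 : HasDerivAt (fun t : ℝ => 0 * t + v * t ^ 2 / 2)
          (0 * 1 + v * ((2 : ℕ) * t ^ (2 - 1)) / 2) t :=
        ((hasDerivAt_id' t).const_mul (0 : ℝ)).add
          (((hasDerivAt_pow 2 t).const_mul (v : ℝ)).div_const 2)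
      refine h2.congr_deriv ?_
      norm_num
      ring
    have h3 : HasDerivAt (fun t : ℝ => p t * Real.exp (0 * t + v * t ^ 2 / 2)) _ t :=
      (hp t).mul h1.exp
    rw [h3.deriv, ← hq]
    ring
  have e0 : (fun t : ℝ => Real.exp (0 * t + v * t ^ 2 / 2))
      = fun t : ℝ => (1 : ℝ) * Real.exp (0 * t + v * t ^ 2 / 2) := by simp
  simp only [iteratedDeriv_succ, iteratedDeriv_zero]
  rw [e0, key (fun _ => 1) (fun _ => 0) (fun t => v * t) (fun t => hasDerivAt_const t 1)
      (fun t => by ring),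
    key (fun t => v * t) (fun t => v) (fun t => v + v ^ 2 * t ^ 2)
      (fun t => by simpa using (hasDerivAt_id' t).const_mul (v : ℝ)) (fun t => by ring),
    key (fun t => v + v ^ 2 * t ^ 2) (fun t => v ^ 2 * (2 * t))
      (fun t => 3 * v ^ 2 * t + v ^ 3 * t ^ 3)
      (fun t => by
        simpa using ((hasDerivAt_pow 2 t).const_mul ((v : ℝ) ^ 2)).const_add (v : ℝ))
      (fun t => by ring),
    key (fun t => 3 * v ^ 2 * t + v ^ 3 * t ^ 3) (fun t => 3 * v ^ 2 * 1 + v ^ 3 * (3 * t ^ 2))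
      (fun t => 3 * v ^ 2 + 6 * v ^ 3 * t ^ 2 + v ^ 4 * t ^ 4)
      (fun t => by
        have := ((hasDerivAt_id' t).const_mul (3 * (v : ℝ) ^ 2)).add
          ((hasDerivAt_pow 3 t).const_mul ((v : ℝ) ^ 3))
        exact this.congr_deriv (by norm_num))
      (fun t => by ring)]
  simp

/-! ### The filtration generated by the process. -/

section Past

variable {Ω : Type*} {B : ℝ≥0 → Ω → ℝ}

/-- The σ-algebra generated by `B s` for `s ≤ t`. -/
@[reducible] def past (B : ℝ≥0 → Ω → ℝ) (t : ℝ≥0) : MeasurableSpace Ω :=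
  MeasurableSpace.comap (fun ω (s : Set.Iic t) => B s ω) inferInstance

lemma measurable_past {s t : ℝ≥0} (hst : s ≤ t) : Measurable[past B t] (B s) := by
  have h : Measurable[past B t] (fun ω (s : Set.Iic t) => B s ω) := comap_measurable _
  exact (measurable_pi_apply (⟨s, hst⟩ : Set.Iic t)).comp h

lemma past_mono {s t : ℝ≥0} (hst : s ≤ t) : past B s ≤ past B t := by
  apply Measurable.comap_le
  exact @measurable_pi_lambda _ _ _ (past B t) _ _ fun u => measurable_past (u.2.trans hst)

end Past

/-! ### Laws of increments and their independence of the past. -/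

section Increments

variable {Ω : Type*} [MeasurableSpace Ω] {P : Measure Ω} {B : ℝ≥0 → Ω → ℝ}

lemma hasLaw_increment (hB : IsPreBrownianReal B P) {a b : ℝ≥0} (hab : a ≤ b) :
    HasLaw (fun ω => B b ω - B a ω) (gaussianReal 0 (b - a)) P := by
  have h := hB.hasLaw_sub b a
  have e : nndist b.1 a.1 = b - a := by
    apply NNReal.coe_injective
    rw [coe_nndist, Real.dist_eq, NNReal.coe_sub hab]
    exact abs_of_nonneg (sub_nonneg.2 (NNReal.coe_le_coe.2 hab))
  rwa [e] at h

lemma integral_increment_comp (hB : IsPreBrownianReal B P) {a b : ℝ≥0} (hab : a ≤ b)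
    (g : ℝ → ℝ) (hg : Measurable g) :
    ∫ ω, g (B b ω - B a ω) ∂P = ∫ x, g x ∂(gaussianReal 0 (b - a)) := by
  have h := hasLaw_increment hB hab
  rw [← h.map_eq, integral_map h.aemeasurable hg.aestronglyMeasurable]

lemma integral_increment (hB : IsPreBrownianReal B P) {a b : ℝ≥0} (hab : a ≤ b) :
    ∫ ω, (B b ω - B a ω) ∂P = 0 := by
  rw [integral_increment_comp hB hab (fun x => x) measurable_id]; simp

lemma integral_increment_sq (hB : IsPreBrownianReal B P) {a b : ℝ≥0} (hab : a ≤ b) :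
    ∫ ω, (B b ω - B a ω) ^ 2 ∂P = (b : ℝ) - a := by
  rw [integral_increment_comp hB hab (fun x => x ^ 2) (by fun_prop), gaussianReal_moment_two,
    NNReal.coe_sub hab]

lemma integral_increment_cube (hB : IsPreBrownianReal B P) {a b : ℝ≥0} (hab : a ≤ b) :
    ∫ ω, (B b ω - B a ω) ^ 3 ∂P = 0 := by
  rw [integral_increment_comp hB hab (fun x => x ^ 3) (by fun_prop), gaussianReal_moment_three]

lemma integral_increment_four (hB : IsPreBrownianReal B P) {a b : ℝ≥0} (hab : a ≤ b) :
    ∫ ω, (B b ω - B a ω) ^ 4 ∂P = 3 * ((b : ℝ) - a) ^ 2 := by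
  rw [integral_increment_comp hB hab (fun x => x ^ 4) (by fun_prop), gaussianReal_moment_four,
    NNReal.coe_sub hab]

lemma memLp_increment (hB : IsPreBrownianReal B P) (a b : ℝ≥0) (p : ℝ≥0) :
    MemLp (fun ω => B b ω - B a ω) p P := by
  have h := hB.hasLaw_sub b a
  have h2 := memLp_id_gaussianReal (μ := 0) (v := nndist b.1 a.1) p
  rw [← h.map_eq] at h2
  exact (memLp_map_measure_iff (by fun_prop) h.aemeasurable).1 h2

lemma integrable_increment_pow (hB : IsPreBrownianReal B P) (a b : ℝ≥0) (n : ℕ) :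
    Integrable (fun ω => (B b ω - B a ω) ^ n) P := by
  have : IsProbabilityMeasure P := hB.isGaussianProcess.isProbabilityMeasure
  have h := (memLp_increment hB a b n).integrable_norm_pow'
  rw [← integrable_norm_iff]
  · simpa using h
  · exact (memLp_increment hB a b 1).1.pow n

lemma past_le (hm : ∀ t, Measurable (B t)) (t : ℝ≥0) : past B t ≤ ‹MeasurableSpace Ω› :=
  Measurable.comap_le (measurable_pi_lambda _ fun s => hm s)

/-- The shifted process $B_{a+\cdot}-B_a$ is independent of $(B_t)_{t\le a}$; the increment is its
value at time $b-a$. -/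
lemma indep_past (hB : IsPreBrownianReal B P) {a b : ℝ≥0} (hab : a ≤ b)
    {X : Ω → ℝ} (hX : StronglyMeasurable[past B a] X) :
    IndepFun X (fun ω => B b ω - B a ω) P := by
  have h := hB.indepFun_shift a
  have h2 : IndepFun (fun ω => B b ω - B a ω) (fun ω (t : Set.Iic a) => B t ω) P := by
    have := h.comp (measurable_pi_apply (b - a)) measurable_id
    simpa [Function.comp_def, add_tsub_cancel_of_le hab] using this
  rw [IndepFun_iff_Indep] at h2 ⊢
  exact indep_of_indep_of_le_left h2.symm hX.measurable.comap_le

lemma integral_past_mul (hB : IsPreBrownianReal B P) (hm : ∀ t, Measurable (B t))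
    {a b : ℝ≥0} (hab : a ≤ b)
    {X : Ω → ℝ} (hX : AEStronglyMeasurable[past B a] X P) {g : ℝ → ℝ} (hg : Measurable g) :
    ∫ ω, X ω * g (B b ω - B a ω) ∂P = (∫ ω, X ω ∂P) * ∫ ω, g (B b ω - B a ω) ∂P := by
  obtain ⟨X', hX', hXX'⟩ := hX
  have h := (indep_past hB hab hX').comp measurable_id hg
  have e1 : ∫ ω, X ω * g (B b ω - B a ω) ∂P = ∫ ω, X' ω * g (B b ω - B a ω) ∂P := by
    apply integral_congr_ae
    filter_upwards [hXX'] with ω hω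
    rw [hω]
  rw [e1, integral_congr_ae hXX']
  exact h.integral_fun_mul_eq_mul_integral (hX'.mono (past_le hm a)).aestronglyMeasurable
    (hg.comp ((hm b).sub (hm a))).aestronglyMeasurable

lemma integrable_past_mul (hB : IsPreBrownianReal B P)
    {a b : ℝ≥0} (hab : a ≤ b)
    {X : Ω → ℝ} (hX : AEStronglyMeasurable[past B a] X P) (hXi : Integrable X P)
    {g : ℝ → ℝ} (hg : Measurable g) (hgi : Integrable (fun ω => g (B b ω - B a ω)) P) :
    Integrable (fun ω => X ω * g (B b ω - B a ω)) P := by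
  obtain ⟨X', hX', hXX'⟩ := hX
  have h := (indep_past hB hab hX').comp measurable_id hg
  have e1 : (fun ω => X' ω * g (B b ω - B a ω)) =ᵐ[P] (fun ω => X ω * g (B b ω - B a ω)) := by
    filter_upwards [hXX'] with ω hω
    rw [hω]
  refine Integrable.congr ?_ e1
  exact h.integrable_mul (hXi.congr hXX') hgi

end Increments

/-! ### Fourth moments -/

instance fact_one_le_four_ennreal : Fact ((1 : ENNReal) ≤ 4) := ⟨by norm_num⟩

section FourthMoment

variable {Ω : Type*} [MeasurableSpace Ω] {P : Measure Ω}

lemma memLp_four_iff {f : Ω → ℝ} (hf : AEStronglyMeasurable f P) :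
    MemLp f 4 P ↔ Integrable (fun ω => f ω ^ 4) P := by
  rw [← integrable_norm_rpow_iff hf (by norm_num) (by norm_num)]
  refine integrable_congr (.of_forall fun ω => ?_)
  have : (4 : ENNReal).toReal = ((4 : ℕ) : ℝ) := by norm_num
  simp only [this, Real.rpow_natCast, Real.norm_eq_abs]
  exact (even_two_mul 2).pow_abs (f ω)

lemma norm_pow_four (X : Lp ℝ 4 P) : ‖X‖ ^ 4 = ∫ ω, X ω ^ 4 ∂P := by
  rw [Lp.norm_def, (Lp.memLp X).eLpNorm_eq_integral_rpow_norm (by norm_num) (by norm_num)]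
  have : (4 : ENNReal).toReal = ((4 : ℕ) : ℝ) := by norm_num
  have e : ∀ ω, ‖X ω‖ ^ ((4 : ℕ) : ℝ) = X ω ^ 4 := fun ω => by
    rw [Real.rpow_natCast, Real.norm_eq_abs]
    exact (even_two_mul 2).pow_abs (X ω)
  simp only [this, e]
  have h0 : 0 ≤ ∫ ω, X ω ^ 4 ∂P := integral_nonneg fun ω => by positivity
  rw [ENNReal.toReal_ofReal (by positivity), ← Real.rpow_natCast, ← Real.rpow_mul h0]
  norm_num

lemma integrable_mul_pow {f g : Ω → ℝ} (hf : MemLp f 4 P) (hg : MemLp g 4 P) (i j : ℕ)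
    (hij : i + j = 4) : Integrable (fun ω => f ω ^ i * g ω ^ j) P := by
  refine Integrable.mono' (((memLp_four_iff hf.1).1 hf).add ((memLp_four_iff hg.1).1 hg))
    ((hf.1.pow i).mul (hg.1.pow j)) (.of_forall fun ω => ?_)
  rw [norm_mul, norm_pow, norm_pow, Real.norm_eq_abs, Real.norm_eq_abs, Pi.add_apply]
  have e1 : f ω ^ 4 = |f ω| ^ 4 := ((even_two_mul 2).pow_abs _).symm
  have e2 : g ω ^ 4 = |g ω| ^ 4 := ((even_two_mul 2).pow_abs _).symm
  rw [e1, e2]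
  have h1 := abs_nonneg (f ω)
  have h2 := abs_nonneg (g ω)
  have h3 : |f ω| ^ i * |g ω| ^ j ≤ (max |f ω| |g ω|) ^ 4 := by
    rw [← hij, pow_add]
    gcongr
    · exact le_max_left _ _
    · exact le_max_right _ _
  refine h3.trans ?_
  rcases max_cases |f ω| |g ω| with h | h
  · rw [h.1]; exact le_add_of_nonneg_right (by positivity)
  · rw [h.1]; exact le_add_of_nonneg_left (by positivity)

/-- Cauchy–Schwarz for the squares. -/
lemma integral_sq_mul_sq_le (X Y : Lp ℝ 4 P) :
    ∫ ω, X ω ^ 2 * Y ω ^ 2 ∂P ≤ ‖X‖ ^ 2 * ‖Y‖ ^ 2 := by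
  have hsq : ∀ Z : Lp ℝ 4 P, MemLp (fun ω => Z ω ^ 2) (ENNReal.ofReal 2) P := fun Z => by
    have h := (memLp_four_iff (Lp.memLp Z).1).1 (Lp.memLp Z)
    rw [show ENNReal.ofReal 2 = 2 by norm_num]
    refine (memLp_two_iff_integrable_sq ((Lp.memLp Z).1.pow 2)).2 (h.congr ?_)
    refine .of_forall fun ω => ?_
    simp only [Pi.pow_apply]
    ring
  have hint : ∀ Z : Lp ℝ 4 P, (∫ ω, (Z ω ^ 2) ^ (2 : ℝ) ∂P) ^ (1 / (2 : ℝ)) = ‖Z‖ ^ 2 := fun Z => by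
    have e : ∀ ω, (Z ω ^ 2) ^ (2 : ℝ) = Z ω ^ 4 := fun ω => by
      rw [Real.rpow_two]; ring
    simp only [e]
    rw [← norm_pow_four, ← Real.sqrt_eq_rpow, show ‖Z‖ ^ 4 = (‖Z‖ ^ 2) ^ 2 by ring,
      Real.sqrt_sq (by positivity)]
  have h := integral_mul_le_Lp_mul_Lq_of_nonneg (μ := P) (p := 2) (q := 2)
    Real.HolderConjugate.two_two (f := fun ω => X ω ^ 2) (g := fun ω => Y ω ^ 2)
    (.of_forall fun ω => by positivity) (.of_forall fun ω => by positivity) (hsq X) (hsq Y)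
  rwa [hint, hint] at h

end FourthMoment

/-! ### Products with increments of the Brownian motion -/

section MulIncr

variable {Ω : Type*} [MeasurableSpace Ω] {P : Measure Ω} {B : ℝ≥0 → Ω → ℝ}

/-- The elements of `L⁴(P)` that are measurable with respect to the past of `t`. -/
def pastL4 (B : ℝ≥0 → Ω → ℝ) (P : Measure Ω) (t : ℝ≥0) : Submodule ℝ (Lp ℝ 4 P) :=
  lpMeas ℝ ℝ (past B t) 4 P

lemma mem_pastL4 {t : ℝ≥0} {X : Lp ℝ 4 P} :
    X ∈ pastL4 B P t ↔ AEStronglyMeasurable[past B t] X P :=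
  mem_lpMeas_iff_aestronglyMeasurable

lemma pastL4_mono {s t : ℝ≥0} (hst : s ≤ t) : pastL4 B P s ≤ pastL4 B P t := fun X hX => by
  rw [mem_pastL4] at hX ⊢
  exact hX.mono (past_mono hst)

lemma isClosed_pastL4 (hm : ∀ t, Measurable (B t)) (t : ℝ≥0) :
    IsClosed (pastL4 B P t : Set (Lp ℝ 4 P)) := by
  have h := isClosed_aestronglyMeasurable (F := ℝ) (p := 4) (μ := P) (past_le hm t)
  convert h using 1
  ext X
  exact mem_pastL4

/-- The product `X (B_b - B_a)`, as an element of `L⁴(P)`. -/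
def mulIncr (B : ℝ≥0 → Ω → ℝ) (a b : ℝ≥0) (X : Lp ℝ 4 P) : Lp ℝ 4 P :=
  open Classical in
  if h : MemLp (fun ω => X ω * (B b ω - B a ω)) 4 P then h.toLp else 0

/-- Independence makes the fourth moment of the product factor. For an $X$ that is not adapted,
Hölder's inequality would only give a product in $L^2$. -/
lemma memLp_mul_increment (hB : IsPreBrownianReal B P) (hm : ∀ t, Measurable (B t))
    {a b : ℝ≥0} (hab : a ≤ b) {X : Lp ℝ 4 P} (hX : X ∈ pastL4 B P a) :
    MemLp (fun ω => X ω * (B b ω - B a ω)) 4 P := by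
  refine (memLp_four_iff ((Lp.aestronglyMeasurable X).mul
    ((hm b).sub (hm a)).aestronglyMeasurable)).2 ?_
  have h := integrable_past_mul hB hab (X := fun ω => X ω ^ 4) ((mem_pastL4.1 hX).pow 4)
    ((memLp_four_iff (Lp.memLp X).1).1 (Lp.memLp X)) (g := fun x => x ^ 4) (by fun_prop)
    (integrable_increment_pow hB a b 4)
  simpa only [Pi.mul_apply, Pi.sub_apply, mul_pow] using h

lemma coeFn_mulIncr (hB : IsPreBrownianReal B P) (hm : ∀ t, Measurable (B t))
    {a b : ℝ≥0} (hab : a ≤ b) {X : Lp ℝ 4 P} (hX : X ∈ pastL4 B P a) :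
    mulIncr B a b X =ᵐ[P] fun ω => X ω * (B b ω - B a ω) := by
  rw [mulIncr, dif_pos (memLp_mul_increment hB hm hab hX)]
  exact MemLp.coeFn_toLp _

lemma mulIncr_self (a : ℝ≥0) (X : Lp ℝ 4 P) : mulIncr B a a X = 0 := by
  have h : MemLp (fun ω => X ω * (B a ω - B a ω)) 4 P := by simp
  rw [mulIncr, dif_pos h]
  simp only [sub_self, mul_zero]
  exact MemLp.toLp_zero _

lemma mulIncr_mem (hB : IsPreBrownianReal B P) (hm : ∀ t, Measurable (B t))
    {a b : ℝ≥0} (hab : a ≤ b) {X : Lp ℝ 4 P} (hX : X ∈ pastL4 B P a) :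
    mulIncr B a b X ∈ pastL4 B P b := by
  rw [mem_pastL4]
  refine AEStronglyMeasurable.congr ?_ (coeFn_mulIncr hB hm hab hX).symm
  refine ((mem_pastL4.1 hX).mono (past_mono hab)).mul ?_
  exact (Measurable.sub (measurable_past le_rfl) (measurable_past hab)).aestronglyMeasurable

lemma mulIncr_add (hB : IsPreBrownianReal B P) (hm : ∀ t, Measurable (B t))
    {a b : ℝ≥0} (hab : a ≤ b) {X Y : Lp ℝ 4 P} (hX : X ∈ pastL4 B P a) (hY : Y ∈ pastL4 B P a) :
    mulIncr B a b (X + Y) = mulIncr B a b X + mulIncr B a b Y := by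
  apply Lp.ext
  filter_upwards [coeFn_mulIncr hB hm hab (add_mem hX hY), coeFn_mulIncr hB hm hab hX,
    coeFn_mulIncr hB hm hab hY, Lp.coeFn_add X Y,
    Lp.coeFn_add (mulIncr B a b X) (mulIncr B a b Y)] with ω h1 h2 h3 h4 h5
  rw [h1, h5, Pi.add_apply, h2, h3, h4, Pi.add_apply]
  ring

lemma mulIncr_sub (hB : IsPreBrownianReal B P) (hm : ∀ t, Measurable (B t))
    {a b : ℝ≥0} (hab : a ≤ b) {X Y : Lp ℝ 4 P} (hX : X ∈ pastL4 B P a) (hY : Y ∈ pastL4 B P a) :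
    mulIncr B a b (X - Y) = mulIncr B a b X - mulIncr B a b Y := by
  have h := mulIncr_add hB hm hab (sub_mem hX hY) hY
  rw [sub_add_cancel] at h
  rw [h, add_sub_cancel_right]

lemma mulIncr_trans (hB : IsPreBrownianReal B P) (hm : ∀ t, Measurable (B t))
    {a b c : ℝ≥0} (hab : a ≤ b) (hbc : b ≤ c) {X : Lp ℝ 4 P} (hX : X ∈ pastL4 B P a) :
    mulIncr B a c X = mulIncr B a b X + mulIncr B b c X := by
  apply Lp.ext
  filter_upwards [coeFn_mulIncr hB hm (hab.trans hbc) hX, coeFn_mulIncr hB hm hab hX,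
    coeFn_mulIncr hB hm hbc (pastL4_mono hab hX),
    Lp.coeFn_add (mulIncr B a b X) (mulIncr B b c X)] with ω h1 h2 h3 h4
  rw [h1, h4, Pi.add_apply, h2, h3]
  ring

lemma integrable_coeFn [IsFiniteMeasure P] (X : Lp ℝ 4 P) : Integrable X P :=
  (Lp.memLp X).integrable (by norm_num)

lemma integral_mulIncr (hB : IsPreBrownianReal B P) (hm : ∀ t, Measurable (B t))
    {a b : ℝ≥0} (hab : a ≤ b) {X : Lp ℝ 4 P} (hX : X ∈ pastL4 B P a) :
    ∫ ω, mulIncr B a b X ω ∂P = 0 := by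
  rw [integral_congr_ae (coeFn_mulIncr hB hm hab hX),
    integral_past_mul hB hm hab (mem_pastL4.1 hX) (g := fun x => x) measurable_id,
    integral_increment hB hab, mul_zero]

/-- The fourth moment of `M + X (B_b - B_a)` when `M` and `X` are known at time `a`. -/
lemma norm_add_mulIncr_sq_le (hB : IsPreBrownianReal B P) (hm : ∀ t, Measurable (B t))
    {a b : ℝ≥0} (hab : a ≤ b) {M X : Lp ℝ 4 P} (hM : M ∈ pastL4 B P a) (hX : X ∈ pastL4 B P a) :
    ‖M + mulIncr B a b X‖ ^ 2 ≤ ‖M‖ ^ 2 + 3 * ‖X‖ ^ 2 * ((b : ℝ) - a) := by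
  have hba : (0 : ℝ) ≤ (b : ℝ) - a := sub_nonneg.2 (NNReal.coe_le_coe.2 hab)
  have hmon : ∀ i j : ℕ, i + j = 4 →
      AEStronglyMeasurable[past B a] (fun ω => M ω ^ i * X ω ^ j) P ∧
      Integrable (fun ω => M ω ^ i * X ω ^ j) P := fun i j hij =>
    ⟨((mem_pastL4.1 hM).pow i).mul ((mem_pastL4.1 hX).pow j),
      integrable_mul_pow (Lp.memLp M) (Lp.memLp X) i j hij⟩
  have hint : ∀ (i j : ℕ), i + j = 4 → ∀ k : ℕ,
      Integrable (fun ω => M ω ^ i * X ω ^ j * (B b ω - B a ω) ^ k) P := fun i j hij k =>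
    integrable_past_mul hB hab (hmon i j hij).1 (hmon i j hij).2 (g := fun x => x ^ k)
      (by fun_prop) (integrable_increment_pow hB a b k)
  have hval : ∀ (i j : ℕ), i + j = 4 → ∀ k : ℕ,
      ∫ ω, M ω ^ i * X ω ^ j * (B b ω - B a ω) ^ k ∂P
        = (∫ ω, M ω ^ i * X ω ^ j ∂P) * ∫ ω, (B b ω - B a ω) ^ k ∂P := fun i j hij k =>
    integral_past_mul hB hm hab (hmon i j hij).1 (g := fun x => x ^ k) (by fun_prop)
  -- Binomial expansion: the terms with an odd power of the increment have mean zero, and the even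
  -- ones use the second and fourth Gaussian moments.
  have hexp : ∫ ω, (M + mulIncr B a b X) ω ^ 4 ∂P
      = ∫ ω, M ω ^ 4 ∂P + 6 * ((b : ℝ) - a) * ∫ ω, M ω ^ 2 * X ω ^ 2 ∂P
        + 3 * ((b : ℝ) - a) ^ 2 * ∫ ω, X ω ^ 4 ∂P := by
    have e1 : ∫ ω, (M + mulIncr B a b X) ω ^ 4 ∂P = ∫ ω,
        (M ω ^ 4 * X ω ^ 0 * (B b ω - B a ω) ^ 0
          + 4 * (M ω ^ 3 * X ω ^ 1 * (B b ω - B a ω) ^ 1)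
          + 6 * (M ω ^ 2 * X ω ^ 2 * (B b ω - B a ω) ^ 2)
          + 4 * (M ω ^ 1 * X ω ^ 3 * (B b ω - B a ω) ^ 3)
          + M ω ^ 0 * X ω ^ 4 * (B b ω - B a ω) ^ 4) ∂P := by
      apply integral_congr_ae
      filter_upwards [coeFn_mulIncr hB hm hab hX, Lp.coeFn_add M (mulIncr B a b X)] with ω h1 h2
      rw [h2, Pi.add_apply, h1]
      ring
    have i0 := hint 4 0 rfl 0
    have i1 := (hint 3 1 rfl 1).const_mul 4
    have i2 := (hint 2 2 rfl 2).const_mul 6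
    have i3 := (hint 1 3 rfl 3).const_mul 4
    have i4 := hint 0 4 rfl 4
    rw [e1, integral_add (((i0.fun_add i1).fun_add i2).fun_add i3) i4,
      integral_add ((i0.fun_add i1).fun_add i2) i3, integral_add (i0.fun_add i1) i2, integral_add i0 i1, integral_const_mul, integral_const_mul,
      integral_const_mul, hval 4 0 rfl 0, hval 3 1 rfl 1, hval 2 2 rfl 2, hval 1 3 rfl 3,
      hval 0 4 rfl 4, integral_increment_sq hB hab, integral_increment_cube hB hab,
      integral_increment_four hB hab]
    have : IsProbabilityMeasure P := hB.isGaussianProcess.isProbabilityMeasure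
    simp only [pow_one, integral_increment hB hab, pow_zero, mul_one, one_mul, integral_const,
      probReal_univ, smul_eq_mul, mul_zero, add_zero]
    ring
  -- With $d=b-a$, the expansion is at most $\|M\|^4+6d\|M\|^2\|X\|^2+3d^2\|X\|^4$, whereas the
  -- square on the right has the same first two terms and $9d^2\|X\|^4$.
  have h4 : (‖M + mulIncr B a b X‖ ^ 2) ^ 2
      ≤ (‖M‖ ^ 2 + 3 * ‖X‖ ^ 2 * ((b : ℝ) - a)) ^ 2 := by
    have h5 := integral_sq_mul_sq_le M X
    have h6 := mul_le_mul_of_nonneg_left h5 (mul_nonneg (by norm_num : (0 : ℝ) ≤ 6) hba)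
    have h7 : 0 ≤ ‖X‖ ^ 4 * ((b : ℝ) - a) ^ 2 := by positivity
    calc (‖M + mulIncr B a b X‖ ^ 2) ^ 2 = ‖M + mulIncr B a b X‖ ^ 4 := by ring
      _ = ‖M‖ ^ 4 + 6 * ((b : ℝ) - a) * ∫ ω, M ω ^ 2 * X ω ^ 2 ∂P
        + 3 * ((b : ℝ) - a) ^ 2 * ‖X‖ ^ 4 := by
          rw [norm_pow_four, hexp, norm_pow_four, norm_pow_four]
      _ ≤ _ := by nlinarith
  exact le_of_sq_le_sq h4 (by positivity)

end MulIncr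

section StochasticIntegrals

open Filter Topology

/-! ### Martingale increments in `L⁴` -/

section IsMartIncr

variable {Ω : Type*} [MeasurableSpace Ω] {P : Measure Ω} [IsProbabilityMeasure P]
  {B : ℝ≥0 → Ω → ℝ}

lemma norm_integral_le (X : Lp ℝ 4 P) : ‖∫ ω, X ω ∂P‖ ≤ ‖X‖ := by
  have h1 : eLpNorm X 1 P ≤ eLpNorm X 4 P :=
    eLpNorm_le_eLpNorm_of_exponent_le (by norm_num) (Lp.aestronglyMeasurable X)
  calc ‖∫ ω, X ω ∂P‖ ≤ ∫ ω, ‖X ω‖ ∂P := norm_integral_le_integral_norm _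
    _ = (eLpNorm X 1 P).toReal := by
      rw [integral_norm_eq_lintegral_enorm (Lp.aestronglyMeasurable X), eLpNorm_one_eq_lintegral_enorm]
    _ ≤ ‖X‖ := by
      rw [Lp.norm_def]
      exact ENNReal.toReal_mono (Lp.eLpNorm_ne_top X) h1

variable (P) in
/-- The expectation on `L⁴(P)`. -/
def expect : Lp ℝ 4 P →L[ℝ] ℝ :=
  LinearMap.mkContinuous
    { toFun := fun X => ∫ ω, X ω ∂P
      map_add' := fun X Y => by
        rw [integral_congr_ae (Lp.coeFn_add X Y)]
        exact integral_add (integrable_coeFn X) (integrable_coeFn Y)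
      map_smul' := fun c X => by
        rw [integral_congr_ae (Lp.coeFn_smul c X)]
        exact integral_const_mul c _ }
    1 fun X => by
      rw [one_mul]
      exact norm_integral_le X

lemma expect_apply (X : Lp ℝ 4 P) : expect P X = ∫ ω, X ω ∂P := rfl

/-- `D` is known at time `b`, has mean zero, and adding it to something known at time `a`
increases the square of the `L⁴` norm by at most `d`. -/
structure IsMartIncr (B : ℝ≥0 → Ω → ℝ) (a b : ℝ≥0) (d : ℝ) (D : Lp ℝ 4 P) : Prop where
  mem : D ∈ pastL4 B P b
  mean : expect P D = 0
  norm_add_le : ∀ M ∈ pastL4 B P a, ‖M + D‖ ^ 2 ≤ ‖M‖ ^ 2 + d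

lemma IsMartIncr.norm_sq_le {a b : ℝ≥0} {d : ℝ} {D : Lp ℝ 4 P} (h : IsMartIncr B a b d D) :
    ‖D‖ ^ 2 ≤ d := by
  simpa using h.norm_add_le 0 (zero_mem _)

lemma IsMartIncr.mono {a b : ℝ≥0} {d d' : ℝ} {D : Lp ℝ 4 P} (h : IsMartIncr B a b d D)
    (hd : d ≤ d') : IsMartIncr B a b d' D :=
  ⟨h.mem, h.mean, fun M hM => (h.norm_add_le M hM).trans (by linarith)⟩

lemma isMartIncr_zero (a b : ℝ≥0) : IsMartIncr B a b 0 (0 : Lp ℝ 4 P) :=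
  ⟨zero_mem _, map_zero _, fun M _ => by simp⟩

lemma isMartIncr_mulIncr (hB : IsPreBrownianReal B P) (hm : ∀ t, Measurable (B t))
    {a b : ℝ≥0} (hab : a ≤ b) {X : Lp ℝ 4 P} (hX : X ∈ pastL4 B P a) :
    IsMartIncr B a b (3 * ‖X‖ ^ 2 * ((b : ℝ) - a)) (mulIncr B a b X) :=
  ⟨mulIncr_mem hB hm hab hX, integral_mulIncr hB hm hab hX,
    fun _ hM => norm_add_mulIncr_sq_le hB hm hab hM hX⟩

/-- The bound for `E` is applied to `M + D`, which is known at time `b`. Quantifying over all `M` in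
the definition is what makes the constants add instead of the norms. -/
lemma IsMartIncr.trans {a b c : ℝ≥0} (hab : a ≤ b) (hbc : b ≤ c) {d e : ℝ} {D E : Lp ℝ 4 P}
    (hD : IsMartIncr B a b d D) (hE : IsMartIncr B b c e E) :
    IsMartIncr B a c (d + e) (D + E) := by
  refine ⟨add_mem (pastL4_mono hbc hD.mem) hE.mem, by rw [map_add, hD.mean, hE.mean, add_zero],
    fun M hM => ?_⟩
  have h1 := hD.norm_add_le M hM
  have h2 := hE.norm_add_le (M + D) (add_mem (pastL4_mono hab hM) hD.mem)
  rw [add_assoc] at h2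
  linarith

lemma IsMartIncr.sum {τ : ℕ → ℝ≥0} (hτ : Monotone τ) {C : ℝ} {D : ℕ → Lp ℝ 4 P} (N : ℕ)
    (h : ∀ k < N, IsMartIncr B (τ k) (τ (k + 1)) (C * ((τ (k + 1) : ℝ) - τ k)) (D k)) :
    IsMartIncr B (τ 0) (τ N) (C * ((τ N : ℝ) - τ 0)) (∑ k ∈ Finset.range N, D k) := by
  induction N with
  | zero => simpa using isMartIncr_zero (P := P) (B := B) (τ 0) (τ 0)
  | succ N ih =>
    rw [Finset.sum_range_succ]
    have h1 := (ih fun k hk => h k (hk.trans N.lt_succ_self)).trans (hτ N.zero_le) (hτ N.le_succ)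
      (h N N.lt_succ_self)
    exact h1.mono (le_of_eq (by ring))

/-- Each of the three conditions is closed in $L^4$. -/
lemma IsMartIncr.of_tendsto (hm : ∀ t, Measurable (B t)) {a b : ℝ≥0} {d : ℝ}
    {D : ℕ → Lp ℝ 4 P} {E : Lp ℝ 4 P} (hD : Tendsto D atTop (𝓝 E))
    (h : ∀ᶠ n in atTop, IsMartIncr B a b d (D n)) : IsMartIncr B a b d E := by
  refine ⟨(isClosed_pastL4 hm b).mem_of_tendsto hD (h.mono fun n hn => hn.mem), ?_, fun M hM => ?_⟩
  · refine tendsto_nhds_unique (((expect P).continuous.tendsto E).comp hD) ?_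
    exact tendsto_const_nhds.congr' (h.mono fun n hn => hn.mean.symm)
  · have h1 : Tendsto (fun n => ‖M + D n‖ ^ 2) atTop (𝓝 (‖M + E‖ ^ 2)) :=
      ((tendsto_const_nhds.add hD).norm).pow 2
    exact le_of_tendsto h1 (h.mono fun n hn => hn.norm_add_le M hM)

lemma IsMartIncr.of_forall_gt {a b : ℝ≥0} {c : ℝ} {D : Lp ℝ 4 P}
    (h : ∀ ε : ℝ, 0 < ε → IsMartIncr B a b (3 * (c + ε) ^ 2 * ((b : ℝ) - a)) D) :
    IsMartIncr B a b (3 * c ^ 2 * ((b : ℝ) - a)) D := by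
  refine ⟨(h 1 one_pos).mem, (h 1 one_pos).mean, fun M hM => ?_⟩
  have h1 : Tendsto (fun ε : ℝ => ‖M‖ ^ 2 + 3 * (c + ε) ^ 2 * ((b : ℝ) - a)) (𝓝[>] 0)
      (𝓝 (‖M‖ ^ 2 + 3 * (c + 0) ^ 2 * ((b : ℝ) - a))) := by
    refine Tendsto.mono_left ?_ nhdsWithin_le_nhds
    exact Continuous.tendsto (by fun_prop) 0
  rw [add_zero] at h1
  refine ge_of_tendsto h1 ?_
  filter_upwards [self_mem_nhdsWithin] with ε hε
  exact (h ε hε).norm_add_le M hM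

end IsMartIncr

/-! ### The Itô integral of a continuous adapted process -/

section Ito

/-- The projection of `x` to the interval `[a, b]`. -/
def clip (a b x : ℝ≥0) : ℝ≥0 := max a (min x b)

lemma clip_mono (a b : ℝ≥0) : Monotone (clip a b) := fun _ _ h =>
  max_le_max le_rfl (min_le_min h le_rfl)

lemma clip_zero (a b : ℝ≥0) : clip a b 0 = a := by simp [clip]

lemma clip_of_ge {a b x : ℝ≥0} (hab : a ≤ b) (hx : b ≤ x) : clip a b x = b := by
  simp [clip, hx, hab]

/-- A grid cell either contributes a zero increment after clipping to $[a,b]$, or its left endpoint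
`p` precedes the clipped one, so that an integrand known at `p` is still known there. -/
lemma clip_cell {a b p q : ℝ≥0} (hab : a ≤ b) (hpq : p ≤ q) :
    clip a b p = clip a b q ∨ (p ≤ clip a b p ∧ p ≤ b ∧ a ≤ q) := by
  rcases le_total b p with h | h
  · exact .inl (by rw [clip_of_ge hab h, clip_of_ge hab (h.trans hpq)])
  rcases le_total q a with h' | h'
  · refine .inl ?_
    rw [clip, clip, max_eq_left ((min_le_left _ _).trans (hpq.trans h')),
      max_eq_left ((min_le_left _ _).trans h')]
  · exact .inr ⟨le_max_of_le_right (le_min le_rfl h), h, h'⟩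

variable {Ω : Type*} [MeasurableSpace Ω] {P : Measure Ω} {B : ℝ≥0 → Ω → ℝ}

lemma mulIncr_clip_trans (hB : IsPreBrownianReal B P) (hm : ∀ t, Measurable (B t))
    {a b c p q : ℝ≥0} (hab : a ≤ b) (hbc : b ≤ c) (hpq : p ≤ q) {X : Lp ℝ 4 P}
    (hX : X ∈ pastL4 B P p) :
    mulIncr B (clip a c p) (clip a c q) X
      = mulIncr B (clip a b p) (clip a b q) X + mulIncr B (clip b c p) (clip b c q) X := by
  have hlow : ∀ x ≤ b, clip a c x = clip a b x ∧ clip b c x = b := fun x hx => by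
    simp [clip, hx, hx.trans hbc]
  have hupp : ∀ x, b ≤ x → clip a c x = clip b c x ∧ clip a b x = b := fun x hx => by
    have h1 : b ≤ min x c := le_min hx hbc
    simp [clip, hx, hab, h1, hab.trans h1]
  rcases le_total q b with hq | hq
  · rw [(hlow q hq).1, (hlow q hq).2, (hlow p (hpq.trans hq)).1, (hlow p (hpq.trans hq)).2,
      mulIncr_self, add_zero]
  rcases le_total b p with hp | hp
  · rw [(hupp q hq).1, (hupp q hq).2, (hupp p hp).1, (hupp p hp).2, mulIncr_self, zero_add]
  rw [(hupp q hq).1, (hupp q hq).2, (hlow p hp).1, (hlow p hp).2]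
  refine mulIncr_trans hB hm ?_ ?_ (pastL4_mono ?_ hX)
  · exact max_le hab (min_le_right _ _)
  · exact le_max_left _ _
  · exact le_max_of_le_right (le_min le_rfl hp)

lemma mulIncr_telescope (hB : IsPreBrownianReal B P) (hm : ∀ t, Measurable (B t))
    {τ : ℕ → ℝ≥0} (hτ : Monotone τ) {X : Lp ℝ 4 P} (hX : X ∈ pastL4 B P (τ 0)) (N : ℕ) :
    ∑ k ∈ Finset.range N, mulIncr B (τ k) (τ (k + 1)) X = mulIncr B (τ 0) (τ N) X := by
  induction N with
  | zero => simp [mulIncr_self]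
  | succ N ih =>
    rw [Finset.sum_range_succ, ih, ← mulIncr_trans hB hm (hτ N.zero_le) (hτ N.le_succ) hX]

/-- The `k`-th point of the grid of mesh `1 / (n + 1)`. -/
def gridPt (n k : ℕ) : ℝ≥0 := k / (n + 1)

lemma gridPt_mono (n : ℕ) : Monotone (gridPt n) := fun k l h => by
  unfold gridPt
  gcongr

lemma gridPt_zero (n : ℕ) : gridPt n 0 = 0 := by simp [gridPt]

/-- The $(n+1)^2$ cells cover $[0,n+1]$, hence any given bounded interval once `n` is large. -/
lemma gridPt_last (n : ℕ) : gridPt n ((n + 1) ^ 2) = n + 1 := by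
  unfold gridPt
  push_cast
  field_simp

lemma gridPt_succ (n k : ℕ) : gridPt n (k + 1) = gridPt n k + 1 / (n + 1) := by
  unfold gridPt
  push_cast
  rw [add_div]

/-- The left-point sums over `[a, b]` along the grid of mesh `1 / (n + 1)`. -/
def gridSum (B : ℝ≥0 → Ω → ℝ) (Y : ℝ≥0 → Lp ℝ 4 P) (n : ℕ) (a b : ℝ≥0) : Lp ℝ 4 P :=
  ∑ k ∈ Finset.range ((n + 1) ^ 2),
    mulIncr B (clip a b (gridPt n k)) (clip a b (gridPt n (k + 1))) (Y (gridPt n k))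

/-- Clipping cuts a cell at `b` but keeps the value of the integrand at its original grid point, so
additivity is exact. -/
lemma gridSum_trans (hB : IsPreBrownianReal B P) (hm : ∀ t, Measurable (B t))
    {Y : ℝ≥0 → Lp ℝ 4 P} (hY : ∀ t, Y t ∈ pastL4 B P t) (n : ℕ) {a b c : ℝ≥0}
    (hab : a ≤ b) (hbc : b ≤ c) :
    gridSum B Y n a c = gridSum B Y n a b + gridSum B Y n b c := by
  unfold gridSum
  rw [← Finset.sum_add_distrib]
  exact Finset.sum_congr rfl fun k _ =>
    mulIncr_clip_trans hB hm hab hbc (gridPt_mono n k.le_succ) (hY _)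

lemma gridSum_self (Y : ℝ≥0 → Lp ℝ 4 P) (n : ℕ) (a : ℝ≥0) : gridSum B Y n a a = 0 := by
  have h : ∀ x, clip a a x = a := fun x => by simp [clip]
  simp [gridSum, h, mulIncr_self]

lemma gridSum_telescope (hB : IsPreBrownianReal B P) (hm : ∀ t, Measurable (B t))
    {Y : ℝ≥0 → Lp ℝ 4 P} (hY : ∀ t, Y t ∈ pastL4 B P t) (n : ℕ)
    {τ : ℕ → ℝ≥0} (hτ : Monotone τ) (N : ℕ) :
    ∑ k ∈ Finset.range N, gridSum B Y n (τ k) (τ (k + 1)) = gridSum B Y n (τ 0) (τ N) := by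
  induction N with
  | zero => simp [gridSum_self]
  | succ N ih =>
    rw [Finset.sum_range_succ, ih, ← gridSum_trans hB hm hY n (hτ N.zero_le) (hτ N.le_succ)]

lemma gridSum_sub (hB : IsPreBrownianReal B P) (hm : ∀ t, Measurable (B t))
    {Y Z : ℝ≥0 → Lp ℝ 4 P} (hY : ∀ t, Y t ∈ pastL4 B P t) (hZ : ∀ t, Z t ∈ pastL4 B P t)
    (n : ℕ) {a b : ℝ≥0} (hab : a ≤ b) :
    gridSum B (fun t => Y t - Z t) n a b = gridSum B Y n a b - gridSum B Z n a b := by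
  unfold gridSum
  rw [← Finset.sum_sub_distrib]
  refine Finset.sum_congr rfl fun k _ => ?_
  have hk := gridPt_mono n k.le_succ
  rcases clip_cell hab hk with h | ⟨h, -, -⟩
  · rw [h]; simp only [mulIncr_self, sub_zero]
  · exact mulIncr_sub hB hm (clip_mono a b hk) (pastL4_mono h (hY _)) (pastL4_mono h (hZ _))

variable [IsProbabilityMeasure P]

/-- Over an interval on which `Y` stays close to `X`, the left-point sums are close to
`X (B_b - B_a)`. -/
lemma isMartIncr_gridSum (hB : IsPreBrownianReal B P) (hm : ∀ t, Measurable (B t))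
    {Y : ℝ≥0 → Lp ℝ 4 P} (hY : ∀ t, Y t ∈ pastL4 B P t) (n : ℕ) {a b : ℝ≥0} (hab : a ≤ b)
    (hb : b ≤ n + 1) {X : Lp ℝ 4 P} (hX : X ∈ pastL4 B P a) {c : ℝ}
    (hc : ∀ r ≤ b, a ≤ r + 1 / (n + 1) → ‖Y r - X‖ ≤ c) :
    IsMartIncr B a b (3 * c ^ 2 * ((b : ℝ) - a)) (gridSum B Y n a b - mulIncr B a b X) := by
  set τ : ℕ → ℝ≥0 := fun k => clip a b (gridPt n k) with hτ
  have hmono : Monotone τ := fun k l h => clip_mono a b (gridPt_mono n h)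
  have h0 : τ 0 = a := by simp only [hτ, gridPt_zero, clip_zero]
  have hN : τ ((n + 1) ^ 2) = b := by
    simp only [hτ, gridPt_last]
    exact clip_of_ge hab hb
  have hX0 : X ∈ pastL4 B P (τ 0) := by rwa [h0]
  have key := IsMartIncr.sum (P := P) (B := B) hmono (C := 3 * c ^ 2)
    (D := fun k => mulIncr B (τ k) (τ (k + 1)) (Y (gridPt n k)) - mulIncr B (τ k) (τ (k + 1)) X)
    ((n + 1) ^ 2) fun k _ => ?_
  · rw [Finset.sum_sub_distrib, mulIncr_telescope hB hm hmono hX0, h0, hN] at key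
    exact key
  · have hk := gridPt_mono n k.le_succ
    rcases clip_cell hab hk with h | ⟨h1, h2, h3⟩
    · have h' : τ k = τ (k + 1) := h
      simpa [← h', mulIncr_self] using isMartIncr_zero (P := P) (B := B) (τ k) (τ k)
    · have hXk : X ∈ pastL4 B P (τ k) := pastL4_mono (hmono k.zero_le) hX0
      have hYk : Y (gridPt n k) ∈ pastL4 B P (τ k) := pastL4_mono h1 (hY _)
      -- The first relevant cell may start before `a`, but by no more than the mesh; this is the
      -- slack allowed in `hc`.
      rw [gridPt_succ] at h3
      rw [← mulIncr_sub hB hm (hmono k.le_succ) hYk hXk]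
      refine (isMartIncr_mulIncr hB hm (hmono k.le_succ) (sub_mem hYk hXk)).mono ?_
      have h4 : (0 : ℝ) ≤ (τ (k + 1) : ℝ) - τ k :=
        sub_nonneg.2 (NNReal.coe_le_coe.2 (hmono k.le_succ))
      have h5 := hc _ h2 h3
      gcongr

lemma exists_modulus {E : Type*} [SeminormedAddCommGroup E] {Y : ℝ≥0 → E} (hY : Continuous Y)
    (T : ℝ≥0) {ε : ℝ} (hε : 0 < ε) :
    ∃ δ : ℝ, 0 < δ ∧ ∀ r ≤ T, ∀ s ≤ T, |(r : ℝ) - s| ≤ δ → ‖Y r - Y s‖ ≤ ε := by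
  have hcomp : IsCompact (Set.Icc 0 T) := isCompact_Icc
  have hu := hcomp.uniformContinuousOn_of_continuous hY.continuousOn
  obtain ⟨δ, hδ, h⟩ := Metric.uniformContinuousOn_iff.1 hu ε hε
  refine ⟨δ / 2, half_pos hδ, fun r hr s hs hrs => ?_⟩
  have h1 := h r ⟨zero_le, hr⟩ s ⟨zero_le, hs⟩ (by
    rw [NNReal.dist_eq]; linarith)
  rw [dist_eq_norm] at h1
  exact h1.le

/-- On each cell of the grid of index `n`, the sums of a finer grid `m` are compared with the frozen
value of `Y` at the left end of the cell. The errors are martingale increments, so their squares add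
up to at most $3c^2t$. The grids need not be nested, since the finer sums are additive under
clipping. -/
lemma cauchySeq_gridSum (hB : IsPreBrownianReal B P) (hm : ∀ t, Measurable (B t))
    {Y : ℝ≥0 → Lp ℝ 4 P} (hY : ∀ t, Y t ∈ pastL4 B P t) (hYc : Continuous Y) (t : ℝ≥0) :
    CauchySeq fun n => gridSum B Y n 0 t := by
  rw [Metric.cauchySeq_iff']
  intro ε hε
  obtain ⟨c, hc, hcε⟩ : ∃ c : ℝ, 0 < c ∧ 3 * c ^ 2 * t < ε ^ 2 := by
    refine ⟨ε / (2 * (t + 1)), by positivity, ?_⟩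
    have h1 : (0 : ℝ) ≤ t := t.2
    rw [div_pow, mul_div_assoc', div_mul_eq_mul_div, div_lt_iff₀ (by positivity)]
    nlinarith [sq_nonneg (t : ℝ), mul_pos hε hε, mul_nonneg h1 (mul_pos hε hε).le,
      mul_nonneg (mul_nonneg h1 h1) (mul_pos hε hε).le]
  obtain ⟨δ, hδ, hmod⟩ := exists_modulus hYc t hc
  obtain ⟨N₁, hN₁⟩ := exists_nat_ge (t : ℝ)
  obtain ⟨N₂, hN₂⟩ := exists_nat_one_div_lt hδ
  have hN : ∀ n, max N₁ N₂ ≤ n → t ≤ n + 1 ∧ (1 / ((n : ℝ) + 1)) ≤ δ := fun n hn => by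
    constructor
    · rw [← NNReal.coe_le_coe]
      push_cast
      have : (N₁ : ℝ) ≤ n := by exact_mod_cast (le_max_left _ _).trans hn
      linarith
    · refine le_trans ?_ hN₂.le
      have : (N₂ : ℝ) ≤ n := by exact_mod_cast (le_max_right _ _).trans hn
      gcongr
  set n := max N₁ N₂ with hn
  refine ⟨n, fun m hmn => ?_⟩
  obtain ⟨hn1, hn2⟩ := hN n le_rfl
  obtain ⟨hm1, hm2⟩ := hN m hmn
  set τ : ℕ → ℝ≥0 := fun k => clip 0 t (gridPt n k) with hτ
  have hmono : Monotone τ := fun k l h => clip_mono 0 t (gridPt_mono n h)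
  have hle : ∀ k, τ k ≤ t := fun k => max_le zero_le (min_le_right _ _)
  have h0 : τ 0 = 0 := by simp only [hτ, gridPt_zero, clip_zero]
  have hNt : τ ((n + 1) ^ 2) = t := by
    simp only [hτ, gridPt_last]
    exact clip_of_ge zero_le hn1
  have key := IsMartIncr.sum (P := P) (B := B) hmono (C := 3 * c ^ 2)
    (D := fun k => gridSum B Y m (τ k) (τ (k + 1)) - mulIncr B (τ k) (τ (k + 1)) (Y (gridPt n k)))
    ((n + 1) ^ 2) fun k _ => ?_
  · rw [Finset.sum_sub_distrib, gridSum_telescope hB hm hY m hmono, h0, hNt] at key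
    have h1 := key.norm_sq_le
    rw [NNReal.coe_zero, sub_zero] at h1
    rw [dist_eq_norm]
    exact lt_of_pow_lt_pow_left₀ 2 hε.le (h1.trans_lt hcε)
  · have hk := gridPt_mono n k.le_succ
    rcases clip_cell (zero_le (a := t)) hk with h | ⟨h1, h2, -⟩
    · have h' : τ k = τ (k + 1) := h
      simpa [← h', mulIncr_self, gridSum_self] using isMartIncr_zero (P := P) (B := B) (τ k) (τ k)
    · have hτk : τ k = gridPt n k := by simp [hτ, clip, h2]
      refine isMartIncr_gridSum hB hm hY m (hmono k.le_succ) ((hle _).trans hm1)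
        (pastL4_mono h1 (hY _)) fun r hr hr' => ?_
      refine hmod r (hr.trans (hle _)) _ h2 ?_
      have h3 : (τ (k + 1) : ℝ) ≤ gridPt n k + 1 / (n + 1) := by
        have : τ (k + 1) ≤ gridPt n (k + 1) := max_le zero_le (min_le_left _ _)
        rw [gridPt_succ] at this
        exact_mod_cast this
      have h4 : (r : ℝ) ≤ τ (k + 1) := hr
      have h5 : (gridPt n k : ℝ) ≤ r + 1 / (m + 1) := by
        rw [hτk] at hr'
        exact_mod_cast hr'
      rw [abs_le]
      constructor <;> linarith

/-- The Itô integral `∫_0^t Y dB`. -/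
def ito (B : ℝ≥0 → Ω → ℝ) (Y : ℝ≥0 → Lp ℝ 4 P) (t : ℝ≥0) : Lp ℝ 4 P :=
  limUnder atTop fun n => gridSum B Y n 0 t

lemma tendsto_gridSum (hB : IsPreBrownianReal B P) (hm : ∀ t, Measurable (B t))
    {Y : ℝ≥0 → Lp ℝ 4 P} (hY : ∀ t, Y t ∈ pastL4 B P t) (hYc : Continuous Y) (t : ℝ≥0) :
    Tendsto (fun n => gridSum B Y n 0 t) atTop (𝓝 (ito B Y t)) :=
  (cauchySeq_gridSum hB hm hY hYc t).tendsto_limUnder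

lemma ito_zero (hB : IsPreBrownianReal B P) (hm : ∀ t, Measurable (B t))
    {Y : ℝ≥0 → Lp ℝ 4 P} (hY : ∀ t, Y t ∈ pastL4 B P t) (hYc : Continuous Y) :
    ito B Y 0 = 0 := by
  refine tendsto_nhds_unique (tendsto_gridSum hB hm hY hYc 0) ?_
  simp [gridSum_self]

lemma ito_sub (hB : IsPreBrownianReal B P) (hm : ∀ t, Measurable (B t))
    {Y Z : ℝ≥0 → Lp ℝ 4 P} (hY : ∀ t, Y t ∈ pastL4 B P t) (hYc : Continuous Y)
    (hZ : ∀ t, Z t ∈ pastL4 B P t) (hZc : Continuous Z) (t : ℝ≥0) :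
    ito B (fun s => Y s - Z s) t = ito B Y t - ito B Z t := by
  refine tendsto_nhds_unique (tendsto_gridSum hB hm (fun s => sub_mem (hY s) (hZ s))
    (hYc.sub hZc) t) ?_
  simp_rw [gridSum_sub hB hm hY hZ _ (zero_le (a := t))]
  exact (tendsto_gridSum hB hm hY hYc t).sub (tendsto_gridSum hB hm hZ hZc t)

/-- Over an interval on which `Y` stays close to `X`, the Itô integral is close to
`X (B_b - B_a)`. -/
lemma isMartIncr_ito (hB : IsPreBrownianReal B P) (hm : ∀ t, Measurable (B t))
    {Y : ℝ≥0 → Lp ℝ 4 P} (hY : ∀ t, Y t ∈ pastL4 B P t) (hYc : Continuous Y)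
    {a b : ℝ≥0} (hab : a ≤ b) {X : Lp ℝ 4 P} (hX : X ∈ pastL4 B P a) {c : ℝ}
    (hc : ∀ r, a ≤ r → r ≤ b → ‖Y r - X‖ ≤ c) :
    IsMartIncr B a b (3 * c ^ 2 * ((b : ℝ) - a)) (ito B Y b - ito B Y a - mulIncr B a b X) := by
  -- Grid points just before `a` are not controlled by `hc`. Uniform continuity bounds their
  -- contribution by `c + ε`, and `ε` is removed in the limit.
  refine IsMartIncr.of_forall_gt fun ε hε => ?_
  have hlim : Tendsto (fun n => gridSum B Y n a b - mulIncr B a b X) atTop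
      (𝓝 (ito B Y b - ito B Y a - mulIncr B a b X)) := by
    refine Tendsto.sub_const ?_ _
    refine ((tendsto_gridSum hB hm hY hYc b).sub (tendsto_gridSum hB hm hY hYc a)).congr fun n => ?_
    rw [gridSum_trans hB hm hY n zero_le hab, add_sub_cancel_left]
  refine IsMartIncr.of_tendsto hm hlim ?_
  obtain ⟨δ, hδ, hmod⟩ := exists_modulus hYc b hε
  obtain ⟨N₁, hN₁⟩ := exists_nat_ge (b : ℝ)
  obtain ⟨N₂, hN₂⟩ := exists_nat_one_div_lt hδ
  filter_upwards [eventually_ge_atTop N₁, eventually_ge_atTop N₂] with n h1 h2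
  have h3 : b ≤ n + 1 := by
    rw [← NNReal.coe_le_coe]
    push_cast
    have : (N₁ : ℝ) ≤ n := by exact_mod_cast h1
    linarith
  have h4 : 1 / ((n : ℝ) + 1) ≤ δ := by
    refine le_trans ?_ hN₂.le
    have : (N₂ : ℝ) ≤ n := by exact_mod_cast h2
    gcongr
  refine isMartIncr_gridSum hB hm hY n hab h3 hX fun r hr hr' => ?_
  rcases le_total a r with h | h
  · exact (hc r h hr).trans (by linarith)
  · have h5 : (a : ℝ) ≤ r + 1 / (n + 1) := by exact_mod_cast hr'
    have h6 : (r : ℝ) ≤ a := h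
    have h7 := hmod r hr a hab (by rw [abs_le]; constructor <;> linarith)
    have h8 := hc a le_rfl hab
    calc ‖Y r - X‖ = ‖(Y a - X) + (Y r - Y a)‖ := by congr 1; abel
      _ ≤ c + ε := (norm_add_le _ _).trans (add_le_add h8 h7)

lemma ito_mem (hB : IsPreBrownianReal B P) (hm : ∀ t, Measurable (B t))
    {Y : ℝ≥0 → Lp ℝ 4 P} (hY : ∀ t, Y t ∈ pastL4 B P t) (hYc : Continuous Y) (t : ℝ≥0) :
    ito B Y t ∈ pastL4 B P t := by
  refine (isClosed_pastL4 hm t).mem_of_tendsto (tendsto_gridSum hB hm hY hYc t)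
    (.of_forall fun n => sum_mem fun k _ => ?_)
  have hk := gridPt_mono n k.le_succ
  have hle : clip 0 t (gridPt n (k + 1)) ≤ t := max_le zero_le (min_le_right _ _)
  rcases clip_cell (zero_le (a := t)) hk with h | ⟨h, -, -⟩
  · rw [h, mulIncr_self]; exact zero_mem _
  · exact pastL4_mono hle (mulIncr_mem hB hm (clip_mono 0 t hk) (pastL4_mono h (hY _)))

/-- The increments of the Itô integral of a bounded process. -/
lemma isMartIncr_ito_sub (hB : IsPreBrownianReal B P) (hm : ∀ t, Measurable (B t))
    {Y : ℝ≥0 → Lp ℝ 4 P} (hY : ∀ t, Y t ∈ pastL4 B P t) (hYc : Continuous Y)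
    {a b : ℝ≥0} (hab : a ≤ b) {c : ℝ} (hc : ∀ r, a ≤ r → r ≤ b → ‖Y r‖ ≤ c) :
    IsMartIncr B a b (3 * c ^ 2 * ((b : ℝ) - a)) (ito B Y b - ito B Y a) := by
  have h := isMartIncr_ito hB hm hY hYc hab (zero_mem (pastL4 B P a)) (c := c)
    (by simpa using hc)
  have h0 : mulIncr B a b (0 : Lp ℝ 4 P) = 0 := by
    have := mulIncr_sub hB hm hab (zero_mem (pastL4 B P a)) (zero_mem (pastL4 B P a))
    simpa using this
  rwa [h0, sub_zero] at h

lemma expect_ito (hB : IsPreBrownianReal B P) (hm : ∀ t, Measurable (B t))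
    {Y : ℝ≥0 → Lp ℝ 4 P} (hY : ∀ t, Y t ∈ pastL4 B P t) (hYc : Continuous Y) (t : ℝ≥0) :
    expect P (ito B Y t) = 0 := by
  obtain ⟨c, hc⟩ := (isCompact_Icc (a := 0) (b := t)).exists_bound_of_continuousOn hYc.continuousOn
  have h := isMartIncr_ito_sub hB hm hY hYc (zero_le (a := t)) fun r h1 h2 => hc r ⟨h1, h2⟩
  rw [ito_zero hB hm hY hYc, sub_zero] at h
  exact h.mean

end Ito

/-! ### Time integrals of continuous adapted processes -/

section TimeInt

lemma intervalIntegrable_toNNReal {E : Type*} [NormedAddCommGroup E] {Z : ℝ≥0 → E}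
    (hZ : Continuous Z) (a b : ℝ) :
    IntervalIntegrable (fun r : ℝ => Z r.toNNReal) volume a b :=
  (hZ.comp continuous_real_toNNReal).intervalIntegrable a b

variable {E : Type*} [NormedAddCommGroup E] [NormedSpace ℝ E]

/-- The integral `∫_0^t Z_r dr`. -/
def timeInt (Z : ℝ≥0 → E) (t : ℝ≥0) : E := ∫ r in (0 : ℝ)..t, Z r.toNNReal

lemma timeInt_zero (Z : ℝ≥0 → E) : timeInt Z 0 = 0 := by simp [timeInt]

lemma timeInt_sub {Y Z : ℝ≥0 → E} (hY : Continuous Y) (hZ : Continuous Z) (t : ℝ≥0) :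
    timeInt (fun s => Y s - Z s) t = timeInt Y t - timeInt Z t :=
  intervalIntegral.integral_sub (intervalIntegrable_toNNReal hY _ _)
    (intervalIntegrable_toNNReal hZ _ _)

lemma timeInt_sub_timeInt {Z : ℝ≥0 → E} (hZ : Continuous Z) (a b : ℝ≥0) :
    timeInt Z b - timeInt Z a = ∫ r in (a : ℝ)..b, Z r.toNNReal :=
  intervalIntegral.integral_interval_sub_left (intervalIntegrable_toNNReal hZ _ _)
    (intervalIntegrable_toNNReal hZ _ _)

lemma mem_of_mem_uIoc {a b : ℝ≥0} (hab : a ≤ b) {r : ℝ} (hr : r ∈ Set.uIoc (a : ℝ) b) :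
    a ≤ r.toNNReal ∧ r.toNNReal ≤ b := by
  rw [Set.uIoc_of_le (NNReal.coe_le_coe.2 hab)] at hr
  have h0 : 0 ≤ r := a.2.trans hr.1.le
  constructor
  · rw [← NNReal.coe_le_coe, Real.coe_toNNReal r h0]; exact hr.1.le
  · rw [← NNReal.coe_le_coe, Real.coe_toNNReal r h0]; exact hr.2

lemma norm_timeInt_sub_le {Z : ℝ≥0 → E} (hZ : Continuous Z) {a b : ℝ≥0} (hab : a ≤ b) {c : ℝ}
    (hc : ∀ r, a ≤ r → r ≤ b → ‖Z r‖ ≤ c) :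
    ‖timeInt Z b - timeInt Z a‖ ≤ c * ((b : ℝ) - a) := by
  rw [timeInt_sub_timeInt hZ]
  have h := intervalIntegral.norm_integral_le_of_norm_le_const (a := (a : ℝ)) (b := b)
    (f := fun r : ℝ => Z r.toNNReal) (C := c)
    fun r hr => hc _ (mem_of_mem_uIoc hab hr).1 (mem_of_mem_uIoc hab hr).2
  rwa [abs_of_nonneg (sub_nonneg.2 (NNReal.coe_le_coe.2 hab))] at h

lemma norm_timeInt_sub_sub_smul_le [CompleteSpace E] {Z : ℝ≥0 → E} (hZ : Continuous Z)
    {a b : ℝ≥0} (hab : a ≤ b)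
    {X : E} {c : ℝ} (hc : ∀ r, a ≤ r → r ≤ b → ‖Z r - X‖ ≤ c) :
    ‖timeInt Z b - timeInt Z a - ((b : ℝ) - a) • X‖ ≤ c * ((b : ℝ) - a) := by
  have h1 := norm_timeInt_sub_le (Z := fun r => Z r - X) (hZ.sub continuous_const) hab hc
  have h2 : ∀ t : ℝ≥0, timeInt (fun _ => X) t = (t : ℝ) • X := fun t => by simp [timeInt]
  rw [timeInt_sub hZ continuous_const, timeInt_sub hZ continuous_const, h2, h2] at h1
  convert h1 using 2
  rw [sub_smul]
  abel

variable {Ω : Type*} [MeasurableSpace Ω] {P : Measure Ω} {B : ℝ≥0 → Ω → ℝ}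

/-- The subspace of the past is closed, hence complete, and the Bochner integral can be formed
inside it. Stopping the time argument at `t` makes all values of the integrand lie in the subspace
without changing them on $[0,t]$. -/
lemma timeInt_mem (hm : ∀ t, Measurable (B t)) {Z : ℝ≥0 → Lp ℝ 4 P}
    (hZ : ∀ t, Z t ∈ pastL4 B P t) (hZc : Continuous Z) (t : ℝ≥0) :
    timeInt Z t ∈ pastL4 B P t := by
  have : CompleteSpace (pastL4 B P t) := (isClosed_pastL4 hm t).completeSpace_coe
  let G : ℝ → pastL4 B P t := fun r =>
    ⟨Z (min r.toNNReal t), pastL4_mono (min_le_right _ _) (hZ _)⟩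
  have hG : Continuous G := Continuous.subtype_mk
    (hZc.comp (continuous_real_toNNReal.min continuous_const)) _
  have h := (pastL4 B P t).subtypeL.intervalIntegral_comp_comm (hG.intervalIntegrable 0 (t : ℝ))
    (μ := volume)
  have h2 : timeInt Z t = ∫ r in (0 : ℝ)..t, (pastL4 B P t).subtypeL (G r) := by
    refine intervalIntegral.integral_congr_ae (.of_forall fun r hr => ?_)
    have h3 : r.toNNReal ≤ t := (mem_of_mem_uIoc (zero_le (a := t)) hr).2
    simp [G, h3]
  rw [h2, h]
  exact (∫ r in (0 : ℝ)..t, G r).2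

lemma expect_timeInt [IsProbabilityMeasure P] {Z : ℝ≥0 → Lp ℝ 4 P} (hZc : Continuous Z)
    (t : ℝ≥0) : expect P (timeInt Z t) = timeInt (fun r => expect P (Z r)) t :=
  ((expect P).intervalIntegral_comp_comm (intervalIntegrable_toNNReal hZc _ _)).symm

end TimeInt

/-! ### Iterated Stratonovich integrals in `L⁴` -/

section Strat

variable {Ω : Type*} [MeasurableSpace Ω] {P : Measure Ω} {B : ℝ≥0 → Ω → ℝ}

/-- A linear operation turning continuous functions of `n` variables into adapted processes which
are Hölder continuous of exponent `1/2` in `L⁴`, locally uniformly in terms of the supremum of the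
function. -/
structure IsVolterraOp (B : ℝ≥0 → Ω → ℝ) {n : ℕ}
    (Φ : ((Fin n → ℝ≥0) → ℝ) → ℝ≥0 → Lp ℝ 4 P) : Prop where
  mem : ∀ f, Continuous f → ∀ s, Φ f s ∈ pastL4 B P s
  sub : ∀ f g, Continuous f → Continuous g → ∀ s, Φ (fun x => f x - g x) s = Φ f s - Φ g s
  bound : ∀ T : ℝ≥0, ∃ C : ℝ, 0 ≤ C ∧ ∀ f, Continuous f → ∀ M : ℝ,
    (∀ x, (∀ i, x i ≤ T) → |f x| ≤ M) →
      (∀ s ≤ T, ‖Φ f s‖ ≤ C * M) ∧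
      ∀ a b, a ≤ b → b ≤ T → ‖Φ f b - Φ f a‖ ≤ C * M * √((b : ℝ) - a)

lemma isCompact_cube (n : ℕ) (T : ℝ≥0) : IsCompact {x : Fin n → ℝ≥0 | ∀ i, x i ≤ T} := by
  have h : {x : Fin n → ℝ≥0 | ∀ i, x i ≤ T} = Set.Icc 0 (fun _ => T) := by
    ext x
    simp [Set.mem_Icc, Pi.le_def]
  rw [h]
  exact isCompact_Icc

/-- A change of parameter is controlled by the supremum of the difference of the functions on a
cube, which is small by compactness; a change of time is controlled by the Hölder bound. -/
lemma IsVolterraOp.continuous {n : ℕ} {Φ : ((Fin n → ℝ≥0) → ℝ) → ℝ≥0 → Lp ℝ 4 P}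
    (hΦ : IsVolterraOp B Φ) {α : Type*} [TopologicalSpace α] {F : α → (Fin n → ℝ≥0) → ℝ}
    (hF : Continuous (Function.uncurry F)) :
    Continuous fun p : α × ℝ≥0 => Φ (F p.1) p.2 := by
  have hFu : ∀ u, Continuous (F u) := fun u => hF.comp (Continuous.prodMk_right u)
  rw [continuous_iff_continuousAt]
  rintro ⟨u₀, r₀⟩
  set T : ℝ≥0 := r₀ + 1 with hT
  obtain ⟨C, hC, hbd⟩ := hΦ.bound T
  obtain ⟨M, hM⟩ := (isCompact_cube n T).exists_bound_of_continuousOn (hFu u₀).continuousOn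
  have hM' := (hbd _ (hFu u₀) M fun x hx => hM x hx).2
  rw [ContinuousAt, Metric.tendsto_nhds]
  intro ε hε
  have hr0 : r₀ < T := lt_add_of_pos_right _ one_pos
  have e1 : ∀ᶠ p : α × ℝ≥0 in 𝓝 (u₀, r₀), p.2 ≤ T :=
    (continuous_snd.tendsto (u₀, r₀)).eventually (eventually_le_nhds hr0)
  have e2 : ∀ᶠ p : α × ℝ≥0 in 𝓝 (u₀, r₀), C * M * √|(p.2 : ℝ) - r₀| < ε / 2 := by
    have hcont : Continuous fun p : α × ℝ≥0 => C * M * √|(p.2 : ℝ) - r₀| := by fun_prop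
    have := hcont.tendsto (u₀, r₀)
    simp only [sub_self, abs_zero, Real.sqrt_zero, mul_zero] at this
    exact this.eventually_lt_const (half_pos hε)
  have e3 : ∀ᶠ p : α × ℝ≥0 in 𝓝 (u₀, r₀), ∀ x, (∀ i, x i ≤ T) →
      |F p.1 x - F u₀ x| ≤ ε / (4 * (C + 1)) := by
    obtain ⟨v, hv, h⟩ := (isCompact_cube n T).mem_uniformity_of_prod (s := Set.univ)
      hF.continuousOn (Set.mem_univ u₀)
      (Metric.dist_mem_uniformity (show 0 < ε / (4 * (C + 1)) by positivity))
    rw [nhdsWithin_univ] at hv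
    filter_upwards [(continuous_fst.tendsto (u₀, r₀)).eventually hv] with p hp x hx
    have := h p.1 hp x hx
    rw [Set.mem_ofPred_eq, Real.dist_eq] at this
    exact this.le
  filter_upwards [e1, e2, e3] with p h1 h2 h3
  have h4 : ‖Φ (F p.1) p.2 - Φ (F u₀) p.2‖ ≤ C * (ε / (4 * (C + 1))) := by
    rw [← hΦ.sub _ _ (hFu _) (hFu _)]
    exact (hbd _ ((hFu _).sub (hFu _)) _ h3).1 _ h1
  have h5 : C * (ε / (4 * (C + 1))) < ε / 2 := by
    rw [mul_div_assoc', div_lt_div_iff₀ (by positivity) (by positivity)]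
    nlinarith
  have h6 : ‖Φ (F u₀) p.2 - Φ (F u₀) r₀‖ ≤ C * M * √|(p.2 : ℝ) - r₀| := by
    rcases le_total r₀ p.2 with h | h
    · rw [abs_of_nonneg (sub_nonneg.2 (NNReal.coe_le_coe.2 h))]
      exact hM' _ _ h h1
    · rw [norm_sub_rev, abs_sub_comm, abs_of_nonneg (sub_nonneg.2 (NNReal.coe_le_coe.2 h))]
      exact hM' _ _ h hr0.le
  rw [dist_eq_norm]
  calc ‖Φ (F p.1) p.2 - Φ (F u₀) r₀‖
      = ‖(Φ (F p.1) p.2 - Φ (F u₀) p.2) + (Φ (F u₀) p.2 - Φ (F u₀) r₀)‖ := by congr 1; abel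
    _ ≤ _ := norm_add_le _ _
    _ < ε := by linarith

lemma IsVolterraOp.continuous_diag {n : ℕ} {Φ : ((Fin n → ℝ≥0) → ℝ) → ℝ≥0 → Lp ℝ 4 P}
    (hΦ : IsVolterraOp B Φ) {F : ℝ≥0 → (Fin n → ℝ≥0) → ℝ}
    (hF : Continuous (Function.uncurry F)) : Continuous fun t => Φ (F t) t :=
  (hΦ.continuous hF).comp (continuous_id.prodMk continuous_id)

lemma isVolterraOp_zero (n : ℕ) : IsVolterraOp B
    (fun (_ : (Fin n → ℝ≥0) → ℝ) (_ : ℝ≥0) => (0 : Lp ℝ 4 P)) where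
  mem _ _ _ := zero_mem _
  sub _ _ _ _ _ := by simp
  bound T := ⟨0, le_rfl, fun f _ M _ => by simp⟩

lemma continuous_cons {n : ℕ} {f : (Fin (n + 1) → ℝ≥0) → ℝ} (hf : Continuous f) :
    Continuous (Function.uncurry fun (t : ℝ≥0) (x : Fin n → ℝ≥0) =>
      f (Fin.cons t x : Fin (n + 1) → ℝ≥0)) :=
  hf.comp (Continuous.finCons (A := fun _ => ℝ≥0) continuous_fst continuous_snd)

variable [IsProbabilityMeasure P]

lemma isVolterraOp_const : IsVolterraOp B
    (fun (f : (Fin 0 → ℝ≥0) → ℝ) (_ : ℝ≥0) => Lp.const 4 P (f Fin.elim0)) where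
  mem f _ s := by
    rw [mem_pastL4]
    exact stronglyMeasurable_const.aestronglyMeasurable.congr
      (Lp.coeFn_const 4 P (f Fin.elim0)).symm
  sub f g _ _ s := map_sub _ _ _
  bound T := by
    refine ⟨1, zero_le_one, fun f _ M hM => ⟨fun s _ => ?_, fun a b _ _ => ?_⟩⟩
    · have h := Lp.norm_const_le (μ := P) (p := 4) (c := f Fin.elim0)
      rw [probReal_univ, Real.one_rpow, mul_one] at h
      rw [one_mul]
      exact h.trans (hM _ fun i => i.elim0)
    · have hM0 : 0 ≤ M := (abs_nonneg _).trans (hM Fin.elim0 fun i => i.elim0)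
      rw [sub_self, norm_zero]
      positivity

/-- An Itô integral plus half a time integral. -/
lemma IsVolterraOp.succ (hB : IsPreBrownianReal B P) (hm : ∀ t, Measurable (B t))
    {n m : ℕ} {Φ : ((Fin n → ℝ≥0) → ℝ) → ℝ≥0 → Lp ℝ 4 P} (hΦ : IsVolterraOp B Φ)
    {Ψ : ((Fin m → ℝ≥0) → ℝ) → ℝ≥0 → Lp ℝ 4 P} (hΨ : IsVolterraOp B Ψ)
    {σ : ℝ≥0 → (Fin m → ℝ≥0) → Fin (n + 1) → ℝ≥0} (hσ : Continuous (Function.uncurry σ))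
    (hσT : ∀ (T : ℝ≥0), ∀ t ≤ T, ∀ x, (∀ i, x i ≤ T) → ∀ i, σ t x i ≤ T) :
    IsVolterraOp B fun (f : (Fin (n + 1) → ℝ≥0) → ℝ) (s : ℝ≥0) =>
      ito B (fun t => Φ (fun x => f (Fin.cons t x : Fin (n + 1) → ℝ≥0)) t) s
        + (1 / 2 : ℝ) • timeInt (fun t => Ψ (fun x => f (σ t x)) t) s := by
  have hc1 : ∀ f, Continuous f → ∀ t, Continuous fun x => f (Fin.cons t x : Fin (n + 1) → ℝ≥0) :=
    fun f hf t => (continuous_cons hf).comp (Continuous.prodMk_right t)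
  have hc2 : ∀ f : (Fin (n + 1) → ℝ≥0) → ℝ, Continuous f → ∀ t, Continuous fun x => f (σ t x) :=
    fun f hf t => (hf.comp hσ).comp (Continuous.prodMk_right t)
  have hY : ∀ f, Continuous f → Continuous fun t =>
      Φ (fun x => f (Fin.cons t x : Fin (n + 1) → ℝ≥0)) t := fun f hf =>
    hΦ.continuous_diag (continuous_cons hf)
  have hZ : ∀ f : (Fin (n + 1) → ℝ≥0) → ℝ, Continuous f → Continuous fun t =>
      Ψ (fun x => f (σ t x)) t := fun f hf =>
    hΨ.continuous_diag (F := fun t x => f (σ t x)) (hf.comp hσ)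
  have hYm := fun f hf t => hΦ.mem _ (hc1 f hf t) t
  have hZm := fun f hf t => hΨ.mem _ (hc2 f hf t) t
  refine ⟨fun f hf s => ?_, fun f g hf hg s => ?_, fun T => ?_⟩
  · exact add_mem (ito_mem hB hm (hYm f hf) (hY f hf) s)
      (Submodule.smul_mem _ _ (timeInt_mem hm (hZm f hf) (hZ f hf) s))
  · have e1 : ∀ t, Φ (fun x => f (Fin.cons t x : Fin (n + 1) → ℝ≥0) - g (Fin.cons t x)) t
        = Φ (fun x => f (Fin.cons t x : Fin (n + 1) → ℝ≥0)) t
          - Φ (fun x => g (Fin.cons t x : Fin (n + 1) → ℝ≥0)) t := fun t =>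
      hΦ.sub _ _ (hc1 f hf t) (hc1 g hg t) t
    have e2 : ∀ t, Ψ (fun x => f (σ t x) - g (σ t x)) t
        = Ψ (fun x => f (σ t x)) t - Ψ (fun x => g (σ t x)) t := fun t =>
      hΨ.sub _ _ (hc2 f hf t) (hc2 g hg t) t
    simp only [e1, e2]
    rw [ito_sub hB hm (hYm f hf) (hY f hf) (hYm g hg) (hY g hg), timeInt_sub (hZ f hf) (hZ g hg),
      smul_sub]
    abel
  · obtain ⟨C₁, hC₁, h₁⟩ := hΦ.bound T
    obtain ⟨C₂, hC₂, h₂⟩ := hΨ.bound T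
    set C₀ := 2 * C₁ + C₂ * √T with hC₀
    have hC₀' : 0 ≤ C₀ := by positivity
    have incr : ∀ f, Continuous f → ∀ M : ℝ, (∀ x, (∀ i, x i ≤ T) → |f x| ≤ M) →
        ∀ a b, a ≤ b → b ≤ T →
        ‖(ito B (fun t => Φ (fun x => f (Fin.cons t x : Fin (n + 1) → ℝ≥0)) t) b
          + (1 / 2 : ℝ) • timeInt (fun t => Ψ (fun x => f (σ t x)) t) b)
          - (ito B (fun t => Φ (fun x => f (Fin.cons t x : Fin (n + 1) → ℝ≥0)) t) a
          + (1 / 2 : ℝ) • timeInt (fun t => Ψ (fun x => f (σ t x)) t) a)‖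
          ≤ C₀ * M * √((b : ℝ) - a) := by
      intro f hf M hM a b hab hbT
      have hM0 : 0 ≤ M := (abs_nonneg _).trans (hM 0 fun i => zero_le)
      have hba : (0 : ℝ) ≤ (b : ℝ) - a := sub_nonneg.2 (NNReal.coe_le_coe.2 hab)
      have i1 := (isMartIncr_ito_sub hB hm (hYm f hf) (hY f hf) hab (c := C₁ * M) fun r _ hr =>
        (h₁ _ (hc1 f hf r) M fun x hx => hM _ fun i => by
          refine Fin.cases ?_ (fun j => ?_) i
          · simpa using hr.trans hbT
          · simpa using hx j).1 r (hr.trans hbT)).norm_sq_le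
      have i2 := norm_timeInt_sub_le (hZ f hf) hab (c := C₂ * M) fun r _ hr =>
        (h₂ _ (hc2 f hf r) M fun x hx => hM _ (hσT T r (hr.trans hbT) x hx)).1 r (hr.trans hbT)
      set I := ito B (fun t => Φ (fun x => f (Fin.cons t x : Fin (n + 1) → ℝ≥0)) t)
      set J := timeInt (fun t => Ψ (fun x => f (σ t x)) t)
      -- The factor $2$ absorbs $\sqrt3$.
      have i3 : ‖I b - I a‖ ≤ 2 * C₁ * M * √((b : ℝ) - a) := by
        refine le_of_sq_le_sq (i1.trans ?_) (by positivity)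
        rw [mul_pow (2 * C₁ * M), Real.sq_sqrt hba]
        have : 0 ≤ (C₁ * M) ^ 2 * ((b : ℝ) - a) := by positivity
        nlinarith
      have i4 : ‖J b - J a‖ ≤ C₂ * √T * M * √((b : ℝ) - a) := by
        refine i2.trans ?_
        -- The time integral is Lipschitz, hence Hölder of exponent $\tfrac12$ on $[0,T]$ at the
        -- cost of $\sqrt T$.
        have h5 : (b : ℝ) - a ≤ √T * √((b : ℝ) - a) := by
          have h6 : √((b : ℝ) - a) ≤ √T := Real.sqrt_le_sqrt (by
            have : (b : ℝ) ≤ T := hbT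
            have : (0 : ℝ) ≤ a := a.2
            linarith)
          calc (b : ℝ) - a = √((b : ℝ) - a) * √((b : ℝ) - a) := (Real.mul_self_sqrt hba).symm
            _ ≤ _ := by gcongr
        calc C₂ * M * ((b : ℝ) - a) ≤ C₂ * M * (√T * √((b : ℝ) - a)) := by gcongr
          _ = _ := by ring
      calc ‖(I b + (1 / 2 : ℝ) • J b) - (I a + (1 / 2 : ℝ) • J a)‖
          = ‖(I b - I a) + (1 / 2 : ℝ) • (J b - J a)‖ := by rw [smul_sub]; congr 1; abel
        _ ≤ ‖I b - I a‖ + ‖(1 / 2 : ℝ) • (J b - J a)‖ := norm_add_le _ _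
        _ = ‖I b - I a‖ + 1 / 2 * ‖J b - J a‖ := by rw [norm_smul]; norm_num
        _ ≤ ‖I b - I a‖ + ‖J b - J a‖ := by linarith [norm_nonneg (J b - J a)]
        _ ≤ _ := (add_le_add i3 i4).trans (le_of_eq (by rw [hC₀]; ring))
    -- Both integrals vanish at time $0$, so the value at `s` is an increment, bounded through
    -- $\sqrt s\le 1+\sqrt T$; one constant serves both bounds.
    refine ⟨C₀ * (1 + √T), by positivity, fun f hf M hM => ?_⟩
    have hM0 : 0 ≤ M := (abs_nonneg _).trans (hM 0 fun i => zero_le)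
    refine ⟨fun s hs => ?_, fun a b hab hbT => (incr f hf M hM a b hab hbT).trans ?_⟩
    · have h := incr f hf M hM 0 s zero_le hs
      rw [ito_zero hB hm (hYm f hf) (hY f hf), timeInt_zero, smul_zero, add_zero, sub_zero,
        NNReal.coe_zero, sub_zero] at h
      refine h.trans ?_
      have h5 : √(s : ℝ) ≤ 1 + √T := by
        have : √(s : ℝ) ≤ √T := Real.sqrt_le_sqrt hs
        linarith
      calc C₀ * M * √(s : ℝ) ≤ C₀ * M * (1 + √T) := by gcongr
        _ = _ := by ring
    · have : C₀ ≤ C₀ * (1 + √T) := le_mul_of_one_le_right hC₀' (by linarith [Real.sqrt_nonneg T])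
      gcongr

variable (P) in
/-- The iterated Stratonovich integral of a continuous function as a sum of iterated Itô and time
integrals. -/
def strat (B : ℝ≥0 → Ω → ℝ) : (n : ℕ) → ((Fin n → ℝ≥0) → ℝ) → ℝ≥0 → Lp ℝ 4 P
  | 0, f, _ => Lp.const 4 P (f Fin.elim0)
  | 1, f, s => ito B (fun t => strat B 0 (fun x => f (Fin.cons t x : Fin 1 → ℝ≥0)) t) s
  | n + 2, f, s =>
      ito B (fun t => strat B (n + 1) (fun x => f (Fin.cons t x : Fin (n + 2) → ℝ≥0)) t) s
        + (1 / 2 : ℝ) • timeInt (fun t => strat B n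
            (fun x => f (Fin.cons t (Fin.cons t x : Fin (n + 1) → ℝ≥0) : Fin (n + 2) → ℝ≥0)) t) s

/-- Two consecutive orders are carried together because order `n + 2` is built from orders `n + 1`
and `n`. -/
lemma isVolterraOp_strat (hB : IsPreBrownianReal B P) (hm : ∀ t, Measurable (B t)) (n : ℕ) :
    IsVolterraOp B (strat P B n) ∧ IsVolterraOp B (strat P B (n + 1)) := by
  induction n with
  | zero =>
    have h0 : IsVolterraOp B (strat P B 0) := by
      convert isVolterraOp_const (B := B) (P := P) using 1
      funext f s
      rw [strat]
    refine ⟨h0, ?_⟩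
    have h1 := h0.succ hB hm (isVolterraOp_zero 0) (σ := fun t _ _ => t)
      (continuous_pi fun _ => continuous_fst) (fun T t ht _ _ _ => ht)
    convert h1 using 1
    funext f s
    rw [strat, show timeInt (fun _ : ℝ≥0 => (0 : Lp ℝ 4 P)) s = 0 by simp [timeInt], smul_zero,
      add_zero]
  | succ n ih =>
    refine ⟨ih.2, ?_⟩
    have h1 := ih.2.succ hB hm ih.1
      (σ := fun t x => Fin.cons t (Fin.cons t x : Fin (n + 1) → ℝ≥0))
      (Continuous.finCons (A := fun _ => ℝ≥0) continuous_fst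
        (Continuous.finCons (A := fun _ => ℝ≥0) continuous_fst continuous_snd))
      (fun T t ht x hx i => by
        refine Fin.cases (by simpa using ht) (fun j => ?_) i
        refine Fin.cases (by simpa using ht) (fun k => by simpa using hx k) j)
    convert h1 using 1
    funext f s
    rw [strat]

end Strat

/-! ### Second moment estimates -/

section SecondMoment

variable {Ω : Type*} [MeasurableSpace Ω] {P : Measure Ω}

instance holderTriple_four_four_two : ENNReal.HolderTriple 4 4 2 := ⟨by
  have h : (4 : ENNReal)⁻¹ = ENNReal.ofReal (1 / 4) := by
    rw [one_div, ENNReal.ofReal_inv_of_pos (by norm_num)]; norm_num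
  have h' : (2 : ENNReal)⁻¹ = ENNReal.ofReal (1 / 2) := by
    rw [one_div, ENNReal.ofReal_inv_of_pos (by norm_num)]; norm_num
  rw [h, h', ← ENNReal.ofReal_add (by norm_num) (by norm_num)]
  norm_num⟩

lemma eLpNorm_two_le {f : Ω → ℝ} (hf : MemLp f 2 P) {c : ℝ} (hc : 0 ≤ c)
    (h : ∫ ω, f ω ^ 2 ∂P ≤ c ^ 2) : eLpNorm f 2 P ≤ ENNReal.ofReal c := by
  rw [hf.eLpNorm_eq_integral_rpow_norm (by norm_num) (by norm_num)]
  refine ENNReal.ofReal_le_ofReal ?_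
  have e : ∀ ω, ‖f ω‖ ^ (2 : ENNReal).toReal = f ω ^ 2 := fun ω => by
    rw [ENNReal.toReal_ofNat, Real.rpow_two, Real.norm_eq_abs, sq_abs]
  simp only [e]
  rw [ENNReal.toReal_ofNat, ← one_div, ← Real.sqrt_eq_rpow, Real.sqrt_le_left hc]
  exact h

variable {B : ℝ≥0 → Ω → ℝ}

lemma memLp_four_increment (hB : IsPreBrownianReal B P) (a b : ℝ≥0) :
    MemLp (fun ω => B b ω - B a ω) 4 P := by
  have h := memLp_increment hB a b 4
  rwa [ENNReal.coe_ofNat] at h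

lemma memLp_two_mul_increment (hB : IsPreBrownianReal B P) (R : Lp ℝ 4 P) (a b : ℝ≥0) :
    MemLp (fun ω => R ω * (B b ω - B a ω)) 2 P :=
  MemLp.mul' (p := 4) (q := 4) (memLp_four_increment hB a b) (Lp.memLp R)

/-- Hölder's inequality with $\tfrac14+\tfrac14=\tfrac12$, needing no adaptedness of `R`. The $L^4$
norm of the increment is $3^{1/4}\sqrt{b-a}\le 2\sqrt{b-a}$. -/
lemma eLpNorm_mul_increment_le (hB : IsPreBrownianReal B P) (R : Lp ℝ 4 P) {a b : ℝ≥0}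
    (hab : a ≤ b) :
    eLpNorm (fun ω => R ω * (B b ω - B a ω)) 2 P
      ≤ ENNReal.ofReal (‖R‖ * (2 * √((b : ℝ) - a))) := by
  have hD : MemLp (fun ω => B b ω - B a ω) 4 P := memLp_four_increment hB a b
  have hba : (0 : ℝ) ≤ (b : ℝ) - a := sub_nonneg.2 (NNReal.coe_le_coe.2 hab)
  let D : Lp ℝ 4 P := hD.toLp (fun ω => B b ω - B a ω)
  have hDae : D =ᵐ[P] fun ω => B b ω - B a ω := hD.coeFn_toLp
  have hDn : eLpNorm (fun ω => B b ω - B a ω) 4 P = ENNReal.ofReal ‖D‖ := by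
    rw [Lp.norm_toLp, ENNReal.ofReal_toReal hD.eLpNorm_ne_top]
  have h4 : ‖D‖ ≤ 2 * √((b : ℝ) - a) := by
    refine le_of_pow_le_pow_left₀ (n := 4) (by norm_num) (by positivity) ?_
    rw [norm_pow_four]
    have e : ∫ ω, D ω ^ 4 ∂P = 3 * ((b : ℝ) - a) ^ 2 := by
      rw [← integral_increment_four hB hab]
      apply integral_congr_ae
      filter_upwards [hDae] with ω hω
      rw [hω]
    rw [e, mul_pow, show √((b : ℝ) - a) ^ 4 = (√((b : ℝ) - a) ^ 2) ^ 2 by ring, Real.sq_sqrt hba]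
    nlinarith [sq_nonneg ((b : ℝ) - a)]
  have h1 : eLpNorm (fun ω => R ω * (B b ω - B a ω)) 2 P
      ≤ eLpNorm R 4 P * eLpNorm (fun ω => B b ω - B a ω) 4 P := by
    have h := eLpNorm_smul_le_mul_eLpNorm (𝕜 := ℝ) (E := ℝ) (μ := P) (p := 4) (q := 4) (r := 2)
      (f := fun ω => B b ω - B a ω) hD.1 (φ := fun ω => R ω) (Lp.aestronglyMeasurable R)
    have e : (fun ω => R ω) • (fun ω => B b ω - B a ω) = fun ω => R ω * (B b ω - B a ω) := by
      ext ω
      simp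
    rwa [e] at h
  refine h1.trans ?_
  rw [ENNReal.ofReal_mul (norm_nonneg R)]
  refine mul_le_mul' (le_of_eq ?_) ?_
  · rw [Lp.norm_def, ENNReal.ofReal_toReal (Lp.eLpNorm_ne_top R)]
  · rw [hDn]
    exact ENNReal.ofReal_le_ofReal h4

variable [IsProbabilityMeasure P]

lemma eLpNorm_two_coeFn_le (X : Lp ℝ 4 P) : eLpNorm X 2 P ≤ ENNReal.ofReal ‖X‖ := by
  rw [Lp.norm_def, ENNReal.ofReal_toReal (Lp.eLpNorm_ne_top X)]
  exact eLpNorm_le_eLpNorm_of_exponent_le (by norm_num) (Lp.aestronglyMeasurable X)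

lemma memLp_two_coeFn (X : Lp ℝ 4 P) : MemLp X 2 P := (Lp.memLp X).mono_exponent (by norm_num)

lemma integral_sq_le (X : Lp ℝ 4 P) : ∫ ω, X ω ^ 2 ∂P ≤ ‖X‖ ^ 2 := by
  have h := integral_sq_mul_sq_le X (Lp.const 4 P (1 : ℝ))
  have h1 : ‖Lp.const 4 P (1 : ℝ)‖ ≤ 1 := by
    have := Lp.norm_const_le (μ := P) (p := 4) (c := (1 : ℝ))
    simpa using this
  have h2 : ∫ ω, X ω ^ 2 * (Lp.const 4 P (1 : ℝ)) ω ^ 2 ∂P = ∫ ω, X ω ^ 2 ∂P := by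
    apply integral_congr_ae
    filter_upwards [Lp.coeFn_const 4 P (1 : ℝ)] with ω hω
    rw [hω]
    simp
  rw [h2] at h
  refine h.trans (mul_le_of_le_one_right (by positivity) ?_)
  exact pow_le_one₀ (norm_nonneg _) h1

/-- Weighted sums of the compensated squared increments have orthogonal terms. -/
lemma integral_sum_compensated_sq_le (hB : IsPreBrownianReal B P) (hm : ∀ t, Measurable (B t))
    {τ : ℕ → ℝ≥0} (hτ : Monotone τ) {Z : ℕ → Lp ℝ 4 P} (hZ : ∀ i, Z i ∈ pastL4 B P (τ i))
    (N : ℕ) :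
    MemLp (fun ω => ∑ i ∈ Finset.range N, Z i ω *
        ((B (τ (i + 1)) ω - B (τ i) ω) ^ 2 - ((τ (i + 1) : ℝ) - τ i))) 2 P ∧
      ∫ ω, (∑ i ∈ Finset.range N, Z i ω *
        ((B (τ (i + 1)) ω - B (τ i) ω) ^ 2 - ((τ (i + 1) : ℝ) - τ i))) ^ 2 ∂P
      ≤ ∑ i ∈ Finset.range N, 2 * ‖Z i‖ ^ 2 * ((τ (i + 1) : ℝ) - τ i) ^ 2 := by
  -- Adaptedness of the partial sum joins the induction, since it makes the cross term with the next
  -- summand vanish.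
  suffices h : AEStronglyMeasurable[past B (τ N)] (fun ω => ∑ i ∈ Finset.range N, Z i ω *
        ((B (τ (i + 1)) ω - B (τ i) ω) ^ 2 - ((τ (i + 1) : ℝ) - τ i))) P ∧
      MemLp (fun ω => ∑ i ∈ Finset.range N, Z i ω *
        ((B (τ (i + 1)) ω - B (τ i) ω) ^ 2 - ((τ (i + 1) : ℝ) - τ i))) 2 P ∧
      ∫ ω, (∑ i ∈ Finset.range N, Z i ω *
        ((B (τ (i + 1)) ω - B (τ i) ω) ^ 2 - ((τ (i + 1) : ℝ) - τ i))) ^ 2 ∂P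
      ≤ ∑ i ∈ Finset.range N, 2 * ‖Z i‖ ^ 2 * ((τ (i + 1) : ℝ) - τ i) ^ 2 from h.2
  induction N with
  | zero => exact ⟨by simpa using stronglyMeasurable_const.aestronglyMeasurable, by simp, by simp⟩
  | succ N ih =>
    obtain ⟨ih1, ih2, ih3⟩ := ih
    simp only [Finset.sum_range_succ]
    set M : Ω → ℝ := fun ω => ∑ i ∈ Finset.range N, Z i ω *
        ((B (τ (i + 1)) ω - B (τ i) ω) ^ 2 - ((τ (i + 1) : ℝ) - τ i)) with hM
    set a := τ N with ha
    set b := τ (N + 1) with hb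
    have hab : a ≤ b := hτ N.le_succ
    set d : ℝ := (b : ℝ) - a with hd
    set g : ℝ → ℝ := fun x => x ^ 2 - d with hg
    have hgm : Measurable g := by fun_prop
    have hg2m : Measurable (fun x => g x ^ 2) := by fun_prop
    have hgi : Integrable (fun ω => g (B b ω - B a ω)) P :=
      (integrable_increment_pow hB a b 2).sub (integrable_const d)
    have e2 : ∀ ω, g (B b ω - B a ω) ^ 2
        = (B b ω - B a ω) ^ 4 - (2 * d) * (B b ω - B a ω) ^ 2 + d ^ 2 := fun ω => by
      simp only [hg]; ring
    have i4 := integrable_increment_pow hB a b 4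
    have i2 := (integrable_increment_pow hB a b 2).const_mul (2 * d)
    have i42 : Integrable (fun ω => (B b ω - B a ω) ^ 4 - 2 * d * (B b ω - B a ω) ^ 2) P :=
      i4.sub i2
    have hg2i : Integrable (fun ω => g (B b ω - B a ω) ^ 2) P := by
      simp only [e2]
      exact i42.add (integrable_const _)
    have hg0 : ∫ ω, g (B b ω - B a ω) ∂P = 0 := by
      simp only [hg]
      rw [integral_sub (integrable_increment_pow hB a b 2) (integrable_const d),
        integral_increment_sq hB hab]
      simp [hd]
    -- $3d^2-2d\cdot d+d^2=2d^2$.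
    have hg2 : ∫ ω, g (B b ω - B a ω) ^ 2 ∂P = 2 * d ^ 2 := by
      simp only [e2]
      rw [integral_add i42 (integrable_const _), integral_sub i4 i2, integral_const_mul,
        integral_increment_sq hB hab, integral_increment_four hB hab]
      simp [← hd]
      ring
    have hZN := mem_pastL4.1 (hZ N)
    have hMZ : Integrable (fun ω => M ω * Z N ω) P := ih2.integrable_mul (memLp_two_coeFn (Z N))
    have hZ2 : Integrable (fun ω => Z N ω ^ 2) P := (memLp_two_coeFn (Z N)).integrable_sq
    have j1 := integrable_past_mul hB hab (ih1.mul hZN) hMZ hgm hgi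
    have j2 : Integrable (fun ω => Z N ω ^ 2 * g (B b ω - B a ω) ^ 2) P :=
      integrable_past_mul hB hab (hZN.pow 2) hZ2 hg2m hg2i
    have k1 := integral_past_mul hB hm hab (ih1.mul hZN) hgm
    have k2 := integral_past_mul hB hm hab (hZN.pow 2) hg2m
    simp only [Pi.mul_apply, hg0, mul_zero] at k1
    simp only [Pi.pow_apply, hg2] at k2
    have hZg : MemLp (fun ω => Z N ω * g (B b ω - B a ω)) 2 P := by
      have hmeas : AEStronglyMeasurable (fun ω => Z N ω * g (B b ω - B a ω)) P :=
        (Lp.aestronglyMeasurable (Z N)).mul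
          (hgm.comp ((hm b).sub (hm a))).aestronglyMeasurable
      rw [memLp_two_iff_integrable_sq hmeas]
      refine j2.congr (.of_forall fun ω => ?_)
      ring
    refine ⟨?_, ih2.add hZg, ?_⟩
    · refine AEStronglyMeasurable.add (ih1.mono (past_mono hab))
        ((hZN.mono (past_mono hab)).mul ?_)
      exact (hgm.comp (Measurable.sub (measurable_past le_rfl)
        (measurable_past hab))).aestronglyMeasurable
    · have hexp : ∀ ω, (M ω + Z N ω * ((B b ω - B a ω) ^ 2 - d)) ^ 2
          = M ω ^ 2 + 2 * (M ω * Z N ω * g (B b ω - B a ω))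
            + Z N ω ^ 2 * g (B b ω - B a ω) ^ 2 := fun ω => by
        simp only [hg]; ring
      have h5 := integral_sq_le (Z N)
      have h6 : ∫ ω, (M ω + Z N ω * ((B b ω - B a ω) ^ 2 - d)) ^ 2 ∂P
          = ∫ ω, M ω ^ 2 ∂P + (∫ ω, Z N ω ^ 2 ∂P) * (2 * d ^ 2) := by
        simp only [hexp]
        have j0 : Integrable (fun ω => M ω ^ 2) P := ih2.integrable_sq
        have j1' : Integrable (fun ω => 2 * (M ω * Z N ω * g (B b ω - B a ω))) P := j1.const_mul 2
        rw [integral_add (j0.fun_add j1') j2, integral_add j0 j1', integral_const_mul, k1, k2]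
        ring
      rw [h6]
      nlinarith [sq_nonneg d, mul_le_mul_of_nonneg_right h5 (sq_nonneg d)]

end SecondMoment

/-! ### Convergence of the trapezoidal sums -/

section Trapezoid

variable {Ω : Type*} [MeasurableSpace Ω] {P : Measure Ω} {B : ℝ≥0 → Ω → ℝ}

lemma sum_sub_partition (τ : ℕ → ℝ≥0) (k : ℕ) :
    ∑ i ∈ Finset.range k, ((τ (i + 1) : ℝ) - τ i) = (τ k : ℝ) - τ 0 :=
  Finset.sum_range_sub (fun i => (τ i : ℝ)) k

/-- The error of the trapezoidal rule over one cell of the partition. -/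
lemma trapezoid_cell (hB : IsPreBrownianReal B P) (hm : ∀ t, Measurable (B t))
    {a b : ℝ≥0} (hab : a ≤ b) {Ya Yb Z A R I J : Lp ℝ 4 P} (hY : Ya ∈ pastL4 B P a)
    (hZ : Z ∈ pastL4 B P a) (hA : A ∈ pastL4 B P a)
    (h : Yb - Ya = A + mulIncr B a b Z + R) :
    (fun ω => (Ya ω + Yb ω) / 2 * (B b ω - B a ω) - (I + (1 / 2 : ℝ) • J) ω) =ᵐ[P]
      fun ω => ((mulIncr B a b Ya - I) + (1 / 2 : ℝ) • mulIncr B a b A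
          + (1 / 2 : ℝ) • (((b : ℝ) - a) • Z - J)) ω
        + (1 / 2 * (R ω * (B b ω - B a ω))
        + 1 / 2 * (Z ω * ((B b ω - B a ω) ^ 2 - ((b : ℝ) - a)))) := by
  have hYb : Yb = Ya + A + mulIncr B a b Z + R := by
    rw [sub_eq_iff_eq_add] at h
    rw [h]
    abel
  -- The trapezoidal term is $Y_a\Delta B+\tfrac12(A+Z\Delta B+R)\Delta B$, and $Z(\Delta B)^2$ is
  -- split as $Z\Delta t+Z((\Delta B)^2-\Delta t)$.
  filter_upwards [coeFn_mulIncr hB hm hab hY, coeFn_mulIncr hB hm hab hZ,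
    coeFn_mulIncr hB hm hab hA, Lp.coeFn_add I ((1 / 2 : ℝ) • J), Lp.coeFn_smul (1 / 2 : ℝ) J,
    Lp.coeFn_add (Ya + A + mulIncr B a b Z) R, Lp.coeFn_add (Ya + A) (mulIncr B a b Z),
    Lp.coeFn_add Ya A, Lp.coeFn_add ((mulIncr B a b Ya - I) + (1 / 2 : ℝ) • mulIncr B a b A)
      ((1 / 2 : ℝ) • (((b : ℝ) - a) • Z - J)),
    Lp.coeFn_add (mulIncr B a b Ya - I) ((1 / 2 : ℝ) • mulIncr B a b A),
    Lp.coeFn_sub (mulIncr B a b Ya) I, Lp.coeFn_smul (1 / 2 : ℝ) (mulIncr B a b A),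
    Lp.coeFn_smul (1 / 2 : ℝ) (((b : ℝ) - a) • Z - J), Lp.coeFn_sub (((b : ℝ) - a) • Z) J,
    Lp.coeFn_smul ((b : ℝ) - a) Z]
    with ω h1 h2 h3 h4 h5 h6 h7 h8 h9 h10 h11 h12 h13 h14 h15
  rw [hYb, h4, h6, h9]
  simp only [Pi.add_apply, h5, h7, h10, h13, Pi.smul_apply, h14, Pi.sub_apply, h15, h11, h12, h8,
    h1, h2, h3, smul_eq_mul]
  ring

variable [IsProbabilityMeasure P]

/-- If the increments of `Y` are those of `∫ Z dB`, up to a small part known at the beginning of the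
interval and a remainder of smaller order, then the Stratonovich integral of `Y` is the Itô
integral plus half the time integral of `Z`. -/
theorem isStratonovichIntegral_of_expansion
    (hB : IsPreBrownianReal B P) (hm : ∀ t, Measurable (B t))
    {Y Z : ℝ≥0 → Lp ℝ 4 P} (hY : ∀ t, Y t ∈ pastL4 B P t) (hYc : Continuous Y)
    (hZ : ∀ t, Z t ∈ pastL4 B P t) (hZc : Continuous Z) (s : ℝ≥0)
    (hexp : ∀ ε : ℝ, 0 < ε → ∃ δ : ℝ, 0 < δ ∧ ∀ a b : ℝ≥0, a ≤ b → b ≤ s → (b : ℝ) - a ≤ δ →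
      ∃ A R : Lp ℝ 4 P, A ∈ pastL4 B P a ∧ ‖A‖ ≤ ε ∧ ‖R‖ ≤ ε * √((b : ℝ) - a) ∧
        Y b - Y a = A + mulIncr B a b (Z a) + R) :
    IsStratonovichIntegral B P s (fun t ω => Y t ω)
      (ito B Y s + (1 / 2 : ℝ) • timeInt Z s : Lp ℝ 4 P) := by
  refine ⟨memLp_two_coeFn _, fun ε hε => ?_⟩
  obtain ⟨K, hK⟩ := (isCompact_Icc (a := 0) (b := s)).exists_bound_of_continuousOn
    hZc.continuousOn
  have hs0 : (0 : ℝ) ≤ s := s.2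
  -- The errors below add up to $\eta(4\sqrt s+2s+1)$, which is at most `ε`.
  set η : ℝ := ε / (4 * √s + 3 * s + 1) with hη
  have hη0 : 0 < η := by positivity
  obtain ⟨δ₁, hδ₁, hmodY⟩ := exists_modulus hYc s hη0
  obtain ⟨δ₂, hδ₂, hmodZ⟩ := exists_modulus hZc s hη0
  obtain ⟨δ₃, hδ₃, hE⟩ := hexp η hη0
  -- Chosen so that $2K^2\delta_4 s\le\eta^2$, the bound needed for the compensated squared
  -- increments.
  set δ₄ : ℝ := η ^ 2 / (2 * K ^ 2 * s + 1) with hδ₄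
  have hδ₄0 : 0 < δ₄ := by positivity
  refine ⟨min (min δ₁ δ₂) (min δ₃ δ₄), by positivity, fun k τ hτ h0 hk hmesh => ?_⟩
  have hm1 : ∀ i < k, (τ (i + 1) : ℝ) - τ i ≤ δ₁ := fun i hi =>
    (hmesh i hi).trans ((min_le_left _ _).trans (min_le_left _ _))
  have hm2 : ∀ i < k, (τ (i + 1) : ℝ) - τ i ≤ δ₂ := fun i hi =>
    (hmesh i hi).trans ((min_le_left _ _).trans (min_le_right _ _))
  have hm3 : ∀ i < k, (τ (i + 1) : ℝ) - τ i ≤ δ₃ := fun i hi =>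
    (hmesh i hi).trans ((min_le_right _ _).trans (min_le_left _ _))
  have hm4 : ∀ i < k, (τ (i + 1) : ℝ) - τ i ≤ δ₄ := fun i hi =>
    (hmesh i hi).trans ((min_le_right _ _).trans (min_le_right _ _))
  have hle : ∀ i ≤ k, τ i ≤ s := fun i hi => hk ▸ hτ hi
  have hst : ∀ i, τ i ≤ τ (i + 1) := fun i => hτ i.le_succ
  have hd0 : ∀ i, (0 : ℝ) ≤ (τ (i + 1) : ℝ) - τ i := fun i =>
    sub_nonneg.2 (NNReal.coe_le_coe.2 (hst i))
  have hsum : ∑ i ∈ Finset.range k, ((τ (i + 1) : ℝ) - τ i) = s := by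
    rw [sum_sub_partition, h0, hk, NNReal.coe_zero, sub_zero]
  have hosc : ∀ i < k, ∀ r, τ i ≤ r → r ≤ τ (i + 1) →
      |(r : ℝ) - τ i| ≤ (τ (i + 1) : ℝ) - τ i := fun i hi r h1 h2 => by
    have h1' : (τ i : ℝ) ≤ r := h1
    have h2' : (r : ℝ) ≤ τ (i + 1) := h2
    rw [abs_of_nonneg (by linarith)]
    linarith
  have hex : ∀ i, ∃ A R : Lp ℝ 4 P, i < k → A ∈ pastL4 B P (τ i) ∧ ‖A‖ ≤ η ∧
      ‖R‖ ≤ η * √((τ (i + 1) : ℝ) - τ i) ∧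
      Y (τ (i + 1)) - Y (τ i) = A + mulIncr B (τ i) (τ (i + 1)) (Z (τ i)) + R := fun i => by
    by_cases hi : i < k
    · obtain ⟨A, R, h⟩ := hE _ _ (hst i) (hle _ hi) (hm3 i hi)
      exact ⟨A, R, fun _ => h⟩
    · exact ⟨0, 0, fun h => absurd h hi⟩
  choose A R hAR using hex
  set I : ℕ → Lp ℝ 4 P := fun i => ito B Y (τ (i + 1)) - ito B Y (τ i) with hI
  set J : ℕ → Lp ℝ 4 P := fun i => timeInt Z (τ (i + 1)) - timeInt Z (τ i) with hJ
  set E₁ : ℕ → Lp ℝ 4 P := fun i => mulIncr B (τ i) (τ (i + 1)) (Y (τ i)) - I i with hE₁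
  set E₂ : ℕ → Lp ℝ 4 P := fun i => mulIncr B (τ i) (τ (i + 1)) (A i) with hE₂
  set E₃ : ℕ → Lp ℝ 4 P := fun i => ((τ (i + 1) : ℝ) - τ i) • Z (τ i) - J i with hE₃
  set L : ℕ → Lp ℝ 4 P := fun i => E₁ i + (1 / 2 : ℝ) • E₂ i + (1 / 2 : ℝ) • E₃ i with hL
  set g : ℕ → Ω → ℝ := fun i ω => R i ω * (B (τ (i + 1)) ω - B (τ i) ω) with hg
  set q : Ω → ℝ := fun ω => ∑ i ∈ Finset.range k, Z (τ i) ω *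
    ((B (τ (i + 1)) ω - B (τ i) ω) ^ 2 - ((τ (i + 1) : ℝ) - τ i)) with hq
  have hIJ : ∑ i ∈ Finset.range k, (I i + (1 / 2 : ℝ) • J i)
      = ito B Y s + (1 / 2 : ℝ) • timeInt Z s := by
    rw [Finset.sum_add_distrib, ← Finset.smul_sum, hI, hJ,
      Finset.sum_range_sub (fun i => ito B Y (τ i)), Finset.sum_range_sub (fun i => timeInt Z (τ i)),
      h0, hk, ito_zero hB hm hY hYc, timeInt_zero, sub_zero, sub_zero]
  have hae : (fun ω => trapezoidSum B (fun t ω => Y t ω) k τ ω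
      - (ito B Y s + (1 / 2 : ℝ) • timeInt Z s : Lp ℝ 4 P) ω) =ᵐ[P]
      fun ω => (∑ i ∈ Finset.range k, L i : Lp ℝ 4 P) ω
        + (∑ i ∈ Finset.range k, 1 / 2 * g i ω + 1 / 2 * q ω) := by
    have hcell : ∀ᵐ ω ∂P, ∀ i ∈ Finset.range k,
        (Y (τ i) ω + Y (τ (i + 1)) ω) / 2 * (B (τ (i + 1)) ω - B (τ i) ω)
          - (I i + (1 / 2 : ℝ) • J i) ω = L i ω + (1 / 2 * g i ω + 1 / 2 * (Z (τ i) ω *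
            ((B (τ (i + 1)) ω - B (τ i) ω) ^ 2 - ((τ (i + 1) : ℝ) - τ i)))) := by
      rw [Finset.eventually_all]
      intro i hi
      obtain ⟨h1, -, -, h4⟩ := hAR i (Finset.mem_range.1 hi)
      exact trapezoid_cell hB hm (hst i) (hY _) (hZ _) h1 h4
    rw [← hIJ]
    filter_upwards [hcell, Lp.coeFn_fun_finsetSum (Finset.range k) L,
      Lp.coeFn_fun_finsetSum (Finset.range k) (fun i => I i + (1 / 2 : ℝ) • J i)] with ω h1 h2 h3
    rw [h2, h3, trapezoidSum, ← Finset.sum_sub_distrib, Finset.sum_congr rfl h1,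
      Finset.sum_add_distrib, Finset.sum_add_distrib, hq, Finset.mul_sum]
  have b1 : ‖∑ i ∈ Finset.range k, E₁ i‖ ≤ 2 * η * √s := by
    have key := (IsMartIncr.sum (P := P) (B := B) hτ (C := 3 * η ^ 2)
      (D := fun i => I i - mulIncr B (τ i) (τ (i + 1)) (Y (τ i))) k fun i hi =>
      isMartIncr_ito hB hm hY hYc (hst i) (hY _) fun r h1 h2 =>
        hmodY r (h2.trans (hle _ hi)) _ (hle _ hi.le)
          ((hosc i hi r h1 h2).trans (hm1 i hi))).norm_sq_le
    have e : ∑ i ∈ Finset.range k, E₁ i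
        = -∑ i ∈ Finset.range k, (I i - mulIncr B (τ i) (τ (i + 1)) (Y (τ i))) := by
      rw [← Finset.sum_neg_distrib]
      exact Finset.sum_congr rfl fun i _ => (neg_sub _ _).symm
    rw [e, norm_neg]
    refine le_of_sq_le_sq (key.trans ?_) (by positivity)
    rw [h0, hk, NNReal.coe_zero, sub_zero, mul_pow _ (√(s : ℝ)), Real.sq_sqrt hs0]
    nlinarith [mul_nonneg (sq_nonneg η) hs0]
  have b2 : ‖∑ i ∈ Finset.range k, E₂ i‖ ≤ 2 * η * √s := by
    have key := (IsMartIncr.sum (P := P) (B := B) hτ (C := 3 * η ^ 2) (D := E₂) k fun i hi => by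
      obtain ⟨h1, h2, -, -⟩ := hAR i hi
      refine (isMartIncr_mulIncr hB hm (hst i) h1).mono ?_
      have := hd0 i
      gcongr).norm_sq_le
    refine le_of_sq_le_sq (key.trans ?_) (by positivity)
    rw [h0, hk, NNReal.coe_zero, sub_zero, mul_pow _ (√(s : ℝ)), Real.sq_sqrt hs0]
    nlinarith [mul_nonneg (sq_nonneg η) hs0]
  have b3 : ‖∑ i ∈ Finset.range k, E₃ i‖ ≤ η * s := by
    refine (norm_sum_le _ _).trans ?_
    rw [← hsum, Finset.mul_sum]
    refine Finset.sum_le_sum fun i hi => ?_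
    have hi' := Finset.mem_range.1 hi
    rw [hE₃, norm_sub_rev]
    exact norm_timeInt_sub_sub_smul_le hZc (hst i) fun r h1 h2 =>
      hmodZ r (h2.trans (hle _ hi')) _ (hle _ hi'.le) ((hosc i hi' r h1 h2).trans (hm2 i hi'))
  have bL : ‖∑ i ∈ Finset.range k, L i‖ ≤ 4 * η * √s + η * s := by
    rw [hL, Finset.sum_add_distrib, Finset.sum_add_distrib, ← Finset.smul_sum, ← Finset.smul_sum]
    refine (norm_add₃_le).trans ?_
    rw [norm_smul, norm_smul]
    have h2 : ‖(1 / 2 : ℝ)‖ = 1 / 2 := by norm_num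
    rw [h2]
    linarith [norm_nonneg (∑ i ∈ Finset.range k, E₂ i), norm_nonneg (∑ i ∈ Finset.range k, E₃ i)]
  -- No orthogonality is available for the remainders, but the triangle inequality suffices: each
  -- term is at most $\tfrac12\cdot\eta\sqrt{\Delta t}\cdot2\sqrt{\Delta t}=\eta\Delta t$.
  have bg : eLpNorm (fun ω => ∑ i ∈ Finset.range k, 1 / 2 * g i ω) 2 P
      ≤ ENNReal.ofReal (η * s) := by
    have e : (fun ω => ∑ i ∈ Finset.range k, 1 / 2 * g i ω)
        = ∑ i ∈ Finset.range k, (1 / 2 : ℝ) • g i := by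
      ext ω
      simp [Finset.sum_apply]
    rw [e]
    refine (eLpNorm_sum_le (fun i _ =>
      ((memLp_two_mul_increment hB (R i) (τ i) (τ (i + 1))).1.const_smul _)) (by norm_num)).trans ?_
    rw [← hsum, Finset.mul_sum, ENNReal.ofReal_sum_of_nonneg fun i _ =>
      mul_nonneg hη0.le (hd0 i)]
    refine Finset.sum_le_sum fun i hi => ?_
    obtain ⟨-, -, h3, -⟩ := hAR i (Finset.mem_range.1 hi)
    rw [eLpNorm_const_smul]
    refine (mul_le_mul' (le_of_eq (Real.enorm_eq_ofReal (by norm_num)))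
      (eLpNorm_mul_increment_le hB (R i) (hst i))).trans ?_
    rw [← ENNReal.ofReal_mul (by norm_num)]
    refine ENNReal.ofReal_le_ofReal ?_
    have h5 := mul_le_mul_of_nonneg_right h3 (Real.sqrt_nonneg ((τ (i + 1) : ℝ) - τ i))
    rw [mul_assoc η, Real.mul_self_sqrt (hd0 i)] at h5
    linarith
  obtain ⟨hqL, hqI⟩ := integral_sum_compensated_sq_le hB hm hτ (fun i => hZ (τ i)) k
  have bq : eLpNorm (fun ω => 1 / 2 * q ω) 2 P ≤ ENNReal.ofReal η := by
    have h1 : eLpNorm q 2 P ≤ ENNReal.ofReal η := by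
      refine eLpNorm_two_le hqL hη0.le (hqI.trans ?_)
      have h2 : ∀ i ∈ Finset.range k, 2 * ‖Z (τ i)‖ ^ 2 * ((τ (i + 1) : ℝ) - τ i) ^ 2
          ≤ 2 * K ^ 2 * δ₄ * ((τ (i + 1) : ℝ) - τ i) := fun i hi => by
        have hi' := Finset.mem_range.1 hi
        have h3 := hK (τ i) ⟨zero_le, hle _ hi'.le⟩
        have h4 := hm4 i hi'
        have h5 := hd0 i
        calc 2 * ‖Z (τ i)‖ ^ 2 * ((τ (i + 1) : ℝ) - τ i) ^ 2
            ≤ 2 * K ^ 2 * (((τ (i + 1) : ℝ) - τ i) * ((τ (i + 1) : ℝ) - τ i)) := by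
              rw [sq ((τ (i + 1) : ℝ) - τ i)]
              gcongr
          _ ≤ 2 * K ^ 2 * (δ₄ * ((τ (i + 1) : ℝ) - τ i)) := by gcongr
          _ = _ := by ring
      refine (Finset.sum_le_sum h2).trans ?_
      rw [← Finset.mul_sum, hsum, hδ₄, mul_div_assoc', div_mul_eq_mul_div,
        div_le_iff₀ (by positivity)]
      nlinarith [sq_nonneg η]
    have e : (fun ω => 1 / 2 * q ω) = (1 / 2 : ℝ) • q := by
      ext ω
      simp
    rw [e, eLpNorm_const_smul]
    refine le_trans ?_ h1
    refine mul_le_of_le_one_left' ?_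
    rw [Real.enorm_eq_ofReal (by norm_num)]
    exact ENNReal.ofReal_le_one.2 (by norm_num)
  have mg : AEStronglyMeasurable (fun ω => ∑ i ∈ Finset.range k, 1 / 2 * g i ω) P :=
    Finset.aestronglyMeasurable_fun_sum _ fun i _ =>
      (memLp_two_mul_increment hB (R i) (τ i) (τ (i + 1))).1.const_mul _
  have mq : AEStronglyMeasurable (fun ω => 1 / 2 * q ω) P := hqL.1.const_mul _
  rw [eLpNorm_congr_ae hae]
  refine (eLpNorm_add_le (Lp.aestronglyMeasurable _) (mg.add mq) (by norm_num)).trans ?_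
  refine (add_le_add (eLpNorm_two_coeFn_le _)
    ((eLpNorm_add_le mg mq (by norm_num)).trans (add_le_add bg bq))).trans ?_
  rw [← ENNReal.ofReal_add (by positivity) hη0.le,
    ← ENNReal.ofReal_add (norm_nonneg _) (by positivity)]
  refine ENNReal.ofReal_le_ofReal ?_
  have hfin : η * (4 * √s + 3 * s + 1) = ε := by
    rw [hη]
    field_simp
  nlinarith [mul_nonneg hη0.le hs0]

end Trapezoid

/-! ### Existence of the iterated Stratonovich integrals of continuous functions -/

section Existence

variable {Ω : Type*} [MeasurableSpace Ω] {P : Measure Ω} [IsProbabilityMeasure P]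
  {B : ℝ≥0 → Ω → ℝ}

lemma exists_modulus_prod {E : Type*} [SeminormedAddCommGroup E] {G : ℝ≥0 × ℝ≥0 → E}
    (hG : Continuous G) (T : ℝ≥0) {ε : ℝ} (hε : 0 < ε) :
    ∃ δ : ℝ, 0 < δ ∧ ∀ u ≤ T, ∀ r ≤ T, ∀ v ≤ T, ∀ w ≤ T,
      |(u : ℝ) - v| ≤ δ → |(r : ℝ) - w| ≤ δ → ‖G (u, r) - G (v, w)‖ ≤ ε := by
  have hcomp : IsCompact (Set.Icc 0 T ×ˢ Set.Icc 0 T) := isCompact_Icc.prod isCompact_Icc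
  have hu := hcomp.uniformContinuousOn_of_continuous hG.continuousOn
  obtain ⟨δ, hδ, h⟩ := Metric.uniformContinuousOn_iff.1 hu ε hε
  refine ⟨δ / 2, half_pos hδ, fun u hu r hr v hv w hw h1 h2 => ?_⟩
  have h3 := h (u, r) ⟨⟨zero_le, hu⟩, ⟨zero_le, hr⟩⟩ (v, w) ⟨⟨zero_le, hv⟩, ⟨zero_le, hw⟩⟩ (by
    rw [Prod.dist_eq, NNReal.dist_eq, NNReal.dist_eq]
    exact max_lt (by linarith) (by linarith))
  rw [dist_eq_norm] at h3
  exact h3.le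

/-- Gives orders one and higher a common form, with $V=0$ at order one, so that the increments of an
inner integral of any positive order can be expanded at once. -/
lemma strat_succ (hB : IsPreBrownianReal B P) (hm : ∀ t, Measurable (B t)) (n : ℕ) :
    ∃ V : ((Fin (n + 1) → ℝ≥0) → ℝ) → ℝ≥0 → Lp ℝ 4 P,
      (∀ f s, strat P B (n + 1) f s
        = ito B (fun t => strat P B n (fun x => f (Fin.cons t x : Fin (n + 1) → ℝ≥0)) t) s
          + (1 / 2 : ℝ) • timeInt (V f) s) ∧
      (∀ f, Continuous f → Continuous (V f)) ∧
      ∀ T : ℝ≥0, ∃ C : ℝ, 0 ≤ C ∧ ∀ f, Continuous f → ∀ M : ℝ,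
        (∀ x, (∀ i, x i ≤ T) → |f x| ≤ M) → ∀ s ≤ T, ‖V f s‖ ≤ C * M := by
  cases n with
  | zero =>
    refine ⟨fun _ _ => 0, fun f s => ?_, fun _ _ => continuous_const,
      fun T => ⟨0, le_rfl, by simp⟩⟩
    rw [strat, show timeInt (fun _ : ℝ≥0 => (0 : Lp ℝ 4 P)) s = 0 by simp [timeInt], smul_zero,
      add_zero]
  | succ n =>
    have hop := (isVolterraOp_strat (P := P) hB hm n).1
    have hc : ∀ f : (Fin (n + 2) → ℝ≥0) → ℝ, Continuous f →
        Continuous (Function.uncurry fun (t : ℝ≥0) (x : Fin n → ℝ≥0) =>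
          f (Fin.cons t (Fin.cons t x : Fin (n + 1) → ℝ≥0) : Fin (n + 2) → ℝ≥0)) := fun f hf =>
      hf.comp (Continuous.finCons (A := fun _ => ℝ≥0) continuous_fst
        (Continuous.finCons (A := fun _ => ℝ≥0) continuous_fst continuous_snd))
    refine ⟨fun f t => strat P B n
      (fun x => f (Fin.cons t (Fin.cons t x : Fin (n + 1) → ℝ≥0) : Fin (n + 2) → ℝ≥0)) t,
      fun f s => by rw [strat], fun f hf => hop.continuous_diag (hc f hf), fun T => ?_⟩
    obtain ⟨C, hC, h⟩ := hop.bound T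
    refine ⟨C, hC, fun f hf M hM s hs => (h _ ((hc f hf).comp (Continuous.prodMk_right s)) M
      fun x hx => hM _ fun i => ?_).1 s hs⟩
    refine Fin.cases (by simpa using hs) (fun j => ?_) i
    refine Fin.cases (by simpa using hs) (fun k => by simpa using hx k) j

/-- The integrand is deterministic, so its whole increment is the part `A` known at time `a`, and
there is no correction term. -/
lemma isStratonovichIntegral_strat_one (hB : IsPreBrownianReal B P) (hm : ∀ t, Measurable (B t))
    {f : (Fin 1 → ℝ≥0) → ℝ} (hf : Continuous f) (s : ℝ≥0) :
    IsStratonovichIntegral B P s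
      (fun t ω => strat P B 0 (fun x => f (Fin.cons t x : Fin 1 → ℝ≥0)) t ω)
      (strat P B 1 f s) := by
  have hop := (isVolterraOp_strat (P := P) hB hm 0).1
  set Y : ℝ≥0 → Lp ℝ 4 P :=
    fun t => strat P B 0 (fun x => f (Fin.cons t x : Fin 1 → ℝ≥0)) t with hYdef
  have hYc : Continuous Y := hop.continuous_diag (continuous_cons hf)
  have hYm : ∀ t r, Y t ∈ pastL4 B P r := fun t r => by
    have h := hop.mem _ ((continuous_cons hf).comp (Continuous.prodMk_right t)) r
    simp only [strat] at h
    simp only [hYdef, strat]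
    exact h
  have h := isStratonovichIntegral_of_expansion hB hm (fun t => hYm t t) hYc
    (fun t => zero_mem (pastL4 B P t)) continuous_const s fun ε hε => ?_
  · have e : strat P B 1 f s
        = ito B Y s + (1 / 2 : ℝ) • timeInt (fun _ : ℝ≥0 => (0 : Lp ℝ 4 P)) s := by
      rw [strat, show timeInt (fun _ : ℝ≥0 => (0 : Lp ℝ 4 P)) s = 0 by simp [timeInt], smul_zero,
        add_zero]
    rw [e]
    exact h
  · obtain ⟨δ, hδ, hmod⟩ := exists_modulus hYc s hε
    refine ⟨δ, hδ, fun a b hab hb hd => ⟨Y b - Y a, 0, sub_mem (hYm b a) (hYm a a),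
      hmod b hb a (hab.trans hb) ?_, by rw [norm_zero]; positivity, ?_⟩⟩
    · rwa [abs_of_nonneg (sub_nonneg.2 (NNReal.coe_le_coe.2 hab))]
    · have h0 : mulIncr B a b (0 : Lp ℝ 4 P) = 0 := by
        have := mulIncr_sub hB hm hab (zero_mem (pastL4 B P a)) (zero_mem (pastL4 B P a))
        simpa using this
      rw [h0, add_zero, add_zero]

/-- The time enters twice: as the first variable of $f$ and as the upper limit of the inner
integral. Separating the two, $$G_1(b,b)-G_1(a,a)=[G_1(b,a)-G_1(a,a)]+[G_1(b,b)-G_1(b,a)].$$ The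
first bracket is known at time $a$ and small. The second is $\int_a^b G_2(b,r)\,dB_r$ plus half a
time integral: the former is $G_2(a,a)(B_b-B_a)$ up to $o(\sqrt{b-a})$, the latter is $O(b-a)$. -/
lemma isStratonovichIntegral_strat_add_two (hB : IsPreBrownianReal B P)
    (hm : ∀ t, Measurable (B t)) (n : ℕ)
    {f : (Fin (n + 2) → ℝ≥0) → ℝ} (hf : Continuous f) (s : ℝ≥0) :
    IsStratonovichIntegral B P s
      (fun t ω => strat P B (n + 1) (fun x => f (Fin.cons t x : Fin (n + 2) → ℝ≥0)) t ω)
      (strat P B (n + 2) f s) := by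
  obtain ⟨hop, hop'⟩ := isVolterraOp_strat (P := P) hB hm n
  have hc1 : Continuous (Function.uncurry fun (t : ℝ≥0) (x : Fin (n + 1) → ℝ≥0) =>
      f (Fin.cons t x : Fin (n + 2) → ℝ≥0)) := continuous_cons hf
  have hc2 : Continuous (Function.uncurry fun (p : ℝ≥0 × ℝ≥0) (x : Fin n → ℝ≥0) =>
      f (Fin.cons p.1 (Fin.cons p.2 x : Fin (n + 1) → ℝ≥0) : Fin (n + 2) → ℝ≥0)) :=
    hf.comp (Continuous.finCons (A := fun _ => ℝ≥0) (continuous_fst.comp continuous_fst)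
      (Continuous.finCons (A := fun _ => ℝ≥0) (continuous_snd.comp continuous_fst)
        continuous_snd))
  have hc1' : ∀ t : ℝ≥0, Continuous fun x : Fin (n + 1) → ℝ≥0 =>
      f (Fin.cons t x : Fin (n + 2) → ℝ≥0) := fun t => hc1.comp (Continuous.prodMk_right t)
  have hc2' : ∀ p : ℝ≥0 × ℝ≥0, Continuous fun x : Fin n → ℝ≥0 =>
      f (Fin.cons p.1 (Fin.cons p.2 x : Fin (n + 1) → ℝ≥0) : Fin (n + 2) → ℝ≥0) :=
    fun p => hc2.comp (Continuous.prodMk_right p)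
  -- `G₁ (u, r)` and `G₂ (u, r)` freeze the first variable at `u`
  set G₁ : ℝ≥0 × ℝ≥0 → Lp ℝ 4 P :=
    fun p => strat P B (n + 1) (fun x => f (Fin.cons p.1 x : Fin (n + 2) → ℝ≥0)) p.2 with hG₁
  set G₂ : ℝ≥0 × ℝ≥0 → Lp ℝ 4 P := fun p => strat P B n (fun x =>
    f (Fin.cons p.1 (Fin.cons p.2 x : Fin (n + 1) → ℝ≥0) : Fin (n + 2) → ℝ≥0)) p.2 with hG₂
  have hG₁c : Continuous G₁ := hop'.continuous hc1
  have hG₂c : Continuous G₂ := (hop.continuous hc2).comp (continuous_id.prodMk continuous_snd)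
  have hG₁m : ∀ u r, G₁ (u, r) ∈ pastL4 B P r := fun u r => hop'.mem _ (hc1' u) r
  have hG₂m : ∀ u r, G₂ (u, r) ∈ pastL4 B P r := fun u r => hop.mem _ (hc2' (u, r)) r
  have h := isStratonovichIntegral_of_expansion hB hm (Y := fun t => G₁ (t, t))
    (Z := fun t => G₂ (t, t)) (fun t => hG₁m t t)
    (hG₁c.comp (continuous_id.prodMk continuous_id)) (fun t => hG₂m t t)
    (hG₂c.comp (continuous_id.prodMk continuous_id)) s fun ε hε => ?_
  · have e : strat P B (n + 2) f s = ito B (fun t => G₁ (t, t)) s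
        + (1 / 2 : ℝ) • timeInt (fun t => G₂ (t, t)) s := by rw [strat]
    rw [e]
    exact h
  obtain ⟨V, hV, hVc, hVb⟩ := strat_succ (P := P) hB hm n
  obtain ⟨C, hC, hVb⟩ := hVb s
  obtain ⟨M, hM⟩ := (isCompact_cube (n + 2) s).exists_bound_of_continuousOn hf.continuousOn
  have hM0 : 0 ≤ M := (norm_nonneg _).trans (hM 0 fun i => zero_le)
  have hcons : ∀ b ≤ s, ∀ x : Fin (n + 1) → ℝ≥0, (∀ i, x i ≤ s) →
      |f (Fin.cons b x : Fin (n + 2) → ℝ≥0)| ≤ M := fun b hb x hx => hM _ fun i => by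
    refine Fin.cases (by simpa using hb) (fun j => by simpa using hx j) i
  set K : ℝ := C * M with hK
  have hK0 : 0 ≤ K := mul_nonneg hC hM0
  obtain ⟨δ₁, hδ₁, hmod₁⟩ := exists_modulus_prod hG₁c s hε
  obtain ⟨δ₂, hδ₂, hmod₂⟩ := exists_modulus_prod hG₂c s (show 0 < ε / 4 by positivity)
  -- Makes $K\sqrt{b-a}\le\varepsilon$, which turns the Lipschitz bound $K(b-a)$ into
  -- $\varepsilon\sqrt{b-a}$.
  set δ₃ : ℝ := (ε / (K + 1)) ^ 2 with hδ₃
  have hδ₃0 : 0 < δ₃ := by positivity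
  refine ⟨min (min δ₁ δ₂) δ₃, by positivity, fun a b hab hb hd => ?_⟩
  have ha : a ≤ s := hab.trans hb
  have hba : (0 : ℝ) ≤ (b : ℝ) - a := sub_nonneg.2 (NNReal.coe_le_coe.2 hab)
  have hd1 : (b : ℝ) - a ≤ δ₁ := hd.trans ((min_le_left _ _).trans (min_le_left _ _))
  have hd2 : (b : ℝ) - a ≤ δ₂ := hd.trans ((min_le_left _ _).trans (min_le_right _ _))
  have hd3 : (b : ℝ) - a ≤ δ₃ := hd.trans (min_le_right _ _)
  set W : ℝ≥0 → Lp ℝ 4 P := fun r => G₂ (b, r) with hW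
  have hWc : Continuous W := hG₂c.comp (continuous_const.prodMk continuous_id)
  set U : ℝ≥0 → Lp ℝ 4 P := V (fun x => f (Fin.cons b x : Fin (n + 2) → ℝ≥0)) with hU
  set D : Lp ℝ 4 P := ito B W b - ito B W a - mulIncr B a b (G₂ (a, a)) with hD
  set D' : Lp ℝ 4 P := (1 / 2 : ℝ) • (timeInt U b - timeInt U a) with hD'
  have hDn : ‖D‖ ≤ ε / 2 * √((b : ℝ) - a) := by
    have key := (isMartIncr_ito hB hm (fun r => hG₂m b r) hWc hab (hG₂m a a) (c := ε / 4)
      fun r h1 h2 => by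
        have h1' : (a : ℝ) ≤ r := h1
        have h2' : (r : ℝ) ≤ b := h2
        refine hmod₂ b hb r (h2.trans hb) a ha a ha ?_ ?_
        · rwa [abs_of_nonneg hba]
        · rw [abs_of_nonneg (by linarith)]
          linarith).norm_sq_le
    refine le_of_sq_le_sq (key.trans ?_) (by positivity)
    rw [mul_pow, Real.sq_sqrt hba]
    nlinarith [mul_nonneg (sq_nonneg ε) hba]
  have hDn' : ‖D'‖ ≤ ε / 2 * √((b : ℝ) - a) := by
    have key := norm_timeInt_sub_le (hVc _ (hc1' b)) hab (c := K) fun r _ h2 =>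
      hVb _ (hc1' b) M (hcons b hb) r (h2.trans hb)
    have h3 : √((b : ℝ) - a) ≤ ε / (K + 1) := by
      rw [Real.sqrt_le_left (by positivity)]
      exact hd3
    have h4 : K * √((b : ℝ) - a) ≤ ε := by
      rw [le_div_iff₀ (by positivity)] at h3
      nlinarith [Real.sqrt_nonneg ((b : ℝ) - a)]
    have h5 := mul_le_mul_of_nonneg_right h4 (Real.sqrt_nonneg ((b : ℝ) - a))
    rw [mul_assoc, Real.mul_self_sqrt hba] at h5
    rw [hD', norm_smul, show ‖(1 / 2 : ℝ)‖ = 1 / 2 by norm_num]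
    linarith
  refine ⟨G₁ (b, a) - G₁ (a, a), D + D', sub_mem (hG₁m b a) (hG₁m a a),
    hmod₁ b hb a ha a ha a ha (by rwa [abs_of_nonneg hba]) (by rw [sub_self, abs_zero]; exact hδ₁.le),
    (norm_add_le _ _).trans (by linarith), ?_⟩
  have e : ∀ t, G₁ (b, t) = ito B W t + (1 / 2 : ℝ) • timeInt U t := fun t => hV _ t
  rw [hD, hD', smul_sub]
  simp only [e b, e a]
  abel

/-- The iterated Stratonovich integral of a continuous function exists. -/
theorem isIteratedStratonovich_strat (hB : IsPreBrownianReal B P) (hm : ∀ t, Measurable (B t))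
    (n : ℕ) {f : (Fin n → ℝ≥0) → ℝ} (hf : Continuous f) (s : ℝ≥0) :
    IsIteratedStratonovich B P n f s (strat P B n f s) := by
  induction n generalizing s with
  | zero =>
    simp only [IsIteratedStratonovich, strat]
    exact Lp.coeFn_const 4 P (f Fin.elim0)
  | succ n ih =>
    refine ⟨fun t ω => strat P B n (fun x => f (Fin.cons t x : Fin (n + 1) → ℝ≥0)) t ω,
      fun t _ => ih ((continuous_cons hf).comp (Continuous.prodMk_right t)) t, ?_⟩
    cases n with
    | zero => exact isStratonovichIntegral_strat_one hB hm hf s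
    | succ n => exact isStratonovichIntegral_strat_add_two hB hm n hf s

lemma expect_strat_zero (f : (Fin 0 → ℝ≥0) → ℝ) (s : ℝ≥0) :
    expect P (strat P B 0 f s) = f Fin.elim0 := by
  rw [strat, expect_apply, integral_congr_ae (Lp.coeFn_const 4 P (f Fin.elim0))]
  simp

lemma expect_strat_add_two (hB : IsPreBrownianReal B P) (hm : ∀ t, Measurable (B t))
    (n : ℕ) {f : (Fin (n + 2) → ℝ≥0) → ℝ} (hf : Continuous f) (s : ℝ≥0) :
    expect P (strat P B (n + 2) f s) = 1 / 2 * timeInt (fun t => expect P (strat P B n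
      (fun x => f (Fin.cons t (Fin.cons t x : Fin (n + 1) → ℝ≥0) : Fin (n + 2) → ℝ≥0)) t)) s := by
  obtain ⟨hop, hop'⟩ := isVolterraOp_strat (P := P) hB hm n
  have hc : Continuous (Function.uncurry fun (t : ℝ≥0) (x : Fin n → ℝ≥0) =>
      f (Fin.cons t (Fin.cons t x : Fin (n + 1) → ℝ≥0) : Fin (n + 2) → ℝ≥0)) :=
    hf.comp (Continuous.finCons (A := fun _ => ℝ≥0) continuous_fst
      (Continuous.finCons (A := fun _ => ℝ≥0) continuous_fst continuous_snd))
  have hc' : ∀ t : ℝ≥0, Continuous fun x : Fin (n + 1) → ℝ≥0 =>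
      f (Fin.cons t x : Fin (n + 2) → ℝ≥0) := fun t =>
    (continuous_cons hf).comp (Continuous.prodMk_right t)
  rw [strat, map_add, expect_ito hB hm (fun t => hop'.mem _ (hc' t) t)
    (hop'.continuous_diag (continuous_cons hf)), map_smul, expect_timeInt (hop.continuous_diag hc),
    zero_add, smul_eq_mul]

/-- The expectation of a fourfold iterated Stratonovich integral. -/
lemma expect_strat_four (hB : IsPreBrownianReal B P) (hm : ∀ t, Measurable (B t))
    {f : (Fin 4 → ℝ≥0) → ℝ} (hf : Continuous f) (s : ℝ≥0) :
    expect P (strat P B 4 f s)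
      = 1 / 4 * timeInt (fun t => timeInt (fun r => f ![t, t, r, r]) t) s := by
  have hc : ∀ t : ℝ≥0, Continuous fun x : Fin 2 → ℝ≥0 =>
      f (Fin.cons t (Fin.cons t x : Fin 3 → ℝ≥0) : Fin 4 → ℝ≥0) := fun t =>
    hf.comp (Continuous.finCons (A := fun _ => ℝ≥0) continuous_const
      (Continuous.finCons (A := fun _ => ℝ≥0) continuous_const continuous_id))
  rw [expect_strat_add_two hB hm 2 hf]
  have e : ∀ t, expect P (strat P B 2
      (fun x => f (Fin.cons t (Fin.cons t x : Fin 3 → ℝ≥0) : Fin 4 → ℝ≥0)) t)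
      = 1 / 2 * timeInt (fun r => f ![t, t, r, r]) t := fun t => by
    rw [expect_strat_add_two hB hm 0 (hc t)]
    simp only [expect_strat_zero]
    have e' : ∀ r, (Fin.cons t (Fin.cons t (Fin.cons r (Fin.cons r Fin.elim0 : Fin 1 → ℝ≥0)
        : Fin 2 → ℝ≥0) : Fin 3 → ℝ≥0) : Fin 4 → ℝ≥0) = ![t, t, r, r] := fun r => by
      ext i
      fin_cases i <;> rfl
    simp only [e']
  simp only [e]
  rw [timeInt, timeInt, intervalIntegral.integral_const_mul]
  ring

end Existence

/-! ### Uniqueness of the iterated Stratonovich integrals -/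

section Uniqueness

variable {Ω : Type*} [MeasurableSpace Ω] {P : Measure Ω} {B B' : ℝ≥0 → Ω → ℝ}

lemma trapezoidSum_congr (hB : ∀ t, B t =ᵐ[P] B' t) {Y Y' : ℝ≥0 → Ω → ℝ} {k : ℕ} {τ : ℕ → ℝ≥0}
    (hY : ∀ i ≤ k, Y (τ i) =ᵐ[P] Y' (τ i)) :
    trapezoidSum B Y k τ =ᵐ[P] trapezoidSum B' Y' k τ := by
  have h : ∀ᵐ ω ∂P, ∀ i ∈ Finset.range (k + 1), Y (τ i) ω = Y' (τ i) ω ∧ B (τ i) ω = B' (τ i) ω := by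
    rw [Finset.eventually_all]
    intro i hi
    exact (hY i (Nat.lt_succ_iff.1 (Finset.mem_range.1 hi))).and (hB (τ i))
  filter_upwards [h] with ω hω
  unfold trapezoidSum
  refine Finset.sum_congr rfl fun i hi => ?_
  have hi' := Finset.mem_range.1 hi
  have h1 := hω i (Finset.mem_range.2 (by omega))
  have h2 := hω (i + 1) (Finset.mem_range.2 (by omega))
  rw [h1.1, h1.2, h2.1, h2.2]

/-- Without partitions of arbitrarily small mesh the convergence in `IsStratonovichIntegral` would
be vacuous and uniqueness would fail. -/
lemma exists_partition (s : ℝ≥0) {δ : ℝ} (hδ : 0 < δ) :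
    ∃ (k : ℕ) (τ : ℕ → ℝ≥0), Monotone τ ∧ τ 0 = 0 ∧ τ k = s ∧
      ∀ i < k, (τ (i + 1) : ℝ) - τ i ≤ δ := by
  obtain ⟨n, hn⟩ := exists_nat_one_div_lt hδ
  obtain ⟨N, hN⟩ := exists_nat_ge (s * (n + 1))
  refine ⟨N, fun i => min (gridPt n i) s, fun i j h => min_le_min (gridPt_mono n h) le_rfl,
    by simp [gridPt_zero], ?_, fun i _ => ?_⟩
  · refine min_eq_right ?_
    unfold gridPt
    rw [le_div_iff₀ (by positivity)]
    exact hN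
  · have h1 : min (gridPt n (i + 1)) s ≤ min (gridPt n i) s + 1 / (n + 1) := by
      rw [gridPt_succ, min_add]
      exact min_le_min le_rfl le_self_add
    have h2 : ((min (gridPt n (i + 1)) s : ℝ≥0) : ℝ) ≤ (min (gridPt n i) s : ℝ≥0) + 1 / (n + 1) := by
      exact_mod_cast h1
    linarith

lemma IsStratonovichIntegral.congr (hB : ∀ t, B t =ᵐ[P] B' t) {s : ℝ≥0} {Y : ℝ≥0 → Ω → ℝ}
    {I : Ω → ℝ} (h : IsStratonovichIntegral B P s Y I) : IsStratonovichIntegral B' P s Y I := by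
  refine ⟨h.1, fun ε hε => ?_⟩
  obtain ⟨δ, hδ, h2⟩ := h.2 ε hε
  refine ⟨δ, hδ, fun k τ h3 h4 h5 h6 => ?_⟩
  refine le_trans (le_of_eq (eLpNorm_congr_ae ?_)) (h2 k τ h3 h4 h5 h6)
  filter_upwards [trapezoidSum_congr (Y := Y) (Y' := Y) (k := k) (τ := τ) hB
    fun _ _ => EventuallyEq.rfl] with ω hω
  rw [hω]

/-- On a common fine partition the two trapezoidal sums agree almost everywhere, since only finitely
many times enter, and each is close to its limit. -/
lemma IsStratonovichIntegral.unique (hBm : ∀ t, AEStronglyMeasurable (B t) P) {s : ℝ≥0}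
    {Y Y' : ℝ≥0 → Ω → ℝ} {I I' : Ω → ℝ} (hYm : ∀ t ≤ s, AEStronglyMeasurable (Y t) P)
    (hY : ∀ t ≤ s, Y t =ᵐ[P] Y' t) (h : IsStratonovichIntegral B P s Y I)
    (h' : IsStratonovichIntegral B P s Y' I') : I =ᵐ[P] I' := by
  have hz : eLpNorm (I - I') 2 P = 0 := by
    refine le_antisymm (ENNReal.le_of_forall_pos_le_add fun ε hε _ => ?_) zero_le
    have hε2 : (0 : ℝ) < ε / 2 := by positivity
    obtain ⟨δ, hδ, h2⟩ := h.2 (ε / 2) hε2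
    obtain ⟨δ', hδ', h2'⟩ := h'.2 (ε / 2) hε2
    obtain ⟨k, τ, h3, h4, h5, h6⟩ := exists_partition s (lt_min hδ hδ')
    have h7 := h2 k τ h3 h4 h5 fun i hi => (h6 i hi).trans (min_le_left _ _)
    have h8 := h2' k τ h3 h4 h5 fun i hi => (h6 i hi).trans (min_le_right _ _)
    have hle : ∀ i ≤ k, τ i ≤ s := fun i hi => h5 ▸ h3 hi
    have hS : AEStronglyMeasurable (trapezoidSum B Y k τ) P := by
      refine Finset.aestronglyMeasurable_fun_sum _ fun i hi => ?_
      have hi' := Finset.mem_range.1 hi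
      refine AEStronglyMeasurable.mul ?_ ((hBm _).sub (hBm _))
      simp only [div_eq_mul_inv]
      exact ((hYm _ (hle i hi'.le)).add (hYm _ (hle (i + 1) hi'))).mul_const _
    have hcongr := trapezoidSum_congr (P := P) (B := B) (B' := B) (k := k) (τ := τ)
      (fun _ => EventuallyEq.rfl) fun i hi => hY _ (hle i hi)
    have e : I - I' =ᵐ[P] fun ω => (trapezoidSum B Y' k τ ω - I' ω)
        - (trapezoidSum B Y k τ ω - I ω) := by
      filter_upwards [hcongr] with ω hω
      rw [hω, Pi.sub_apply]
      ring
    rw [eLpNorm_congr_ae e, zero_add]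
    refine (eLpNorm_sub_le ((hS.congr hcongr).sub h'.1.1) (hS.sub h.1.1) (by norm_num)).trans ?_
    refine (add_le_add h8 h7).trans (le_of_eq ?_)
    rw [← ENNReal.ofReal_add hε2.le hε2.le, add_halves, ENNReal.ofReal_coe_nnreal]
  have h3 := (eLpNorm_eq_zero_iff (h.1.1.sub h'.1.1) (by norm_num)).1 hz
  filter_upwards [h3] with ω hω
  exact sub_eq_zero.1 hω

lemma IsIteratedStratonovich.aestronglyMeasurable {n : ℕ} {f : (Fin n → ℝ≥0) → ℝ} {s : ℝ≥0}
    {I : Ω → ℝ} (h : IsIteratedStratonovich B P n f s I) : AEStronglyMeasurable I P := by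
  cases n with
  | zero => exact aestronglyMeasurable_const.congr (EventuallyEq.symm h)
  | succ n =>
    obtain ⟨Y, -, h⟩ := h
    exact h.1.1

lemma IsIteratedStratonovich.unique (hBm : ∀ t, AEStronglyMeasurable (B t) P) {n : ℕ}
    {f : (Fin n → ℝ≥0) → ℝ} {s : ℝ≥0} {I I' : Ω → ℝ} (h : IsIteratedStratonovich B P n f s I)
    (h' : IsIteratedStratonovich B P n f s I') : I =ᵐ[P] I' := by
  induction n generalizing s I I' with
  | zero => exact EventuallyEq.trans h (EventuallyEq.symm h')
  | succ n ih =>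
    obtain ⟨Y, hY, h⟩ := h
    obtain ⟨Y', hY', hI⟩ := h'
    exact IsStratonovichIntegral.unique hBm (fun t ht => (hY t ht).aestronglyMeasurable)
      (fun t ht => ih (hY t ht) (hY' t ht)) h hI

/-- The iterated integral only depends on the values of the integrand on the simplex, and on the
Brownian motion up to a modification. -/
lemma IsIteratedStratonovich.congr (hB : ∀ t, B t =ᵐ[P] B' t) {n : ℕ}
    {f g : (Fin n → ℝ≥0) → ℝ} {s : ℝ≥0} {I : Ω → ℝ}
    (hfg : ∀ x : Fin n → ℝ≥0, Antitone x → (∀ i, x i ≤ s) → f x = g x)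
    (h : IsIteratedStratonovich B P n f s I) : IsIteratedStratonovich B' P n g s I := by
  induction n generalizing s I with
  | zero =>
    have h' : I =ᵐ[P] fun _ => f Fin.elim0 := h
    rw [hfg Fin.elim0 (fun i => i.elim0) (fun i => i.elim0)] at h'
    exact h'
  | succ n ih =>
    obtain ⟨Y, hY, h⟩ := h
    refine ⟨Y, fun t ht => ih (fun x hx hxt => hfg _ ?_ ?_) (hY t ht), h.congr hB⟩
    · intro i j
      refine Fin.cases ?_ (fun i => ?_) i <;> refine Fin.cases ?_ (fun j => ?_) j
      · exact fun _ => le_rfl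
      · exact fun _ => by simpa using hxt j
      · intro hij
        exact absurd hij (by simp)
      · intro hij
        simpa using hx (Fin.succ_le_succ_iff.1 hij)
    · intro i
      refine Fin.cases (by simpa using ht) (fun j => ?_) i
      simpa using (hxt j).trans ht

end Uniqueness

end StochasticIntegrals

/-! ### Index maps of length two and four -/

section IndexMaps

lemma IndexMap.count_four (κ : IndexMap 4) (a : ℕ) : κ.count a =
    (if (κ 0 : ℕ) = a then 1 else 0) + (if (κ 1 : ℕ) = a then 1 else 0)
      + (if (κ 2 : ℕ) = a then 1 else 0) + (if (κ 3 : ℕ) = a then 1 else 0) := by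
  rw [IndexMap.count, Finset.card_filter, Fin.sum_univ_four]

lemma IndexMap.count_two (κ : IndexMap 2) (a : ℕ) : κ.count a =
    (if (κ 0 : ℕ) = a then 1 else 0) + (if (κ 1 : ℕ) = a then 1 else 0) := by
  rw [IndexMap.count, Finset.card_filter, Fin.sum_univ_two]

/-- The position in the list of the functions of order four of the function given by an index
map with entries `0, a, b, c`. -/
def shape (a b c : ℕ) : Fin 7 :=
  if a = 0 then
    if b = 0 then (if c = 0 then 0 else 1)
    else if c = 0 then 1 else if b = c then 2 else 3
  else if b = 0 then (if c = 0 then 1 else if c = 1 then 2 else 3)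
  else if c = 0 then (if b = 1 then 2 else 3)
  else if b = 1 then (if c = 1 then 4 else 5)
  else if c = 3 then 6 else 5

/-- The kind of kernel product on the double diagonal: `0` if it vanishes there. -/
def kernelKind (a b c : ℕ) : Fin 4 :=
  if a = 1 ∨ c = 3 then 0
  else if b = 0 then (if c = 0 then 1 else 2)
  else if c = 0 then 2 else 3

lemma IndexMap.cases_four (κ : IndexMap 4) : (κ 0 : ℕ) = 0 ∧
    ((κ 1 : ℕ) = 0 ∨ (κ 1 : ℕ) = 1) ∧ ((κ 2 : ℕ) = 0 ∨ (κ 2 : ℕ) = 1 ∨ (κ 2 : ℕ) = 2) ∧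
    ((κ 3 : ℕ) = 0 ∨ (κ 3 : ℕ) = 1 ∨ (κ 3 : ℕ) = 2 ∨ (κ 3 : ℕ) = 3) := by
  have h0 : (κ 0 : ℕ) < 1 := (κ 0).2
  have h1 : (κ 1 : ℕ) < 2 := (κ 1).2
  have h2 : (κ 2 : ℕ) < 3 := (κ 2).2
  have h3 : (κ 3 : ℕ) < 4 := (κ 3).2
  omega

lemma coeffFun_four (G V : ℝ → ℝ) (κ : IndexMap 4) :
    coeffFun G V κ = orderFourFun G V (shape (κ 1) (κ 2) (κ 3)) := by
  obtain ⟨h0, h1, h2, h3⟩ := κ.cases_four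
  funext x
  simp only [coeffFun, Fin.prod_univ_four, IndexMap.count_four, h0]
  rcases h1 with h1 | h1 <;> rcases h2 with h2 | h2 | h2 <;> rcases h3 with h3 | h3 | h3 | h3 <;>
    simp [h1, h2, h3, shape, orderFourFun, iteratedDeriv_one, iteratedDeriv_zero] <;> ring

lemma coeffFun_two (G V : ℝ → ℝ) (κ : IndexMap 2) :
    ∃ β : Fin 2, coeffFun G V κ = orderTwoFun G V β := by
  have h1 : (κ 1 : ℕ) = 0 ∨ (κ 1 : ℕ) = 1 := by
    have h1 : (κ 1 : ℕ) < 2 := (κ 1).2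
    omega
  rcases h1 with h1 | h1
  · refine ⟨0, funext fun x => ?_⟩
    simp [coeffFun, IndexMap.count_two, h1, orderTwoFun, iteratedDeriv_zero]
    ring
  · refine ⟨1, funext fun x => ?_⟩
    simp [coeffFun, Fin.prod_univ_two, IndexMap.count_two, h1, orderTwoFun, iteratedDeriv_zero,
      iteratedDeriv_one]
    ring

lemma exists_shape_eq (α : Fin 7) : ∃ κ : IndexMap 4, shape (κ 1) (κ 2) (κ 3) = α := by
  revert α
  decide

/-- The number of index maps of each shape and kind. -/
lemma card_shape_kind (α : Fin 7) (j : Fin 4) (hj : j ≠ 0) :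
    (Finset.univ.filter fun κ : IndexMap 4 =>
      shape (κ 1) (κ 2) (κ 3) = α ∧ kernelKind (κ 1) (κ 2) (κ 3) = j).card
      = (![![0, 1, 0, 0], ![0, 0, 4, 0], ![0, 0, 0, 2], ![0, 0, 0, 2], ![0, 0, 0, 0], ![0, 0, 0, 0],
          ![0, 0, 0, 0]] : Fin 7 → Fin 4 → ℕ) α j := by
  revert α j
  decide

end IndexMaps

/-! ### Double integrals of powers over a triangle -/

section Triangle

/-- Fubini on the square for `g` cut off by the indicator of the triangle. -/
lemma integral_triangle_swap {g : ℝ × ℝ → ℝ} (hg : Continuous g) {T : ℝ} (hT : 0 ≤ T) :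
    ∫ t in (0 : ℝ)..T, ∫ r in (0 : ℝ)..t, g (t, r)
      = ∫ r in (0 : ℝ)..T, ∫ t in r..T, g (t, r) := by
  set S : Set (ℝ × ℝ) := {p | p.2 ≤ p.1} with hS
  have hSm : MeasurableSet S := measurableSet_le measurable_snd measurable_fst
  have hint : Integrable (Function.uncurry fun t r => S.indicator g (t, r))
      ((volume.restrict (Set.Ioc 0 T)).prod (volume.restrict (Set.Ioc 0 T))) := by
    rw [Measure.prod_restrict]
    have h1 : IntegrableOn g (Set.Icc 0 T ×ˢ Set.Icc 0 T) ((volume : Measure ℝ).prod volume) :=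
      hg.continuousOn.integrableOn_compact (isCompact_Icc.prod isCompact_Icc)
    exact (h1.mono_set (Set.prod_mono Set.Ioc_subset_Icc_self
      Set.Ioc_subset_Icc_self)).integrable.indicator hSm
  have hswap := integral_integral_swap hint
  rw [intervalIntegral.integral_of_le hT, intervalIntegral.integral_of_le hT]
  refine Eq.trans (setIntegral_congr_fun measurableSet_Ioc fun t ht => ?_)
    (hswap.trans (setIntegral_congr_fun measurableSet_Ioc fun r hr => ?_))
  · rw [intervalIntegral.integral_of_le ht.1.le]
    have e : ∀ r, S.indicator g (t, r) = (Set.Iic t).indicator (fun r => g (t, r)) r := fun r => by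
      simp only [Set.indicator, hS, Set.mem_ofPred_eq, Set.mem_Iic]
    simp only [e]
    rw [setIntegral_indicator measurableSet_Iic]
    congr 2
    ext r
    simp only [Set.mem_Ioc, Set.mem_inter_iff, Set.mem_Iic]
    exact ⟨fun h => ⟨⟨h.1, h.2.trans ht.2⟩, h.2⟩, fun h => ⟨h.1.1, h.2⟩⟩
  · rw [intervalIntegral.integral_of_le hr.2, ← integral_Icc_eq_integral_Ioc (x := r)]
    have e : ∀ t, S.indicator g (t, r) = (Set.Ici r).indicator (fun t => g (t, r)) t := fun t => by
      simp only [Set.indicator, hS, Set.mem_ofPred_eq, Set.mem_Ici]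
    simp only [e]
    rw [setIntegral_indicator measurableSet_Ici]
    congr 2
    ext t
    simp only [Set.mem_Ioc, Set.mem_Icc, Set.mem_inter_iff, Set.mem_Ici]
    exact ⟨fun h => ⟨h.2, h.1.2⟩, fun h => ⟨⟨hr.1.trans_le h.1, h.2⟩, h.1⟩⟩

lemma integral_sub_rpow_mul_sub_rpow {p m r T : ℝ} (hrT : r < T) :
    ∫ t in r..T, (T - t) ^ p * (t - r) ^ m
      = (T - r) ^ (p + m + 1) * ∫ w in (0 : ℝ)..1, (1 - w) ^ p * w ^ m := by
  have hd : 0 < T - r := sub_pos.2 hrT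
  have h1 := intervalIntegral.smul_integral_comp_mul_add (a := 0) (b := 1)
    (fun t => (T - t) ^ p * (t - r) ^ m) (T - r) r
  simp only [mul_zero, zero_add, mul_one, sub_add_cancel, smul_eq_mul, add_sub_cancel_right] at h1
  rw [← h1, ← intervalIntegral.integral_const_mul, ← intervalIntegral.integral_const_mul]
  refine intervalIntegral.integral_congr fun w hw => ?_
  rw [Set.uIcc_of_le zero_le_one] at hw
  rw [show T - ((T - r) * w + r) = (T - r) * (1 - w) by ring,
    Real.mul_rpow hd.le (by linarith [hw.2]), Real.mul_rpow hd.le hw.1, Real.rpow_add hd,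
    Real.rpow_add hd, Real.rpow_one]
  ring

/-- With the order of integration exchanged, the inner integral in $t$ scales to a Beta integral
times a power of $T-r$, leaving a single power to integrate. Nonnegative exponents keep the
integrand continuous. -/
lemma integral_triangle_rpow {p q m T : ℝ} (hp : 0 ≤ p) (hq : 0 ≤ q) (hm : 0 ≤ m) (hT : 0 ≤ T) :
    ∫ t in (0 : ℝ)..T, ∫ r in (0 : ℝ)..t, (T - t) ^ p * (T - r) ^ q * (t - r) ^ m
      = T ^ (p + q + m + 2) / (p + q + m + 2) * ∫ w in (0 : ℝ)..1, (1 - w) ^ p * w ^ m := by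
  have hg : Continuous fun x : ℝ × ℝ => (T - x.1) ^ p * (T - x.2) ^ q * (x.1 - x.2) ^ m :=
    (((continuous_const.sub continuous_fst).rpow_const fun _ => .inr hp).mul
      ((continuous_const.sub continuous_snd).rpow_const fun _ => .inr hq)).mul
      ((continuous_fst.sub continuous_snd).rpow_const fun _ => .inr hm)
  rw [integral_triangle_swap hg hT]
  set β := ∫ w in (0 : ℝ)..1, (1 - w) ^ p * w ^ m with hβ
  have h1 : ∫ r in (0 : ℝ)..T, ∫ t in r..T, (T - t) ^ p * (T - r) ^ q * (t - r) ^ m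
      = ∫ r in (0 : ℝ)..T, (T - r) ^ (p + q + m + 1) * β := by
    refine intervalIntegral.integral_congr_Ioo_of_le hT fun r hr => ?_
    have hd : 0 < T - r := sub_pos.2 hr.2
    have e : ∀ t, (T - t) ^ p * (T - r) ^ q * (t - r) ^ m
        = (T - r) ^ q * ((T - t) ^ p * (t - r) ^ m) := fun t => by ring
    simp only [e]
    rw [intervalIntegral.integral_const_mul, integral_sub_rpow_mul_sub_rpow hr.2, ← mul_assoc,
      ← Real.rpow_add hd, show q + (p + m + 1) = p + q + m + 1 by ring]
  simp only at h1 ⊢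
  rw [h1, intervalIntegral.integral_mul_const,
    intervalIntegral.integral_comp_sub_left (fun u => u ^ (p + q + m + 1)) T, sub_self, sub_zero,
    integral_rpow (.inl (by linarith)), Real.zero_rpow (by positivity), sub_zero,
    show p + q + m + 1 + 1 = p + q + m + 2 by ring]

/-- Insert $1=(1-t)+t$; the two resulting integrals are exchanged by $t\mapsto1-t$. This converts
$\mathrm B(2H,2H)$ into the form with $\mathrm B(2H,2H+1)$. -/
lemma betaFun_self {a : ℝ} (ha : 1 ≤ a) : betaFun a a = 2 * betaFun a (a + 1) := by
  have hc : Continuous fun t : ℝ => (1 - t) ^ (a - 1) * t ^ a :=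
    ((continuous_const.sub continuous_id).rpow_const fun _ => .inr (by linarith)).mul
      (continuous_id.rpow_const fun _ => .inr (by linarith))
  have hc' : Continuous fun t : ℝ => t ^ (a - 1) * (1 - t) ^ a :=
    (continuous_id.rpow_const fun _ => .inr (by linarith)).mul
      ((continuous_const.sub continuous_id).rpow_const fun _ => .inr (by linarith))
  have h1 : betaFun a (a + 1) = ∫ t in (0 : ℝ)..1, (1 - t) ^ (a - 1) * t ^ a := by
    rw [betaFun, add_sub_cancel_right]
  have h2 : betaFun a (a + 1) = ∫ t in (0 : ℝ)..1, t ^ (a - 1) * (1 - t) ^ a := by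
    have := intervalIntegral.integral_comp_sub_left (a := 0) (b := 1)
      (fun t : ℝ => t ^ (a - 1) * (1 - t) ^ a) 1
    simp only [sub_sub_cancel, sub_self, sub_zero] at this
    rw [h1, this]
  rw [two_mul]
  nth_rewrite 1 [h1]
  rw [h2, ← intervalIntegral.integral_add (hc.intervalIntegrable _ _) (hc'.intervalIntegrable _ _),
    betaFun]
  refine intervalIntegral.integral_congr_Ioo_of_le zero_le_one fun t ht => ?_
  have e1 : t ^ a = t ^ (a - 1) * t := by
    rw [Real.rpow_sub_one ht.1.ne']; field_simp [ht.1.ne']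
  have hne : (1 : ℝ) - t ≠ 0 := (sub_pos.2 ht.2).ne'
  have e2 : (1 - t) ^ a = (1 - t) ^ (a - 1) * (1 - t) := by
    rw [Real.rpow_sub_one hne]; field_simp
  rw [e1, e2]
  ring

lemma timeInt_timeInt_eq {F : ℝ≥0 → ℝ≥0 → ℝ} {w : ℝ → ℝ → ℝ} (T : ℝ≥0)
    (h : ∀ t r : ℝ≥0, r ≤ t → t ≤ T → F t r = w t r) :
    timeInt (fun t => timeInt (fun r => F t r) t) T
      = ∫ t in (0 : ℝ)..T, ∫ r in (0 : ℝ)..t, w t r := by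
  unfold timeInt
  refine intervalIntegral.integral_congr fun t ht => ?_
  rw [Set.uIcc_of_le T.coe_nonneg] at ht
  simp only [Real.coe_toNNReal t ht.1]
  refine intervalIntegral.integral_congr fun r hr => ?_
  rw [Set.uIcc_of_le ht.1] at hr
  have h1 := h t.toNNReal r.toNNReal (Real.toNNReal_le_toNNReal hr.2)
    (Real.toNNReal_le_iff_le_coe.2 ht.2)
  simpa only [Real.coe_toNNReal t ht.1, Real.coe_toNNReal r hr.1] using h1

end Triangle

/-! ### The kernel products -/

section Kernel

/-- The kernel `(t - r)_+^{H - 1/2}`. -/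
def posKernel (H : ℝ) (t r : ℝ≥0) : ℝ := ((t - r : ℝ≥0) : ℝ) ^ (H - 1 / 2)

lemma continuous_posKernel {H : ℝ} (hH : 1 / 2 < H) {α : Type*} [TopologicalSpace α]
    {f g : α → ℝ≥0} (hf : Continuous f) (hg : Continuous g) :
    Continuous fun x => posKernel H (f x) (g x) :=
  (NNReal.continuous_coe.comp (hf.sub hg)).rpow_const fun _ => .inr (by linarith)

lemma posKernel_eq (H : ℝ) {t r : ℝ≥0} (h : r ≤ t) : posKernel H t r = volterraKernel H t r := by
  rw [posKernel, volterraKernel, NNReal.coe_sub h]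

lemma posKernel_self {H : ℝ} (hH : 1 / 2 < H) (t : ℝ≥0) : posKernel H t t = 0 := by
  rw [posKernel, tsub_self, NNReal.coe_zero, Real.zero_rpow (by linarith)]

/-- The product of the kernels `posKernel` along an index map. -/
def posKernelProd (H : ℝ) (T : ℝ≥0) {n : ℕ} (κ : IndexMap n) (t : Fin n → ℝ≥0) : ℝ :=
  ∏ l : Fin n,
    posKernel H ((Fin.cons T t : Fin (n + 1) → ℝ≥0) (Fin.castLE (by omega) (κ l))) (t l)

lemma continuous_posKernelProd {H : ℝ} (hH : 1 / 2 < H) (T : ℝ≥0) {n : ℕ} (κ : IndexMap n) :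
    Continuous (posKernelProd H T κ) := by
  have hc : Continuous fun t : Fin n → ℝ≥0 => (Fin.cons T t : Fin (n + 1) → ℝ≥0) :=
    Continuous.finCons (A := fun _ => ℝ≥0) continuous_const continuous_id
  exact continuous_finsetProd _ fun l _ =>
    continuous_posKernel hH ((continuous_apply _).comp hc) (continuous_apply l)

/-- Since $\kappa_l<l$, decreasing times give $t_l\le t_{\kappa_l}$, so truncating the difference at
$0$ changes nothing on the simplex, the only place where the iterated integral sees its integrand.
-/
lemma posKernelProd_eq (H : ℝ) {T : ℝ≥0} {n : ℕ} (κ : IndexMap n) {t : Fin n → ℝ≥0}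
    (ht : Antitone t) (hT : ∀ i, t i ≤ T) : posKernelProd H T κ t = kernelProd H T κ t := by
  refine Finset.prod_congr rfl fun l _ => posKernel_eq H ?_
  have key : ∀ j : Fin (n + 1), (j : ℕ) ≤ l → t l ≤ (Fin.cons T t : Fin (n + 1) → ℝ≥0) j := by
    intro j
    refine Fin.cases (fun _ => by simpa using hT l) (fun i hi => ?_) j
    rw [Fin.cons_succ]
    refine ht ?_
    rw [Fin.le_def]
    rw [Fin.val_succ] at hi
    omega
  exact key _ (by
    rw [Fin.val_castLE]
    exact Nat.lt_succ_iff.1 (κ l).2)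

/-- The four possible values of a kernel product on the double diagonal. -/
def diagKernel (H : ℝ) (T t r : ℝ≥0) : Fin 4 → ℝ :=
  ![0, posKernel H T t ^ 2 * posKernel H T r ^ 2,
    posKernel H T t ^ 2 * (posKernel H T r * posKernel H t r),
    posKernel H T t ^ 2 * posKernel H t r ^ 2]

/-- At $(t,t,r,r)$ the factor with $\kappa_2=1$ is $K(t,t)=0$ and the one with $\kappa_4=3$ is
$K(r,r)=0$. Otherwise the first two factors are $K(T,t)^2$, and each of the last two is $K(T,r)$ or
$K(t,r)$; only the number of each matters. -/
lemma posKernelProd_diag {H : ℝ} (hH : 1 / 2 < H) (T : ℝ≥0) (κ : IndexMap 4) (t r : ℝ≥0) :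
    posKernelProd H T κ ![t, t, r, r] = diagKernel H T t r (kernelKind (κ 1) (κ 2) (κ 3)) := by
  have hval : ∀ (l : Fin 4) (j : Fin 5), (κ l : ℕ) = j →
      (Fin.cons T ![t, t, r, r] : Fin 5 → ℝ≥0) (Fin.castLE (by omega) (κ l))
        = (![T, t, t, r, r] : Fin 5 → ℝ≥0) j := by
    intro l j hj
    rw [show Fin.castLE (by omega) (κ l) = j from Fin.ext hj]
    rfl
  obtain ⟨h0, h1, h2, h3⟩ := κ.cases_four
  rw [posKernelProd, Fin.prod_univ_four, hval 0 0 h0]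
  rcases h1 with h1 | h1 <;> rcases h2 with h2 | h2 | h2 <;> rcases h3 with h3 | h3 | h3 | h3 <;>
    first
    | (rw [hval 1 0 h1]) | (rw [hval 1 1 h1])
  all_goals first
    | (rw [hval 2 0 h2]) | (rw [hval 2 1 h2]) | (rw [hval 2 2 h2])
  all_goals first
    | (rw [hval 3 0 h3]) | (rw [hval 3 1 h3]) | (rw [hval 3 2 h3]) | (rw [hval 3 3 h3])
  all_goals
    simp [kernelKind, diagKernel, h1, h2, h3, posKernel_self hH]
  all_goals ring

/-- The integrals of the four kernels over the triangle `0 ≤ r ≤ t ≤ T`. -/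
def diagValue (H : ℝ) (T : ℝ≥0) : Fin 4 → ℝ :=
  ![0, (T : ℝ) ^ (4 * H) / (8 * H ^ 2),
    (T : ℝ) ^ (4 * H) / (4 * H) * betaFun (2 * H) (H + 1 / 2),
    2 * ((T : ℝ) ^ (4 * H) / (4 * H) * betaFun (2 * H) (2 * (H + 1 / 2)))]

lemma timeInt_diagKernel {H : ℝ} (hH : 1 / 2 < H) (T : ℝ≥0) (j : Fin 4) :
    timeInt (fun t => timeInt (fun r => diagKernel H T t r j) t) T = diagValue H T j := by
  have hsq : ∀ t r : ℝ≥0, r ≤ t → posKernel H t r ^ 2 = ((t : ℝ) - r) ^ (2 * H - 1) :=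
    fun t r h => by
      have h0 : (0 : ℝ) ≤ (t : ℝ) - r := sub_nonneg.2 (NNReal.coe_le_coe.2 h)
      rw [posKernel_eq H h, volterraKernel, ← Real.rpow_mul_natCast h0]
      congr 1
      push_cast
      ring
  have hone : ∀ t r : ℝ≥0, r ≤ t → posKernel H t r = ((t : ℝ) - r) ^ (H - 1 / 2) :=
    fun t r h => posKernel_eq H h
  have hH0 : 0 < H := by linarith
  fin_cases j
  · simp [diagKernel, diagValue, timeInt]
  · simp only [diagKernel, diagValue, Fin.mk_one, Matrix.cons_val_one, Matrix.cons_val_zero]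
    rw [timeInt_timeInt_eq (w := fun t r =>
      ((T : ℝ) - t) ^ (2 * H - 1) * ((T : ℝ) - r) ^ (2 * H - 1) * (t - r) ^ (0 : ℝ)) T
      fun t r hrt htT => by
        rw [hsq T t htT, hsq T r (hrt.trans htT), Real.rpow_zero, mul_one],
      integral_triangle_rpow (by linarith) (by linarith) le_rfl T.coe_nonneg]
    simp only [Real.rpow_zero, mul_one]
    rw [intervalIntegral.integral_comp_sub_left (fun u : ℝ => u ^ (2 * H - 1)) 1, sub_self,
      sub_zero, integral_rpow (.inl (by linarith)), sub_add_cancel, Real.one_rpow,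
      Real.zero_rpow (by positivity),
      show 2 * H - 1 + (2 * H - 1) + 0 + 2 = 4 * H by ring]
    field_simp
    ring
  · simp only [diagKernel, diagValue, Fin.reduceFinMk, Matrix.cons_val]
    rw [timeInt_timeInt_eq (w := fun t r =>
      ((T : ℝ) - t) ^ (2 * H - 1) * ((T : ℝ) - r) ^ (H - 1 / 2) * (t - r) ^ (H - 1 / 2)) T
      fun t r hrt htT => by
        rw [hsq T t htT, hone T r (hrt.trans htT), hone t r hrt, mul_assoc],
      integral_triangle_rpow (by linarith) (by linarith) (by linarith) T.coe_nonneg,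
      show 2 * H - 1 + (H - 1 / 2) + (H - 1 / 2) + 2 = 4 * H by ring, betaFun,
      show H + 1 / 2 - 1 = H - 1 / 2 by ring]
  · simp only [diagKernel, diagValue, Fin.reduceFinMk, Matrix.cons_val]
    rw [timeInt_timeInt_eq (w := fun t r =>
      ((T : ℝ) - t) ^ (2 * H - 1) * ((T : ℝ) - r) ^ (0 : ℝ) * (t - r) ^ (2 * H - 1)) T
      fun t r hrt htT => by
        rw [hsq T t htT, hsq t r hrt, Real.rpow_zero, mul_one],
      integral_triangle_rpow (by linarith) le_rfl (by linarith) T.coe_nonneg,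
      show 2 * H - 1 + 0 + (2 * H - 1) + 2 = 4 * H by ring,
      show 2 * (H + 1 / 2) = 2 * H + 1 by ring]
    -- The triangle integral produces $\mathrm B(2H,2H)$; the factor $2$ in `diagValue` comes from
    -- this identity.
    have h := betaFun_self (a := 2 * H) (by linarith)
    rw [betaFun] at h
    rw [h]
    ring

end Kernel

/-! ### The signature components of order four -/

lemma coeffSet_five_diff_three {G V : ℝ → ℝ}
    (h : ∀ (α : Fin 7) (β : Fin 2), orderFourFun G V α ≠ orderTwoFun G V β) :
    coeffSet G V 5 \ coeffSet G V 3 = Set.range (orderFourFun G V) := by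
  have h5 : evenOrders 5 = {2, 4} := by decide
  have h3 : evenOrders 3 = {2} := by decide
  ext φ
  constructor
  · rintro ⟨⟨n, hn, κ, rfl⟩, hφ⟩
    rw [h5, Finset.mem_insert, Finset.mem_singleton] at hn
    obtain rfl | rfl := hn
    · exact absurd ⟨2, by rw [h3]; exact Finset.mem_singleton_self 2, κ, rfl⟩ hφ
    · exact ⟨_, (coeffFun_four G V κ).symm⟩
  · rintro ⟨α, rfl⟩
    obtain ⟨κ, hκ⟩ := exists_shape_eq α
    refine ⟨⟨4, by rw [h5]; decide, κ, by rw [coeffFun_four, hκ]⟩, ?_⟩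
    rintro ⟨n, hn, μ, hμ⟩
    rw [h3, Finset.mem_singleton] at hn
    subst hn
    obtain ⟨β, hβ⟩ := coeffFun_two G V μ
    exact h α β (hμ.symm.trans hβ)

/-- Summing the diagonal values over all index maps of a given shape. -/
lemma sum_shape_diagValue {H : ℝ} (hH : 1 / 2 < H) (T : ℝ≥0) (α : Fin 7) :
    ∑ κ : IndexMap 4, (if shape (κ 1) (κ 2) (κ 3) = α then
      1 / 4 * diagValue H T (kernelKind (κ 1) (κ 2) (κ 3)) else 0) = orderFourValue H T α := by
  rw [← Finset.sum_filter, ← Finset.sum_fiberwise _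
    (fun κ : IndexMap 4 => kernelKind (κ 1) (κ 2) (κ 3))]
  have hfib : ∀ j : Fin 4, ∑ κ ∈ (Finset.univ.filter fun κ : IndexMap 4 =>
      shape (κ 1) (κ 2) (κ 3) = α) with kernelKind (κ 1) (κ 2) (κ 3) = j,
      1 / 4 * diagValue H T (kernelKind (κ 1) (κ 2) (κ 3))
      = (![![0, 1, 0, 0], ![0, 0, 4, 0], ![0, 0, 0, 2], ![0, 0, 0, 2], ![0, 0, 0, 0],
          ![0, 0, 0, 0], ![0, 0, 0, 0]] : Fin 7 → Fin 4 → ℕ) α j * (1 / 4 * diagValue H T j) := by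
    intro j
    rw [Finset.sum_congr rfl fun κ hκ => by rw [(Finset.mem_filter.1 hκ).2],
      Finset.sum_const, nsmul_eq_mul, Finset.filter_filter]
    -- Maps of kind `0` need not be counted, because their diagonal value is zero.
    by_cases hj : j = 0
    · subst hj
      simp [diagValue]
    · rw [card_shape_kind α j hj]
  simp only [hfib, Fin.sum_univ_four]
  have hH0 : H ≠ 0 := by linarith
  fin_cases α <;> simp [diagValue, orderFourValue] <;> field_simp <;> ring

/-! ### Expectation of the signature components. -/

section Expectation

variable {Ω : Type*} [MeasurableSpace Ω] {P : Measure Ω} {B : ℝ≥0 → Ω → ℝ}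

/-- The iterated integrals of the kernel products exist; those of order four have the
expectations given by the diagonal values. -/
lemma exists_isIteratedStratonovich_kernelProd (hB : IsPreBrownianReal B P) {H : ℝ}
    (hH : 1 / 2 < H) (T : ℝ≥0) :
    ∃ J : (n : ℕ) → IndexMap n → Ω → ℝ,
      (∀ n (κ : IndexMap n), IsIteratedStratonovich B P n (kernelProd H T κ) T (J n κ) ∧
        Integrable (J n κ) P) ∧
      ∀ κ : IndexMap 4,
        ∫ ω, J 4 κ ω ∂P = 1 / 4 * diagValue H T (kernelKind (κ 1) (κ 2) (κ 3)) := by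
  have : IsProbabilityMeasure P := hB.isGaussianProcess.isProbabilityMeasure
  -- Each `B t` is only almost everywhere measurable, whereas the filtration argument needs genuine
  -- measurability; a modification is used and the integrals are transferred back.
  have hBm : ∀ t, AEMeasurable (B t) P := fun t => hB.aemeasurable t
  have hBB : ∀ t, B t =ᵐ[P] (hBm t).mk (B t) := fun t => (hBm t).ae_eq_mk
  have hB' := hB.congr hBB
  have hm : ∀ t, Measurable ((hBm t).mk (B t)) := fun t => (hBm t).measurable_mk
  refine ⟨fun n κ => strat P (fun t => (hBm t).mk (B t)) n (posKernelProd H T κ) T,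
    fun n κ => ⟨?_, ?_⟩, fun κ => ?_⟩
  · exact (isIteratedStratonovich_strat hB' hm n (continuous_posKernelProd hH T κ) T).congr
      (fun t => (hBB t).symm) fun x hx hxT => posKernelProd_eq H κ hx hxT
  · exact (Lp.memLp _).integrable fact_one_le_four_ennreal.out
  · rw [← expect_apply, expect_strat_four hB' hm (continuous_posKernelProd hH T κ)]
    simp only [posKernelProd_diag hH, timeInt_diagKernel hH]

-- A component may be built from any versions of the iterated integrals; uniqueness replaces those
-- of order four by the versions with known means. As $\phi_\alpha$ differs from the other eight
-- functions, the maps selected are exactly those of shape `α`, and order two contributes nothing.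
open Classical in
lemma integral_signatureComponent (hB : IsPreBrownianReal B P) {H : ℝ} (hH : 1 / 2 < H)
    (T : ℝ≥0) {G V : ℝ → ℝ} {α : Fin 7}
    (h4 : ∀ β : Fin 7, β ≠ α → orderFourFun G V α ≠ orderFourFun G V β)
    (h2 : ∀ β : Fin 2, orderFourFun G V α ≠ orderTwoFun G V β) {N : ℕ}
    (hN : evenOrders N = {2, 4}) :
    (∃ Γ, IsSignatureComponent B P H T G V N (orderFourFun G V α) Γ) ∧
      ∀ Γ, IsSignatureComponent B P H T G V N (orderFourFun G V α) Γ →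
        Integrable Γ P ∧ ∫ ω, Γ ω ∂P = orderFourValue H T α := by
  obtain ⟨J, hJ, hJ4⟩ := exists_isIteratedStratonovich_kernelProd hB hH T
  refine ⟨⟨_, J, fun n _ κ => (hJ n κ).1, Filter.EventuallyEq.rfl⟩, ?_⟩
  rintro Γ ⟨J', hJ', hΓ⟩
  have : IsProbabilityMeasure P := hB.isGaussianProcess.isProbabilityMeasure
  have hshape : ∀ κ : IndexMap 4, coeffFun G V κ = orderFourFun G V α ↔
      shape (κ 1) (κ 2) (κ 3) = α := fun κ => by
    rw [coeffFun_four]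
    refine ⟨fun h => ?_, fun h => by rw [h]⟩
    by_contra hne
    exact h4 _ hne h.symm
  have htwo : ∀ κ : IndexMap 2, coeffFun G V κ ≠ orderFourFun G V α := fun κ h => by
    obtain ⟨β, hβ⟩ := coeffFun_two G V κ
    exact h2 β (h.symm.trans hβ)
  have hJJ : ∀ κ : IndexMap 4, J' 4 κ =ᵐ[P] J 4 κ := fun κ =>
    (hJ' 4 (by rw [hN]; decide) κ).unique
      (fun t => (hB.aemeasurable t).aestronglyMeasurable) (hJ 4 κ).1
  have hsum : Γ =ᵐ[P] fun ω => ∑ κ : IndexMap 4,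
      if shape (κ 1) (κ 2) (κ 3) = α then J 4 κ ω else 0 := by
    filter_upwards [hΓ, MeasureTheory.ae_all_iff.2 hJJ] with ω hω hκ
    rw [hω, hN, Finset.sum_pair (by decide),
      Finset.sum_eq_zero (s := (Finset.univ : Finset (IndexMap 2)))
        (fun κ _ => if_neg (htwo κ)), zero_add]
    refine Finset.sum_congr rfl fun κ _ => ?_
    simp only [hshape, hκ]
  have hint : ∀ κ : IndexMap 4, Integrable
      (fun ω => if shape (κ 1) (κ 2) (κ 3) = α then J 4 κ ω else 0) P := fun κ => by
    split_ifs
    · exact (hJ 4 κ).2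
    · exact integrable_zero _ _ _
  refine ⟨(integrable_finsetSum _ fun κ _ => hint κ).congr hsum.symm, ?_⟩
  rw [integral_congr_ae hsum, integral_finsetSum _ fun κ _ => hint κ,
    ← sum_shape_diagValue hH T α]
  refine Finset.sum_congr rfl fun κ _ => ?_
  split_ifs
  · exact hJ4 κ
  · exact integral_zero _ _

end Expectation

end VolterraSignature

end

theorem lemma5p1 {Ω : Type*} [MeasurableSpace Ω] (P : Measure Ω) (B : ℝ≥0 → Ω → ℝ)
    (hB : IsBrownianReal B P) (H : ℝ) (hH : 1 / 2 < H) (T : ℝ≥0) (hT : 0 < T)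
    (G V : ℝ → ℝ) (hG : ContDiff ℝ 4 G) (hV : ContDiff ℝ 3 V) :
    -- the coefficient functions; no function of order four may be one of order two
    ((∀ (α : Fin 7) (β : Fin 2),
        VolterraSignature.orderFourFun G V α ≠ VolterraSignature.orderTwoFun G V β) →
      VolterraSignature.coeffSet G V 5 \ VolterraSignature.coeffSet G V 3 =
        Set.range (VolterraSignature.orderFourFun G V)) ∧
    -- the expectations, for a function that differs from the eight other ones
    (∀ α : Fin 7,
      (∀ β : Fin 7, β ≠ α →
        VolterraSignature.orderFourFun G V α ≠ VolterraSignature.orderFourFun G V β) →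
      (∀ β : Fin 2,
        VolterraSignature.orderFourFun G V α ≠ VolterraSignature.orderTwoFun G V β) →
      ∀ N : ℕ, N = 4 ∨ N = 5 →
        (∃ Γ : Ω → ℝ, VolterraSignature.IsSignatureComponent B P H T G V N
          (VolterraSignature.orderFourFun G V α) Γ) ∧
        ∀ Γ : Ω → ℝ, VolterraSignature.IsSignatureComponent B P H T G V N
            (VolterraSignature.orderFourFun G V α) Γ →
          Integrable Γ P ∧
            ∫ ω, Γ ω ∂P = VolterraSignature.orderFourValue H T α) := by
  have hN45 : ∀ N : ℕ, N = 4 ∨ N = 5 → VolterraSignature.evenOrders N = {2, 4} := by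
    rintro N (rfl | rfl) <;> decide
  exact ⟨VolterraSignature.coeffSet_five_diff_three, fun α h4 h2 N hN =>
    VolterraSignature.integral_signatureComponent hB.toIsPreBrownianReal hH T h4 h2 (hN45 N hN)⟩
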